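/- Let $n\ge 1$ and $1\le k\le 2n-1$. On $\mathbb R^{2n}$ with coordinates $(x_1,\dots,x_n,y_1,\dots,y_n)$ let $\lambda_{\rm st}=\frac12\sum_{i=1}^n(x_i\,dy_i-y_i\,dx_i)$, let $\Pi_k$ be the span of the last $k$ vectors of the standard basis and $\Pi_k^\perp$ its orthogonal complement. Let $\xi_{\rm st}=\ker(\lambda_{\rm st}|_{S^{2n-1}})$ be the standard (cooriented) contact structure on the unit sphere. For a contact manifold $(U,\xi)$ let $\mathcal E(U,\xi)$ be the set of contact embeddings $\sigma:U\to U$ such that $\sigma$ is isotopic to the identity through a smooth family $(\sigma_t)_{t\in[0,1]}$ of contact embeddings $U\to U$ and $\sigma(U)$ has compact closure in $U$. A noncompact contact manifold $(U,\xi)$ is called convex at infinity if $\mathcal E(U,\xi)\neq\emptyset$. (a) $(S^{2n-1}\setminus\Pi_k,\xi_{\rm st})$ is a noncompact contact manifold which is convex at infinity. Moreover, for every open set $W\subset S^{2n-1}\setminus\Pi_k$ containing the equatorial sphere $S^{2n-1}\cap\Pi_k^\perp$ there exists $\sigma\in\mathcal E(S^{2n-1}\setminus\Pi_k,\xi_{\rm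 st})$ with $\sigma(S^{2n-1}\setminus\Pi_k)\subset W$. (b) If $k\ge n$, then $(S^{2n-1}\setminus\Pi_k,\xi_{\rm st})$ is contactomorphic to $J^1(S^{2n-k-1})\times\mathbb R^{2k-2n}$ with the contact structure $\ker(dz+p\,dq+\lambda_{\rm st})$, and also to $T^*(S^{2n-k-1}\times\mathbb R^{k-n})\times\mathbb R$ with the contact structure $\ker(dz+p\,dq)$. Here $J^1(M)=T^*M\times\mathbb R$, $z$ is the coordinate on $\mathbb R$, $p\,dq$ is the canonical Liouville form of the cotangent bundle, $\lambda_{\rm st}$ on $\mathbb R^{2k-2n}$ is as above with $k-n$ in place of $n$, and contactomorphisms are diffeomorphisms preserving the cooriented contact structures. -/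

import Mathlib

open scoped Manifold ContDiff

noncomputable section

/-! ## Contact manifolds given by a contact form

Contact structures are cooriented, `ξ = ker α`, and are represented by a form `α`.  All notions below
only depend on `α` up to multiplication by a positive function, that is, on the cooriented `ξ`. -/

section General

variable {E : Type*} [NormedAddCommGroup E] [NormedSpace ℝ E]
  {H : Type*} [TopologicalSpace H] (I : ModelWithCorners ℝ E H)
  {F : Type*} [NormedAddCommGroup F] [NormedSpace ℝ F]
  {G : Type*} [TopologicalSpace G] (J : ModelWithCorners ℝ F G)

/-- A (not necessarily continuous) differential 1-form on the manifold `M`. -/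
abbrev OneForm (M : Type*) [TopologicalSpace M] [ChartedSpace H M] : Type _ :=
  ∀ x : M, TangentSpace I x →L[ℝ] ℝ

variable {I J} {M : Type*} [TopologicalSpace M] [ChartedSpace H M]
  {N : Type*} [TopologicalSpace N] [ChartedSpace G N]

/-- The pullback `f^* β` of a 1-form. -/
def OneForm.pullback (f : M → N) (β : OneForm J N) : OneForm I M :=
  fun x => (β (f x)).comp (mfderiv I J f x)

/-- The coordinate expression of a 1-form in the preferred chart `φ` at `x₀`, i.e. the pullback
under `φ⁻¹`; it is meaningful on `φ.target`. -/
def OneForm.inChart (α : OneForm I M) (x₀ : M) : E → E →L[ℝ] ℝ :=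
  fun y => (α ((extChartAt I x₀).symm y)).comp (mfderiv 𝓘(ℝ, E) I (extChartAt I x₀).symm y)

/-- `α` is a contact form on the manifold without boundary `M`: it is smooth, nowhere zero, and `dα`
is nondegenerate on `ker α`.  In coordinates `dα (v, w) = Dα(v)(w) - Dα(w)(v)`. -/
structure IsContactForm (α : OneForm I M) : Prop where
  smooth : ∀ x₀ : M, ContDiffOn ℝ ∞ (α.inChart x₀) (extChartAt I x₀).target
  ne_zero : ∀ x : M, α x ≠ 0
  nondegenerate : ∀ x : M, ∀ v : E,
    α.inChart x (extChartAt I x x) v = 0 → v ≠ 0 →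
      ∃ w : E, α.inChart x (extChartAt I x x) w = 0 ∧
        fderiv ℝ (α.inChart x) (extChartAt I x x) v w
          - fderiv ℝ (α.inChart x) (extChartAt I x x) w v ≠ 0

/-- `f` respects the cooriented hyperplane fields `ker α` and `ker β`: the form `f^* β` is a positive
multiple of `α` at every point. -/
def IsConformal (α : OneForm I M) (β : OneForm J N) (f : M → N) : Prop :=
  ∀ x : M, ∃ c : ℝ, 0 < c ∧ OneForm.pullback (I := I) f β x = c • α x

/-- A contact embedding is a smooth embedding which respects the contact structures. -/
structure IsContactEmbedding (α : OneForm I M) (β : OneForm J N) (f : M → N) : Prop where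
  isSmoothEmbedding : Manifold.IsSmoothEmbedding I J ∞ f
  isConformal : IsConformal α β f

/-- `(M, ker α)` and `(N, ker β)` are contactomorphic. -/
def Contactomorphic (α : OneForm I M) (β : OneForm J N) : Prop :=
  ∃ Φ : Diffeomorph I J M N ∞, IsConformal α β Φ

/-- `σ` is contactly isotopic to the identity: there is a smooth family `h t`, `t ∈ [0, 1]`, of
contact embeddings of `M` into itself with `h 0 = id` and `h 1 = σ`. -/
def IsContactlyIsotopicToId (α : OneForm I M) (σ : M → M) : Prop :=
  ∃ h : ℝ → M → M,
    ContMDiffOn (𝓘(ℝ, ℝ).prod I) I ∞ (fun p : ℝ × M => h p.1 p.2)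
      (Set.Icc (0 : ℝ) 1 ×ˢ Set.univ) ∧
    (∀ t ∈ Set.Icc (0 : ℝ) 1, IsContactEmbedding α α (h t)) ∧
    h 0 = id ∧ h 1 = σ

/-- The set `𝓔(M, ker α)` of contact embeddings `σ : M → M` which are contactly isotopic to the
identity and whose image has compact closure in `M`. -/
def contractingEmbeddings (α : OneForm I M) : Set (M → M) :=
  {σ | IsContactEmbedding α α σ ∧ IsContactlyIsotopicToId α σ ∧ IsCompact (closure (Set.range σ))}

/-- The contact manifold `(M, ker α)` is noncompact and convex at infinity. -/
structure ConvexAtInfinity (α : OneForm I M) : Prop where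
  isContactForm : IsContactForm α
  noncompact : NoncompactSpace M
  nonempty : (contractingEmbeddings α).Nonempty

end General

/-! ## Cotangent bundles and 1-jet spaces -/

section Jet

variable {E : Type*} [NormedAddCommGroup E] [NormedSpace ℝ E]
  {H : Type*} [TopologicalSpace H] (I : ModelWithCorners ℝ E H)
  (M : Type*) [TopologicalSpace M] [ChartedSpace H M] [IsManifold I 1 M]

/-- The cotangent bundle `T^*M`, as a manifold: the bundle of continuous linear maps from the
tangent bundle to the trivial line bundle. -/
abbrev Cotangent : Type _ :=
  Bundle.TotalSpace (E →L[ℝ] ℝ) (fun x : M => TangentSpace I x →L[ℝ] ℝ)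

/-- The model of `T^*M`. -/
abbrev cotangentModel : ModelWithCorners ℝ (E × (E →L[ℝ] ℝ)) (ModelProd H (E →L[ℝ] ℝ)) :=
  I.prod 𝓘(ℝ, E →L[ℝ] ℝ)

/-- The canonical Liouville form `p dq` of `T^*M`: at a covector `η` over `q` it is the pullback
of `η` under the differential of the projection `T^*M → M`. -/
def canonicalLiouville : OneForm (cotangentModel I) (Cotangent I M) :=
  fun η => (show TangentSpace I η.proj →L[ℝ] ℝ from η.snd).comp
    (mfderiv (cotangentModel I) I (fun ζ : Cotangent I M => ζ.proj) η)

/-- The 1-jet space `J^1(M) = T^*M × ℝ`. -/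
abbrev Jet1 : Type _ := Cotangent I M × ℝ

/-- The model of `J^1(M)`. -/
abbrev jet1Model : ModelWithCorners ℝ ((E × (E →L[ℝ] ℝ)) × ℝ)
    (ModelProd (ModelProd H (E →L[ℝ] ℝ)) ℝ) :=
  (cotangentModel I).prod 𝓘(ℝ, ℝ)

/-- The standard contact form `dz + p dq` of `J^1(M) = T^*M × ℝ`. -/
def jet1Form : OneForm (jet1Model I) (Jet1 I M) :=
  fun a =>
    OneForm.pullback (I := jet1Model I) (J := 𝓘(ℝ, ℝ)) (fun b : Jet1 I M => b.2)
      (fun _ => ContinuousLinearMap.id ℝ ℝ) a +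
    OneForm.pullback (I := jet1Model I) (J := cotangentModel I) (fun b : Jet1 I M => b.1)
      (canonicalLiouville I M) a

end Jet

/-! ## The standard contact sphere -/

/-- The unit sphere `S^{d-1}` in `ℝ^d`. -/
abbrev UnitSphere (d : ℕ) : Type := Metric.sphere (0 : EuclideanSpace ℝ (Fin d)) 1

/-- This provides Mathlib's manifold structure, of dimension `d - 1`, on the unit sphere of `ℝ^d`
for `d ≠ 0`. -/
instance factFinrankEuclidean (d : ℕ) [NeZero d] :
    Fact (Module.finrank ℝ (EuclideanSpace ℝ (Fin d)) = (d - 1) + 1) :=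
  ⟨by have := NeZero.pos d; rw [finrank_euclideanSpace_fin]; omega⟩

/-- The position of the coordinate `x_i` among `(x_1, …, x_n, y_1, …, y_n)`. -/
def xIdx {n : ℕ} (i : Fin n) : Fin (2 * n) := ⟨i, by omega⟩

/-- The position of the coordinate `y_i` among `(x_1, …, x_n, y_1, …, y_n)`. -/
def yIdx {n : ℕ} (i : Fin n) : Fin (2 * n) := ⟨n + i, by omega⟩

/-- The standard Liouville form `λ_st = ½ ∑ (x_i dy_i - y_i dx_i)` on `ℝ^{2n}`. -/
def stdLiouville (n : ℕ) (v : EuclideanSpace ℝ (Fin (2 * n))) :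
    EuclideanSpace ℝ (Fin (2 * n)) →L[ℝ] ℝ :=
  (1 / 2 : ℝ) • ∑ i : Fin n,
    (v (xIdx i) • (EuclideanSpace.proj (yIdx i) : EuclideanSpace ℝ (Fin (2 * n)) →L[ℝ] ℝ)
      - v (yIdx i) • (EuclideanSpace.proj (xIdx i) : EuclideanSpace ℝ (Fin (2 * n)) →L[ℝ] ℝ))

/-- The subspace `Π_k ⊆ ℝ^{2n}` spanned by the last `k` vectors of the standard basis. -/
def coordPlane (n k : ℕ) : Submodule ℝ (EuclideanSpace ℝ (Fin (2 * n))) :=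
  Submodule.span ℝ {v | ∃ i : Fin (2 * n), 2 * n ≤ (i : ℕ) + k ∧ v = EuclideanSpace.single i 1}

/-- The open subset `S^{2n-1} ∖ Π_k` of the sphere. -/
def sphereCompl (n k : ℕ) : TopologicalSpace.Opens (UnitSphere (2 * n)) where
  carrier := {x | (x : EuclideanSpace ℝ (Fin (2 * n))) ∉ coordPlane n k}
  is_open' :=
    ((coordPlane n k).closed_of_finiteDimensional.preimage continuous_subtype_val).isOpen_compl

/-- The standard contact form on `S^{2n-1} ∖ Π_k`, the restriction of `λ_st`. -/
def sphereForm (n k : ℕ) [NeZero n] : OneForm (𝓡 (2 * n - 1)) (sphereCompl n k) :=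
  OneForm.pullback (J := 𝓘(ℝ, EuclideanSpace ℝ (Fin (2 * n))))
    (fun x : sphereCompl n k => ((x : UnitSphere (2 * n)) : EuclideanSpace ℝ (Fin (2 * n))))
    (stdLiouville n)

/-- The contact form `(dz + p dq) + λ_st` on `J^1(S^{d-1}) × ℝ^{2l}`. -/
def jetTimesForm (d l : ℕ) [NeZero d] :
    OneForm ((jet1Model (𝓡 (d - 1))).prod 𝓘(ℝ, EuclideanSpace ℝ (Fin (2 * l))))
      (Jet1 (𝓡 (d - 1)) (UnitSphere d) × EuclideanSpace ℝ (Fin (2 * l))) :=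
  fun a =>
    OneForm.pullback (J := jet1Model (𝓡 (d - 1)))
        (fun b : Jet1 (𝓡 (d - 1)) (UnitSphere d) × EuclideanSpace ℝ (Fin (2 * l)) => b.1)
        (jet1Form (𝓡 (d - 1)) (UnitSphere d)) a +
      OneForm.pullback (J := 𝓘(ℝ, EuclideanSpace ℝ (Fin (2 * l))))
        (fun b : Jet1 (𝓡 (d - 1)) (UnitSphere d) × EuclideanSpace ℝ (Fin (2 * l)) => b.2)
        (stdLiouville l) a

/-- The contact form `dz + p dq` on `T^*(S^{d-1} × ℝ^l) × ℝ`. -/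
def jetProdForm (d l : ℕ) [NeZero d] :
    OneForm (jet1Model ((𝓡 (d - 1)).prod 𝓘(ℝ, EuclideanSpace ℝ (Fin l))))
      (Jet1 ((𝓡 (d - 1)).prod 𝓘(ℝ, EuclideanSpace ℝ (Fin l)))
        (UnitSphere d × EuclideanSpace ℝ (Fin l))) :=
  jet1Form ((𝓡 (d - 1)).prod 𝓘(ℝ, EuclideanSpace ℝ (Fin l)))
    (UnitSphere d × EuclideanSpace ℝ (Fin l))

end

/-! Contact geometry of an open subset of the sphere is homogeneous geometry of the cone over it: a
map of the cone `ℝ^{2n} ∖ Π_k` which commutes with positive dilations and preserves `λ_st` descends,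
by radial projection, to a contact map of `S^{2n-1} ∖ Π_k`.

Split the conjugate pairs of coordinates so that `ℝ^{2n}` becomes the space of triples `(q, p, w)`
with `q, p ∈ ℝ^m`, `w ∈ ℝ^{2l}`, and `λ_st = ½(q dp - p dq + w ∧ dw)`. If `k ≥ n`, take `m = 2n -
k`, so that `Π_k = {q = 0}`; if `k ≤ n`, take `m = k`, so that `Π_k = {q = 0, w = 0}`. With `c = 0`
and `c = 1` respectively, the cone is `{R > 0}` for `R = |q|² + c|w|²`, and the equator is the part
of the unit sphere where `R = 1`.

For (a) it suffices to find, for each `b > 0`, a homogeneous `λ_st`-preserving isotopy from the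
identity to an embedding of the cone into `{|v|² ≤ (1 + b) R(v)}`: on the sphere these regions are
compact in the complement of `Π_k`, and they shrink to the equator. Explicit coordinates
(`toCotangent`) turn the form into `ξ dx + ½ w ∧ dw`, with `x` of degree 0 and `ξ` of degree 2. The
cotangent lift of a contraction of `x`-space into a small ball (`contractLift`) then makes `|p|²`
small relative to `R`. If `c = 0`, `|w|²` must be made small as well; the flow `inflate` does so by
replacing `|ξ|`, which is then `R`, by `|ξ| + K|w|²`. The composite is `coneContraction`, and
`exists_contractingEmbedding` brings it to the sphere.

For (b), where `c = 0`, the sphere is replaced by the slice `|q| = 1`, which meets every ray of the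
cone once; the kernel of the form is unchanged because `λ_st` vanishes on the radial direction. On
the slice, `z = ½⟪q, p⟫` and the covector `-p` restricted to `T_q S^{m-1}` give `dz - p dq = ½(q dp
- p dq)`, which is the first model. Writing `w = (x, y)` and treating this pair like `(q, p)` gives
the second. -/

open scoped Manifold ContDiff

noncomputable section

set_option linter.unusedSectionVars false

/-! ### Maps preserving one-forms on normed spaces -/

section PreservesForm

variable {A B C : Type*} [NormedAddCommGroup A] [NormedSpace ℝ A]
  [NormedAddCommGroup B] [NormedSpace ℝ B] [NormedAddCommGroup C] [NormedSpace ℝ C]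

/-- `f` is differentiable at `x` and pulls the one-form `β` back to `α` there. -/
def PreservesFormAt (α : A → A → ℝ) (β : B → B → ℝ) (f : A → B) (x : A) : Prop :=
  DifferentiableAt ℝ f x ∧ ∀ h, β (f x) (fderiv ℝ f x h) = α x h

theorem PreservesFormAt.comp {α : A → A → ℝ} {β : B → B → ℝ} {γ : C → C → ℝ} {g : B → C}
    {f : A → B} {x : A} (hg : PreservesFormAt β γ g (f x)) (hf : PreservesFormAt α β f x) :
    PreservesFormAt α γ (g ∘ f) x := by
  refine ⟨hg.1.comp x hf.1, fun h => ?_⟩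
  rw [fderiv_comp x hg.1 hf.1]
  simp only [Function.comp_apply, ContinuousLinearMap.comp_apply]
  rw [hg.2, hf.2]

/-- A local right inverse of a form-preserving map preserves forms. -/
theorem PreservesFormAt.of_rightInverse {α : A → A → ℝ} {β : B → B → ℝ} {f : A → B} {g : B → A}
    {y : B} (hf : PreservesFormAt α β f (g y)) (hg : DifferentiableAt ℝ g y)
    (h : f ∘ g =ᶠ[nhds y] id) : PreservesFormAt β α g y := by
  refine ⟨hg, fun v => ?_⟩
  have h1 : fderiv ℝ (f ∘ g) y = ContinuousLinearMap.id ℝ B := by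
    rw [h.fderiv_eq, fderiv_id]
  have h2 : f (g y) = y := h.eq_of_nhds
  rw [fderiv_comp y hf.1 hg] at h1
  rw [← hf.2, h2]
  congr 1
  exact DFunLike.congr_fun h1 v

/-- The derivative along a line computes the Fréchet derivative. -/
theorem DifferentiableAt.hasDerivAt_line {f : A → B} {x : A} (hf : DifferentiableAt ℝ f x) (h : A) :
    HasDerivAt (fun s : ℝ => f (x + s • h)) (fderiv ℝ f x h) 0 := by
  have h1 : HasDerivAt (fun s : ℝ => x + s • h) h 0 := by
    simpa using ((hasDerivAt_id (0 : ℝ)).smul_const h).const_add x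
  have h2 : HasFDerivAt f (fderiv ℝ f x) ((fun s : ℝ => x + s • h) 0) := by
    simpa using hf.hasFDerivAt
  exact h2.comp_hasDerivAt 0 h1

end PreservesForm

/-! ### Complex structures and rotations -/

/-- `J` is an orthogonal complex structure. -/
structure IsComplexStructure {Z : Type*} [NormedAddCommGroup Z] [InnerProductSpace ℝ Z]
    (J : Z →L[ℝ] Z) : Prop where
  inner_self : ∀ w, inner ℝ (J w) w = 0
  inner_map : ∀ w v, inner ℝ (J w) (J v) = inner ℝ w v
  sq : ∀ w, J (J w) = -w

section Models

variable {V Z : Type*} [NormedAddCommGroup V] [InnerProductSpace ℝ V]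
  [NormedAddCommGroup Z] [InnerProductSpace ℝ Z]

/-- The rotation by the angle `θ` defined by a complex structure. -/
def rotate (J : Z →L[ℝ] Z) (θ : ℝ) (w : Z) : Z := Real.cos θ • w + Real.sin θ • J w

theorem rotate_zero (J : Z →L[ℝ] Z) (w : Z) : rotate J 0 w = w := by simp [rotate]

theorem rotate_smul (J : Z →L[ℝ] Z) (θ a : ℝ) (w : Z) : rotate J θ (a • w) = a • rotate J θ w := by
  simp only [rotate, map_smul, smul_add, smul_comm a]

theorem IsComplexStructure.inner_map_left {J : Z →L[ℝ] Z} (hJ : IsComplexStructure J) (w v : Z) :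
    inner ℝ (J w) v = -inner ℝ w (J v) := by
  have := hJ.inner_map w (J v)
  rw [hJ.sq, inner_neg_right] at this
  linarith

theorem IsComplexStructure.inner_self_right {J : Z →L[ℝ] Z} (hJ : IsComplexStructure J) (w : Z) :
    inner ℝ w (J w) = 0 := by
  rw [real_inner_comm]; exact hJ.inner_self w

theorem IsComplexStructure.norm_sq_rotate {J : Z →L[ℝ] Z} (hJ : IsComplexStructure J) (θ : ℝ)
    (w : Z) : ‖rotate J θ w‖ ^ 2 = ‖w‖ ^ 2 := by
  rw [rotate, ← real_inner_self_eq_norm_sq, ← real_inner_self_eq_norm_sq]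
  simp only [inner_add_left, inner_add_right, inner_smul_left, inner_smul_right, hJ.inner_map,
    hJ.inner_self, hJ.inner_self_right, conj_trivial]
  linear_combination (inner ℝ w w) * Real.sin_sq_add_cos_sq θ

theorem IsComplexStructure.rotate_rotate {J : Z →L[ℝ] Z} (hJ : IsComplexStructure J) (θ φ : ℝ)
    (w : Z) : rotate J θ (rotate J φ w) = rotate J (θ + φ) w := by
  simp only [rotate, map_add, map_smul, hJ.sq, Real.cos_add, Real.sin_add]
  module

/-- The derivative of `½ w ∧ dw` under a variable rotation. -/
theorem IsComplexStructure.hasDerivAt_rotate {J : Z →L[ℝ] Z} (hJ : IsComplexStructure J)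
    {θ : ℝ → ℝ} {w : ℝ → Z} {θ' : ℝ} {w' : Z} {s : ℝ} (hθ : HasDerivAt θ θ' s)
    (hw : HasDerivAt w w' s) :
    ∃ d : Z, HasDerivAt (fun s => rotate J (θ s) (w s)) d s ∧
      inner ℝ (J (rotate J (θ s) (w s))) d = inner ℝ (J (w s)) w' + θ' * ‖w s‖ ^ 2 := by
  refine ⟨_, (hθ.cos.smul hw).add (hθ.sin.smul (J.hasFDerivAt.comp_hasDerivAt s hw)), ?_⟩
  rw [← real_inner_self_eq_norm_sq]
  simp only [rotate, map_add, map_smul, hJ.sq, inner_add_left, inner_add_right, inner_smul_left,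
    inner_smul_right, hJ.inner_map, hJ.inner_self, hJ.inner_self_right, conj_trivial,
    inner_neg_left]
  have h1 := Real.sin_sq_add_cos_sq (θ s)
  have h2 := hJ.inner_map_left (w s) w'
  linear_combination (inner ℝ (J (w s)) w' + θ' * inner ℝ (w s) (w s)) * h1 -
    Real.sin (θ s) ^ 2 * h2

theorem ContDiffAt.rotate {A : Type*} [NormedAddCommGroup A] [NormedSpace ℝ A] {J : Z →L[ℝ] Z}
    {θ : A → ℝ} {w : A → Z} {x : A} (hθ : ContDiffAt ℝ ∞ θ x) (hw : ContDiffAt ℝ ∞ w x) :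
    ContDiffAt ℝ ∞ (fun y => rotate J (θ y) (w y)) x :=
  (hθ.cos.smul hw).add (hθ.sin.smul (J.contDiff.contDiffAt.comp x hw))

/-! ### The explicit maps of the model cone and their inverses -/

variable (J : Z →L[ℝ] Z) (c : ℝ)

/-- The Liouville form `½ (q dp - p dq + w ∧ dw)`. -/
def linearLiouville (y h : V × V × Z) : ℝ :=
  1 / 2 * (inner ℝ y.1 h.2.1 - inner ℝ y.2.1 h.1 + inner ℝ (J y.2.2) h.2.2)

/-- The Liouville form `ξ dx + ½ w ∧ dw`, at points written as `(x, ξ, w)`. -/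
def cotangentLiouville (y h : V × V × Z) : ℝ :=
  inner ℝ y.2.1 h.1 + 1 / 2 * inner ℝ (J y.2.2) h.2.2

/-- The quadratic form `|q|² + c |w|²`. -/
def coneSize (y : V × V × Z) : ℝ := ‖y.1‖ ^ 2 + c * ‖y.2.2‖ ^ 2

/-- The function `⟪q, p⟫ / (2 |q|² + c |w|²)`. -/
def coneSlope (y : V × V × Z) : ℝ := inner ℝ y.1 y.2.1 / (coneSize c y + ‖y.1‖ ^ 2)

/-- A homogeneous symplectic change of coordinates from `(q, p, w)` to cotangent coordinates
`(x, ξ, w)`, where `x` has degree `0` and `ξ` has degree `2`. -/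
def toCotangent (y : V × V × Z) : V × V × Z :=
  ((√(coneSize c y))⁻¹ • (y.2.1 - coneSlope c y • y.1), √(coneSize c y) • y.1,
    rotate J (-(c * coneSlope c y)) y.2.2)

/-- The function `|q|² + c |w|²` in cotangent coordinates. -/
def cotangentSize (y : V × V × Z) : ℝ :=
  (c * ‖y.2.2‖ ^ 2 + √((c * ‖y.2.2‖ ^ 2) ^ 2 + 4 * ‖y.2.1‖ ^ 2)) / 2

/-- The inverse of `toCotangent`. -/
def ofCotangent (y : V × V × Z) : V × V × Z :=
  ((√(cotangentSize c y))⁻¹ • y.2.1,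
    √(cotangentSize c y) • y.1 +
      (inner ℝ y.1 y.2.1 / cotangentSize c y) • (√(cotangentSize c y))⁻¹ • y.2.1,
    rotate J (c * (inner ℝ y.1 y.2.1 / cotangentSize c y)) y.2.2)

/-- The cotangent lift of the contraction `x ↦ x / √(1 + τ |x|²)`. -/
def contractLift (τ : ℝ) (y : V × V × Z) : V × V × Z :=
  ((√(1 + τ * ‖y.1‖ ^ 2))⁻¹ • y.1,
    √(1 + τ * ‖y.1‖ ^ 2) • (y.2.1 + (τ * inner ℝ y.1 y.2.1) • y.1), y.2.2)

/-- The flow of the Hamiltonian `|w|² ⟪x, ξ⟫ / |ξ|`. -/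
def inflate (K : ℝ) (y : V × V × Z) : V × V × Z :=
  ((1 + K * ‖y.2.2‖ ^ 2 / ‖y.2.1‖)⁻¹ • y.1 +
      ((1 - (1 + K * ‖y.2.2‖ ^ 2 / ‖y.2.1‖)⁻¹) * (inner ℝ y.1 y.2.1 / ‖y.2.1‖)) •
        (‖y.2.1‖⁻¹ • y.2.1),
    (1 + K * ‖y.2.2‖ ^ 2 / ‖y.2.1‖) • y.2.1,
    rotate J (-(2 * K * (inner ℝ y.1 y.2.1 / ‖y.2.1‖))) y.2.2)

variable {c}

/-- Since `|ξ|² = R|q|²` and `|w|` is unchanged, `R` is the positive root of `R² = c|w|²R + |ξ|²`.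
The discriminant is the square of `2|q|² + c|w|²`. -/
theorem coneSize_toCotangent {y : V × V × Z} (hJ : IsComplexStructure J) (hc : 0 ≤ c) :
    cotangentSize c (toCotangent J c y) = coneSize c y := by
  have h0 : 0 ≤ coneSize c y := by unfold coneSize; positivity
  have h2 : ‖√(coneSize c y) • y.1‖ ^ 2 = coneSize c y * ‖y.1‖ ^ 2 := by
    rw [norm_smul, mul_pow, Real.norm_eq_abs, sq_abs, Real.sq_sqrt h0]
  simp only [cotangentSize, toCotangent, hJ.norm_sq_rotate, h2]
  have : (c * ‖y.2.2‖ ^ 2) ^ 2 + 4 * (coneSize c y * ‖y.1‖ ^ 2)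
      = (2 * ‖y.1‖ ^ 2 + c * ‖y.2.2‖ ^ 2) ^ 2 := by unfold coneSize; ring
  rw [this, Real.sqrt_sq (by positivity)]
  unfold coneSize; ring

/-- The domain of `ofCotangent`, where `ξ ≠ 0` or `c |w|² ≠ 0`. -/
def cotangentDomain (c : ℝ) : Set (V × V × Z) := {y | 0 < cotangentSize c y}

/-- The domain of `toCotangent`, where `q ≠ 0` or `c |w|² ≠ 0`. -/
def coneDomain (c : ℝ) : Set (V × V × Z) := {y | 0 < coneSize c y}

theorem cotangentSize_sq (y : V × V × Z) :
    cotangentSize c y ^ 2 = c * ‖y.2.2‖ ^ 2 * cotangentSize c y + ‖y.2.1‖ ^ 2 := by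
  have := Real.sq_sqrt (show 0 ≤ (c * ‖y.2.2‖ ^ 2) ^ 2 + 4 * ‖y.2.1‖ ^ 2 by positivity)
  unfold cotangentSize
  linear_combination this / 4

theorem coneSize_ofCotangent {y : V × V × Z} (hJ : IsComplexStructure J)
    (hy : y ∈ cotangentDomain c) : coneSize c (ofCotangent J c y) = cotangentSize c y := by
  have h0 : 0 < cotangentSize c y := hy
  simp only [coneSize, ofCotangent, hJ.norm_sq_rotate, norm_smul, mul_pow, norm_inv, inv_pow,
    Real.norm_eq_abs, sq_abs, Real.sq_sqrt h0.le]
  field_simp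
  linear_combination - (cotangentSize_sq (c := c) y)

/-- The slope `β` survives in the new coordinates: `⟪x, ξ⟫ = ⟪q, p⟫ - β|q|² = βR`, because `β(R +
|q|²) = ⟪q, p⟫`. Once `R` and `β` are known, the three components are solved for `q`, `p` and `w`.
-/
theorem ofCotangent_toCotangent (hJ : IsComplexStructure J) (hc : 0 ≤ c) {y : V × V × Z}
    (hy : y ∈ coneDomain c) : ofCotangent J c (toCotangent J c y) = y := by
  have h0 : 0 < coneSize c y := hy
  have hs : √(coneSize c y) ≠ 0 := by positivity
  have hA : 0 < coneSize c y + ‖y.1‖ ^ 2 := by positivity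
  have hβ : inner ℝ (toCotangent J c y).1 (toCotangent J c y).2.1 / coneSize c y
      = coneSlope c y := by
    simp only [toCotangent, inner_smul_left, inner_smul_right, inner_sub_left, conj_trivial]
    rw [real_inner_self_eq_norm_sq, real_inner_comm, coneSlope]
    field_simp
    ring
  have h1 : ofCotangent J c (toCotangent J c y) =
    ((√(coneSize c y))⁻¹ • (toCotangent J c y).2.1,
      √(coneSize c y) • (toCotangent J c y).1 +
      coneSlope c y • (√(coneSize c y))⁻¹ • (toCotangent J c y).2.1,
    rotate J (c * coneSlope c y) (toCotangent J c y).2.2) := by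
    simp only [ofCotangent, coneSize_toCotangent J hJ hc, hβ]
  rw [h1]
  simp only [toCotangent, hJ.rotate_rotate, smul_smul, inv_mul_cancel₀ hs, mul_inv_cancel₀ hs,
    one_smul, add_neg_cancel, rotate_zero]
  ext <;> simp

theorem toCotangent_ofCotangent (hJ : IsComplexStructure J) {y : V × V × Z}
    (hy : y ∈ cotangentDomain c) : toCotangent J c (ofCotangent J c y) = y := by
  have h0 : 0 < cotangentSize c y := hy
  have hs : √(cotangentSize c y) ≠ 0 := by positivity
  have hss : √(cotangentSize c y) * √(cotangentSize c y) = cotangentSize c y :=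
    Real.mul_self_sqrt h0.le
  have hβ : coneSlope c (ofCotangent J c y) = inner ℝ y.1 y.2.1 / cotangentSize c y := by
    rw [coneSlope, coneSize_ofCotangent J hJ hy]
    simp only [ofCotangent, inner_smul_left, inner_smul_right, inner_add_right, conj_trivial,
      norm_smul, mul_pow, norm_inv, inv_pow, Real.norm_eq_abs, sq_abs, Real.sq_sqrt h0.le]
    rw [real_inner_self_eq_norm_sq, real_inner_comm]
    have : √(cotangentSize c y) ^ 2 = cotangentSize c y := Real.sq_sqrt h0.le
    field_simp
    rw [this]
    field_simp
  have h1 : toCotangent J c (ofCotangent J c y) =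
      ((√(cotangentSize c y))⁻¹ • ((ofCotangent J c y).2.1 -
        (inner ℝ y.1 y.2.1 / cotangentSize c y) • (ofCotangent J c y).1),
      √(cotangentSize c y) • (ofCotangent J c y).1,
      rotate J (-(c * (inner ℝ y.1 y.2.1 / cotangentSize c y))) (ofCotangent J c y).2.2) := by
    simp only [toCotangent, coneSize_ofCotangent J hJ hy, hβ]
  rw [h1]
  simp only [ofCotangent, hJ.rotate_rotate, smul_smul, mul_inv_cancel₀ hs,
    one_smul, neg_add_cancel, rotate_zero, add_sub_cancel_right, inv_mul_cancel₀ hs]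

/-- The base map sends `1/|x|²` to `1/|x|² + τ` and keeps directions, so these maps form a local
one-parameter group in `τ`, and so do their cotangent lifts. -/
theorem contractLift_contractLift {τ : ℝ} {y : V × V × Z} (hy : 0 < 1 + τ * ‖y.1‖ ^ 2) :
    contractLift (-τ) (contractLift τ y) = y := by
  have hs : √(1 + τ * ‖y.1‖ ^ 2) ≠ 0 := by positivity
  have hss : √(1 + τ * ‖y.1‖ ^ 2) ^ 2 = 1 + τ * ‖y.1‖ ^ 2 := Real.sq_sqrt hy.le
  have h1 : 1 + -τ * ‖(contractLift τ y).1‖ ^ 2 = (1 + τ * ‖y.1‖ ^ 2)⁻¹ := by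
    simp only [contractLift, norm_smul, mul_pow, norm_inv, inv_pow, Real.norm_eq_abs, sq_abs, hss]
    field_simp
    ring
  have h2 : inner ℝ (contractLift τ y).1 (contractLift τ y).2.1
      = inner ℝ y.1 y.2.1 * (1 + τ * ‖y.1‖ ^ 2) := by
    simp only [contractLift, inner_smul_left, inner_smul_right, inner_add_right, conj_trivial,
      real_inner_self_eq_norm_sq]
    field_simp
  rw [contractLift, h1, h2, Real.sqrt_inv, inv_inv]
  simp only [contractLift, smul_smul, mul_inv_cancel₀ hs, one_smul, smul_add]
  ext
  · rfl
  · simp only [inv_mul_cancel₀ hs, one_smul]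
    rw [add_assoc, ← add_smul]
    convert! add_zero _
    convert! zero_smul ℝ _
    field_simp
    rw [hss]; ring
  · rfl

/-- The quantities `|w|²` and `⟪x, ξ⟫ / |ξ|` are conserved while `|ξ|` becomes `|ξ| + K|w|²`, so the
scaling factor for `-K` at the image is the inverse of the one for `K` at the start. -/
theorem inflate_inflate (hJ : IsComplexStructure J) {K : ℝ} {y : V × V × Z} (hy : y.2.1 ≠ 0)
    (hK : 0 < 1 + K * ‖y.2.2‖ ^ 2 / ‖y.2.1‖) : inflate J (-K) (inflate J K y) = y := by
  have hn : ‖y.2.1‖ ≠ 0 := by positivity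
  have h1 : ‖(inflate J K y).2.1‖ = (1 + K * ‖y.2.2‖ ^ 2 / ‖y.2.1‖) * ‖y.2.1‖ := by
    rw [inflate, norm_smul, Real.norm_eq_abs, abs_of_pos hK]
  have h2 : ‖(inflate J K y).2.2‖ ^ 2 = ‖y.2.2‖ ^ 2 := by rw [inflate, hJ.norm_sq_rotate]
  have h3 : inner ℝ (inflate J K y).1 (inflate J K y).2.1 / ‖(inflate J K y).2.1‖
      = inner ℝ y.1 y.2.1 / ‖y.2.1‖ := by
    rw [h1]
    simp only [inflate, inner_smul_left, inner_smul_right, inner_add_left, conj_trivial,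
      real_inner_self_eq_norm_sq]
    generalize 1 + K * ‖y.2.2‖ ^ 2 / ‖y.2.1‖ = μ at hK
    field_simp
    ring
  have h4 : 1 + -K * ‖(inflate J K y).2.2‖ ^ 2 / ‖(inflate J K y).2.1‖
      = (1 + K * ‖y.2.2‖ ^ 2 / ‖y.2.1‖)⁻¹ := by
    rw [h1, h2]
    have : (1 + K * ‖y.2.2‖ ^ 2 / ‖y.2.1‖) * ‖y.2.1‖ = ‖y.2.1‖ + K * ‖y.2.2‖ ^ 2 := by field_simp
    have h5 : ‖y.2.1‖ + K * ‖y.2.2‖ ^ 2 ≠ 0 := by rw [← this]; positivity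
    rw [this, show 1 + K * ‖y.2.2‖ ^ 2 / ‖y.2.1‖ = (‖y.2.1‖ + K * ‖y.2.2‖ ^ 2) / ‖y.2.1‖ by
      field_simp]
    field_simp
    ring
  rw [inflate, h3, h4, h1]
  simp only [inflate]
  generalize 1 + K * ‖y.2.2‖ ^ 2 / ‖y.2.1‖ = μ at hK
  have hμ : μ ≠ 0 := hK.ne'
  rw [hJ.rotate_rotate]
  ext
  · simp only [inv_inv, smul_smul, smul_add, mul_inv_cancel₀ hμ, one_smul]
    rw [add_assoc, ← add_smul]
    convert! add_zero _
    convert! zero_smul ℝ _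
    field_simp
    ring
  · simp [smul_smul, inv_mul_cancel₀ hμ]
  · convert! rotate_zero J y.2.2
    ring

end Models

/-! ### Smoothness of the model maps and invariance of the Liouville forms -/

section ModelsSmooth

variable {V Z : Type*} [NormedAddCommGroup V] [InnerProductSpace ℝ V]
  [NormedAddCommGroup Z] [InnerProductSpace ℝ Z] (J : Z →L[ℝ] Z) {c : ℝ}

theorem contDiff_coneSize : ContDiff ℝ ∞ (coneSize c : V × V × Z → ℝ) := by
  unfold coneSize
  exact (contDiff_fst.norm_sq ℝ).add (contDiff_const.mul (contDiff_snd.snd.norm_sq ℝ))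

theorem contDiffAt_coneSlope {y : V × V × Z} (hy : y ∈ coneDomain c) :
    ContDiffAt ℝ ∞ (coneSlope c : V × V × Z → ℝ) y := by
  have h0 : 0 < coneSize c y := hy
  unfold coneSlope
  refine (contDiff_fst.inner ℝ contDiff_snd.fst).contDiffAt.div
    (contDiff_coneSize.add (contDiff_fst.norm_sq ℝ)).contDiffAt ?_
  positivity

theorem contDiffAt_toCotangent {y : V × V × Z} (hy : y ∈ coneDomain c) :
    ContDiffAt ℝ ∞ (toCotangent J c : V × V × Z → V × V × Z) y := by
  have h0 : 0 < coneSize c y := hy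
  have h1 : ContDiffAt ℝ ∞ (fun y : V × V × Z => √(coneSize c y)) y :=
    contDiff_coneSize.contDiffAt.sqrt h0.ne'
  have h2 := contDiffAt_coneSlope hy
  unfold toCotangent
  refine ContDiffAt.prodMk ?_ (ContDiffAt.prodMk ?_ ?_)
  · refine (h1.inv (by positivity)).smul (contDiffAt_snd.fst.sub (h2.smul contDiffAt_fst))
  · exact h1.smul contDiffAt_fst
  · exact (contDiffAt_const.mul h2).neg.rotate contDiffAt_snd.snd

/-- Keeps the radicand in `cotangentSize` away from zero, where the square root is not smooth. -/
theorem sq_add_pos_of_mem_cotangentDomain {y : V × V × Z} (hy : y ∈ cotangentDomain c) :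
    0 < (c * ‖y.2.2‖ ^ 2) ^ 2 + 4 * ‖y.2.1‖ ^ 2 := by
  have h0 : 0 < cotangentSize c y := hy
  by_contra h
  have h1 : c * ‖y.2.2‖ ^ 2 = 0 := by nlinarith [sq_nonneg (c * ‖y.2.2‖ ^ 2), sq_nonneg ‖y.2.1‖]
  have h2 : ‖y.2.1‖ ^ 2 = 0 := by nlinarith [sq_nonneg (c * ‖y.2.2‖ ^ 2), sq_nonneg ‖y.2.1‖]
  simp [cotangentSize, h1, h2] at h0

theorem contDiffAt_cotangentSize {y : V × V × Z} (hy : y ∈ cotangentDomain c) :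
    ContDiffAt ℝ ∞ (cotangentSize c : V × V × Z → ℝ) y := by
  unfold cotangentSize
  have h1 : ContDiffAt ℝ ∞ (fun y : V × V × Z => c * ‖y.2.2‖ ^ 2) y :=
    contDiffAt_const.mul (contDiffAt_snd.snd.norm_sq ℝ)
  refine ContDiffAt.div_const (h1.add (ContDiffAt.sqrt ?_ ?_)) 2
  · exact (h1.pow 2).add (contDiffAt_const.mul (contDiffAt_snd.fst.norm_sq ℝ))
  · exact (sq_add_pos_of_mem_cotangentDomain hy).ne'

theorem contDiffAt_ofCotangent {y : V × V × Z} (hy : y ∈ cotangentDomain c) :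
    ContDiffAt ℝ ∞ (ofCotangent J c : V × V × Z → V × V × Z) y := by
  have h0 : 0 < cotangentSize c y := hy
  have h1 : ContDiffAt ℝ ∞ (fun y : V × V × Z => √(cotangentSize c y)) y :=
    (contDiffAt_cotangentSize hy).sqrt h0.ne'
  have h2 : ContDiffAt ℝ ∞ (fun y : V × V × Z => inner ℝ y.1 y.2.1 / cotangentSize c y) y :=
    (contDiffAt_fst.inner ℝ contDiffAt_snd.fst).div (contDiffAt_cotangentSize hy) h0.ne'
  have h3 := h1.inv (by positivity)
  unfold ofCotangent
  refine ContDiffAt.prodMk ?_ (ContDiffAt.prodMk ?_ ?_)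
  · exact h3.smul contDiffAt_snd.fst
  · exact (h1.smul contDiffAt_fst).add (h2.smul (h3.smul contDiffAt_snd.fst))
  · exact (contDiffAt_const.mul h2).rotate contDiffAt_snd.snd

theorem contDiffAt_contractLift {u : ℝ × V × V × Z} (hu : 0 < 1 + u.1 * ‖u.2.1‖ ^ 2) :
    ContDiffAt ℝ ∞ (fun u : ℝ × V × V × Z => contractLift u.1 u.2) u := by
  have h1 : ContDiffAt ℝ ∞ (fun u : ℝ × V × V × Z => √(1 + u.1 * ‖u.2.1‖ ^ 2)) u :=
    (contDiffAt_const.add (contDiffAt_fst.mul (contDiffAt_snd.fst.norm_sq ℝ))).sqrt hu.ne'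
  have h2 : ContDiffAt ℝ ∞ (fun u : ℝ × V × V × Z => u.1 * inner ℝ u.2.1 u.2.2.1) u :=
    contDiffAt_fst.mul (contDiffAt_snd.fst.inner ℝ contDiffAt_snd.snd.fst)
  unfold contractLift
  refine ContDiffAt.prodMk ?_ (ContDiffAt.prodMk ?_ ?_)
  · exact (h1.inv (by positivity)).smul contDiffAt_snd.fst
  · exact h1.smul (contDiffAt_snd.snd.fst.add (h2.smul contDiffAt_snd.fst))
  · exact contDiffAt_snd.snd.snd

theorem contDiffAt_inflate {u : ℝ × V × V × Z} (hu : u.2.2.1 ≠ 0)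
    (hK : 0 < 1 + u.1 * ‖u.2.2.2‖ ^ 2 / ‖u.2.2.1‖) :
    ContDiffAt ℝ ∞ (fun u : ℝ × V × V × Z => inflate J u.1 u.2) u := by
  have h0 : ContDiffAt ℝ ∞ (fun u : ℝ × V × V × Z => ‖u.2.2.1‖) u :=
    contDiffAt_snd.snd.fst.norm ℝ hu
  have hn : ‖u.2.2.1‖ ≠ 0 := by positivity
  have h1 : ContDiffAt ℝ ∞
      (fun u : ℝ × V × V × Z => 1 + u.1 * ‖u.2.2.2‖ ^ 2 / ‖u.2.2.1‖) u :=
    contDiffAt_const.add ((contDiffAt_fst.mul (contDiffAt_snd.snd.snd.norm_sq ℝ)).div h0 hn)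
  have h2 : ContDiffAt ℝ ∞ (fun u : ℝ × V × V × Z => inner ℝ u.2.1 u.2.2.1 / ‖u.2.2.1‖) u :=
    (contDiffAt_snd.fst.inner ℝ contDiffAt_snd.snd.fst).div h0 hn
  have h3 := h1.inv hK.ne'
  unfold inflate
  refine ContDiffAt.prodMk ?_ (ContDiffAt.prodMk ?_ ?_)
  · exact (h3.smul contDiffAt_snd.fst).add
      (((contDiffAt_const.sub h3).mul h2).smul ((h0.inv hn).smul contDiffAt_snd.snd.fst))
  · exact h1.smul contDiffAt_snd.snd.fst
  · exact ((contDiffAt_const.mul contDiffAt_fst).mul h2).neg.rotate contDiffAt_snd.snd.snd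

variable {J}

theorem hasDerivAt_line {A : Type*} [NormedAddCommGroup A] [NormedSpace ℝ A] (x h : A) :
    HasDerivAt (fun s : ℝ => x + s • h) h 0 := by
  simpa using ((hasDerivAt_id (0 : ℝ)).smul_const h).const_add x

/-- Expanding, `ξ dx = q dp - ½β d|q|² - |q|² dβ - ½β dR`, where the last term uses `⟪q, p⟫ - β|q|²
= βR`. The rotation of `w` by `-cβ` contributes `-½c|w|² dβ`. Since `|q|² + ½c|w|² = ½(R + |q|²)`,
the sum is `q dp - ½ d(β(R + |q|²)) = q dp - ½ d⟪q, p⟫`, which is the symmetric form. This dictates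
both the slope and the angle. -/
theorem preservesFormAt_toCotangent (hJ : IsComplexStructure J) {y : V × V × Z}
    (hy : y ∈ coneDomain c) :
    PreservesFormAt (linearLiouville J) (cotangentLiouville J) (toCotangent J c) y := by
  have h0 : 0 < coneSize c y := hy
  have hd : DifferentiableAt ℝ (toCotangent J c) y :=
    (contDiffAt_toCotangent J hy).differentiableAt (by simp)
  refine ⟨hd, fun h => ?_⟩
  have hq := hasDerivAt_line y.1 h.1
  have hp := hasDerivAt_line y.2.1 h.2.1
  have hw := hasDerivAt_line y.2.2 h.2.2
  have hR := (contDiff_coneSize (V := V) (Z := Z) (c := c)).contDiffAt.differentiableAt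
    (x := y) (by simp) |>.hasDerivAt_line h
  have hβ := ((contDiffAt_coneSlope hy).differentiableAt (by simp)).hasDerivAt_line h
  have hr := hR.sqrt (by simpa using h0.ne')
  have hsq := (hq.norm_sq).add ((hw.norm_sq).const_mul c)
  -- The identity `β(R + |q|²) = ⟪q, p⟫`, differentiated along the line, is all that is needed about
  -- the derivative of the slope.
  have hmul := (hβ.mul (hR.add hq.norm_sq)).unique
    (((hq.inner ℝ hp)).congr_of_eventuallyEq (by
      have : ∀ᶠ s : ℝ in nhds 0, y + s • h ∈ coneDomain c := by
        have h1 : Continuous (fun s : ℝ => coneSize c (y + s • h)) :=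
          contDiff_coneSize.continuous.comp (by fun_prop)
        exact h1.continuousAt.eventually (lt_mem_nhds (by simpa using h0))
      filter_upwards [this] with s hs
      have hs' : 0 < coneSize c (y + s • h) := hs
      simp only [coneSlope, Pi.add_apply, Pi.mul_apply]
      exact div_mul_cancel₀ _ (by positivity :
        coneSize c (y + s • h) + ‖(y + s • h).1‖ ^ 2 ≠ 0)))
  have hRR := hR.unique hsq
  obtain ⟨dw, hdw, hdw'⟩ := hJ.hasDerivAt_rotate (hβ.const_mul c).neg hw
  have hfx := (hr.inv (by simpa using (Real.sqrt_pos.2 h0).ne')).smul (hp.sub (hβ.smul hq))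
  have hfξ := hr.smul hq
  have key := hd.hasDerivAt_line h |>.unique (hfx.prodMk (hfξ.prodMk hdw))
  rw [key]
  simp only [zero_smul, add_zero, Pi.sub_apply, Pi.neg_apply, Pi.inv_apply, Pi.add_apply,
    Pi.smul_apply'] at hmul hRR hdw' ⊢
  generalize fderiv ℝ (coneSize c) y h = R' at *
  generalize fderiv ℝ (coneSlope c) y h = β' at *
  unfold cotangentLiouville linearLiouville
  have hdw'' : inner ℝ (J (toCotangent J c y).2.2) dw
      = inner ℝ (J y.2.2) h.2.2 + -(c * β') * ‖y.2.2‖ ^ 2 := hdw'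
  rw [hdw'']
  simp only [toCotangent, inner_smul_left, inner_smul_right, inner_sub_right, inner_add_right,
    conj_trivial, real_inner_self_eq_norm_sq]
  have hs : √(coneSize c y) ≠ 0 := by positivity
  have hss : √(coneSize c y) ^ 2 = coneSize c y := Real.sq_sqrt h0.le
  have hβe : coneSlope c y * (coneSize c y + ‖y.1‖ ^ 2) = inner ℝ y.1 y.2.1 := by
    rw [coneSlope, div_mul_cancel₀]; positivity
  rw [real_inner_comm y.2.1 h.1] at *
  have hRdef : coneSize c y = ‖y.1‖ ^ 2 + c * ‖y.2.2‖ ^ 2 := rfl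
  generalize √(coneSize c y) = r at *
  generalize coneSize c y = R at *
  generalize coneSlope c y = β at *
  rw [← hβe]
  field_simp
  rw [hss]
  linear_combination (-R) * hmul + R * β' * hRdef

/-- The base map has derivative `s⁻¹(1 - τ s⁻² x xᵀ)` with `s² = 1 + τ|x|²`; this is symmetric with
inverse `s(1 + τ x xᵀ)`, which is exactly what acts on `ξ`. -/
theorem preservesFormAt_contractLift {τ : ℝ} {y : V × V × Z} (hy : 0 < 1 + τ * ‖y.1‖ ^ 2) :
    PreservesFormAt (cotangentLiouville J) (cotangentLiouville J) (contractLift τ) y := by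
  have hd : DifferentiableAt ℝ (contractLift τ) y :=
    ((contDiffAt_contractLift (u := (τ, y)) hy).comp y
      (contDiffAt_const.prodMk contDiffAt_id)).differentiableAt (by simp)
  refine ⟨hd, fun h => ?_⟩
  have hx := hasDerivAt_line y.1 h.1
  have hξ := hasDerivAt_line y.2.1 h.2.1
  have hw := hasDerivAt_line y.2.2 h.2.2
  have hr := ((hx.norm_sq.const_mul τ).const_add 1).sqrt (by simpa using hy.ne')
  have hfx := (hr.inv (by simpa using (Real.sqrt_pos.2 hy).ne')).smul hx
  have hfξ := hr.smul (hξ.add (((hx.inner ℝ hξ).const_mul τ).smul hx))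
  have key := hd.hasDerivAt_line h |>.unique (hfx.prodMk (hfξ.prodMk hw))
  rw [key]
  simp only [zero_smul, add_zero, Pi.inv_apply]
  unfold cotangentLiouville
  simp only [contractLift, inner_smul_left, inner_smul_right, inner_add_left, inner_add_right,
    conj_trivial, real_inner_self_eq_norm_sq]
  have hs : √(1 + τ * ‖y.1‖ ^ 2) ≠ 0 := by positivity
  have hss : √(1 + τ * ‖y.1‖ ^ 2) ^ 2 = 1 + τ * ‖y.1‖ ^ 2 := Real.sq_sqrt hy.le
  rw [real_inner_comm y.1 y.2.1] at *
  generalize √(1 + τ * ‖y.1‖ ^ 2) = r at *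
  field_simp
  rw [hss]
  ring

/-- Put `μ = 1 + K|w|²/|ξ|` and `σ = ⟪x, ξ⟫/|ξ|`. The terms in `dμ` cancel and the new `ξ dx`
exceeds the old one by `(μ - 1)|ξ| dσ = K|w|² dσ`; the rotation of `w` by `-2Kσ` subtracts the same
amount from `½ w ∧ dw`. -/
theorem preservesFormAt_inflate (hJ : IsComplexStructure J) {K : ℝ} {y : V × V × Z}
    (hy : y.2.1 ≠ 0) (hK : 0 < 1 + K * ‖y.2.2‖ ^ 2 / ‖y.2.1‖) :
    PreservesFormAt (cotangentLiouville J) (cotangentLiouville J) (inflate J K) y := by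
  have hd : DifferentiableAt ℝ (inflate J K) y :=
    ((contDiffAt_inflate J (u := (K, y)) hy hK).comp y
      (contDiffAt_const.prodMk contDiffAt_id)).differentiableAt (by simp)
  refine ⟨hd, fun h => ?_⟩
  have hx := hasDerivAt_line y.1 h.1
  have hξ := hasDerivAt_line y.2.1 h.2.1
  have hw := hasDerivAt_line y.2.2 h.2.2
  have hn0 : ‖y.2.1‖ ≠ 0 := by positivity
  have hn : HasDerivAt (fun s : ℝ => ‖y.2.1 + s • h.2.1‖) (inner ℝ y.2.1 h.2.1 / ‖y.2.1‖) 0 := by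
    have h1 := hξ.norm_sq.sqrt (by simpa using hy)
    simp only [Real.sqrt_sq (norm_nonneg _), zero_smul, add_zero] at h1
    convert h1 using 1
    field_simp
  have hμ := (((hw.norm_sq.const_mul K).div hn (by simpa using hy))).const_add 1
  have hσ := (hx.inner ℝ hξ).div hn (by simpa using hy)
  have hi := hμ.inv (by simpa using hK.ne')
  have hu := (hn.inv (by simpa using hy)).smul hξ
  obtain ⟨dw, hdw, hdw'⟩ := hJ.hasDerivAt_rotate (hσ.const_mul (2 * K)).neg hw
  have hfx := (hi.smul hx).add (((hi.const_sub 1).mul hσ).smul hu)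
  have hfξ := hμ.smul hξ
  have key := hd.hasDerivAt_line h |>.unique (hfx.prodMk (hfξ.prodMk hdw))
  rw [key]
  simp only [zero_smul, add_zero, Pi.neg_apply, Pi.inv_apply,
    Pi.smul_apply', Pi.mul_apply, Pi.div_apply] at hdw' ⊢
  unfold cotangentLiouville
  replace hdw' : inner ℝ (J (inflate J K y).2.2) dw = _ := hdw'
  rw [hdw']
  clear hdw' hdw hfx hfξ key hu hσ hi hμ hn hd
  simp only [inflate, inner_smul_left, inner_smul_right, inner_add_right,
    conj_trivial, real_inner_self_eq_norm_sq]
  rw [real_inner_comm y.1 y.2.1, real_inner_comm y.2.1 h.1] at *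
  have hμn : (1 + K * ‖y.2.2‖ ^ 2 / ‖y.2.1‖ - 1) * ‖y.2.1‖ = K * ‖y.2.2‖ ^ 2 := by field_simp; ring
  generalize ((inner ℝ y.1 h.2.1 + inner ℝ y.2.1 h.1) * ‖y.2.1‖ -
    inner ℝ y.1 y.2.1 * (inner ℝ y.2.1 h.2.1 / ‖y.2.1‖)) / ‖y.2.1‖ ^ 2 = σ'
  generalize (K * (2 * inner ℝ y.2.2 h.2.2) * ‖y.2.1‖ -
    K * ‖y.2.2‖ ^ 2 * (inner ℝ y.2.1 h.2.1 / ‖y.2.1‖)) / ‖y.2.1‖ ^ 2 = μ'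
  generalize 1 + K * ‖y.2.2‖ ^ 2 / ‖y.2.1‖ = μ at *
  have hμ : μ ≠ 0 := hK.ne'
  field_simp
  linear_combination 2 * μ * σ' * ‖y.2.1‖ ^ 2 * hμn

end ModelsSmooth

/-- A smooth family of embeddings `Φ t` of the cone `O` into itself, commuting with positive
dilations and preserving the one-form `α`, with `Φ 0 = id`. -/
structure IsConeIsotopy {E : Type*} [NormedAddCommGroup E] [NormedSpace ℝ E] (α : E → E → ℝ)
    (O : Set E) (Φ : ℝ → E → E) : Prop where
  smooth : ∀ t, ∀ y ∈ O, ContDiffAt ℝ ∞ (fun u : ℝ × E => Φ u.1 u.2) (t, y)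
  mapsTo : ∀ t, ∀ y ∈ O, Φ t y ∈ O
  map_smul : ∀ t, ∀ y ∈ O, ∀ a : ℝ, 0 < a → Φ t (a • y) = a • Φ t y
  preserves : ∀ t, ∀ y ∈ O, PreservesFormAt α α (Φ t) y
  zero : ∀ y ∈ O, Φ 0 y = y
  leftInverse : ∀ t, ∃ Ψ : E → E, ∀ y ∈ O, ContDiffAt ℝ ∞ Ψ (Φ t y) ∧ Ψ (Φ t y) = y

/-! ### Contraction of the model cone -/

section ModelIsotopy

variable {V Z : Type*} [NormedAddCommGroup V] [InnerProductSpace ℝ V]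
  [NormedAddCommGroup Z] [InnerProductSpace ℝ Z] (J : Z →L[ℝ] Z) (c : ℝ)

/-- The dilation of cotangent coordinates corresponding to the multiplication by `a`. -/
def cotangentDilation (a : ℝ) (y : V × V × Z) : V × V × Z := (y.1, a ^ 2 • y.2.1, a • y.2.2)

variable {J c}

theorem coneSize_smul (a : ℝ) (y : V × V × Z) : coneSize c (a • y) = a ^ 2 * coneSize c y := by
  simp only [coneSize, Prod.smul_fst, Prod.smul_snd, norm_smul, mul_pow, Real.norm_eq_abs, sq_abs]
  ring

/-- `R` has degree 2 and the slope degree 0, which gives `x`, `ξ`, `w` the weights 0, 2, 1.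
Equivariance of every factor under these weights is what lets the contraction descend to the sphere.
-/
theorem toCotangent_smul {a : ℝ} (ha : 0 < a) (y : V × V × Z) :
    toCotangent J c (a • y) = cotangentDilation a (toCotangent J c y) := by
  have h1 : coneSlope c (a • y) = coneSlope c y := by
    simp only [coneSlope, coneSize_smul, Prod.smul_fst, Prod.smul_snd, norm_smul, mul_pow,
      Real.norm_eq_abs, sq_abs, inner_smul_left, inner_smul_right, conj_trivial]
    rw [← mul_add, ← mul_assoc, ← sq, mul_div_mul_left _ _ (by positivity)]
  have h2 : √(coneSize c (a • y)) = a * √(coneSize c y) := by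
    rw [coneSize_smul, Real.sqrt_mul (by positivity), Real.sqrt_sq ha.le]
  simp only [toCotangent, cotangentDilation, h1, h2, Prod.smul_fst, Prod.smul_snd, rotate_smul,
    smul_comm _ a, smul_smul, mul_inv]
  ext
  · simp only [smul_sub, smul_smul]
    congr 2 <;> field_simp
  · simp only; congr 1; ring
  · simp

theorem cotangentSize_dilation {a : ℝ} (y : V × V × Z) :
    cotangentSize c (cotangentDilation a y) = a ^ 2 * cotangentSize c y := by
  simp only [cotangentSize, cotangentDilation, norm_smul, mul_pow, Real.norm_eq_abs, sq_abs]
  rw [show (c ^ 2 * ((a ^ 2) ^ 2 * (‖y.2.2‖ ^ 2) ^ 2) + 4 * ((a ^ 2) ^ 2 * ‖y.2.1‖ ^ 2))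
    = (a ^ 2) ^ 2 * ((c ^ 2 * (‖y.2.2‖ ^ 2) ^ 2) + 4 * ‖y.2.1‖ ^ 2) by ring,
    Real.sqrt_mul (by positivity), Real.sqrt_sq (by positivity)]
  ring

theorem ofCotangent_dilation {a : ℝ} (ha : 0 < a) (y : V × V × Z) :
    ofCotangent J c (cotangentDilation a y) = a • ofCotangent J c y := by
  have h2 : √(cotangentSize c (cotangentDilation a y)) = a * √(cotangentSize c y) := by
    rw [cotangentSize_dilation, Real.sqrt_mul (by positivity), Real.sqrt_sq ha.le]
  have h1 : inner ℝ (cotangentDilation a y).1 (cotangentDilation a y).2.1 /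
      cotangentSize c (cotangentDilation a y) = inner ℝ y.1 y.2.1 / cotangentSize c y := by
    rw [cotangentSize_dilation]
    simp only [cotangentDilation, inner_smul_right]
    rw [mul_div_mul_left _ _ (by positivity)]
  simp only [ofCotangent, h1, h2]
  have h3 : a⁻¹ * a ^ 2 = a := by field_simp
  ext
  · simp only [cotangentDilation, smul_smul, Prod.smul_fst]
    congr 1; rw [mul_inv, mul_right_comm, h3]
  · simp only [cotangentDilation, smul_smul, Prod.smul_snd, Prod.smul_fst, smul_add]
    congr 2
    rw [mul_inv]
    linear_combination (inner ℝ y.1 y.2.1 / cotangentSize c y) * (√(cotangentSize c y))⁻¹ * h3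
  · simp [cotangentDilation, rotate_smul]

theorem contractLift_dilation {τ a : ℝ} (y : V × V × Z) :
    contractLift τ (cotangentDilation a y) = cotangentDilation a (contractLift τ y) := by
  simp only [contractLift, cotangentDilation, inner_smul_right]
  ext
  · rfl
  · simp only
    module
  · rfl

theorem inflate_dilation {K a : ℝ} (ha : 0 < a) (y : V × V × Z) :
    inflate J K (cotangentDilation a y) = cotangentDilation a (inflate J K y) := by
  have h1 : ‖(cotangentDilation a y).2.1‖ = a ^ 2 * ‖y.2.1‖ := by
    simp [cotangentDilation, norm_smul]
  have h2 : K * ‖(cotangentDilation a y).2.2‖ ^ 2 / ‖(cotangentDilation a y).2.1‖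
      = K * ‖y.2.2‖ ^ 2 / ‖y.2.1‖ := by
    rw [h1]
    simp only [cotangentDilation, norm_smul, mul_pow, Real.norm_eq_abs, sq_abs]
    rw [mul_left_comm, mul_div_mul_left _ _ (by positivity)]
  have h3 : inner ℝ (cotangentDilation a y).1 (cotangentDilation a y).2.1 /
      ‖(cotangentDilation a y).2.1‖ = inner ℝ y.1 y.2.1 / ‖y.2.1‖ := by
    rw [h1]
    simp only [cotangentDilation, inner_smul_right]
    rw [mul_div_mul_left _ _ (by positivity)]
  have h4 : ‖(cotangentDilation a y).2.1‖⁻¹ • (cotangentDilation a y).2.1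
      = ‖y.2.1‖⁻¹ • y.2.1 := by
    rw [h1, cotangentDilation, smul_smul]
    congr 1
    field_simp
  simp only [inflate, h2, h3, h4]
  simp only [cotangentDilation, rotate_smul, smul_comm (a ^ 2)]

/-- For `τ ≥ 0` the derivative of the base map has norm at most one, so its inverse transpose, which
acts on covectors, does not shrink them. -/
theorem le_norm_sq_contractLift {τ : ℝ} (hτ : 0 ≤ τ) (y : V × V × Z) :
    ‖y.2.1‖ ^ 2 ≤ ‖(contractLift τ y).2.1‖ ^ 2 := by
  have h1 : 0 ≤ 1 + τ * ‖y.1‖ ^ 2 := by positivity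
  simp only [contractLift, norm_smul, mul_pow, Real.norm_eq_abs, sq_abs, Real.sq_sqrt h1]
  rw [← real_inner_self_eq_norm_sq (y.2.1 + _)]
  simp only [inner_add_left, inner_add_right, inner_smul_left, inner_smul_right, conj_trivial,
    real_inner_self_eq_norm_sq, real_inner_comm y.1 y.2.1]
  have h2 : 0 ≤ τ * ‖y.1‖ ^ 2 * ‖y.2.1‖ ^ 2 := by positivity
  have h3 : 0 ≤ (1 + τ * ‖y.1‖ ^ 2) * (τ * inner ℝ y.1 y.2.1 ^ 2) := by positivity
  have h4 : 0 ≤ (1 + τ * ‖y.1‖ ^ 2) * (τ ^ 2 * inner ℝ y.1 y.2.1 ^ 2 * ‖y.1‖ ^ 2) := by positivity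
  nlinarith

theorem contractLift_mem {τ : ℝ} (hτ : 0 ≤ τ) {y : V × V × Z}
    (hy : y ∈ cotangentDomain c) : contractLift τ y ∈ cotangentDomain c := by
  refine lt_of_lt_of_le (show 0 < cotangentSize c y from hy) ?_
  have h1 := le_norm_sq_contractLift hτ y
  have h2 : (contractLift τ y).2.2 = y.2.2 := rfl
  unfold cotangentSize
  rw [h2]
  gcongr

theorem contractLift_pos {τ : ℝ} {y : V × V × Z} (hy : 0 < 1 + τ * ‖y.1‖ ^ 2) :
    1 - τ * ‖(contractLift τ y).1‖ ^ 2 = (1 + τ * ‖y.1‖ ^ 2)⁻¹ := by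
  simp only [contractLift, norm_smul, mul_pow, norm_inv, inv_pow, Real.norm_eq_abs, sq_abs,
    Real.sq_sqrt hy.le]
  field_simp
  ring

theorem inflate_zero (y : V × V × Z) : inflate J 0 y = y := by
  simp [inflate, rotate_zero]

theorem cotangentSize_zero (y : V × V × Z) : cotangentSize 0 y = ‖y.2.1‖ := by
  simp only [cotangentSize, zero_mul, zero_add]
  rw [show (0 : ℝ) ^ 2 + 4 * ‖y.2.1‖ ^ 2 = (2 * ‖y.2.1‖) ^ 2 by ring, Real.sqrt_sq (by positivity)]
  ring

theorem norm_inflate {K : ℝ} (hK : 0 ≤ K) (y : V × V × Z) (hy : y.2.1 ≠ 0) :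
    ‖(inflate J K y).2.1‖ = ‖y.2.1‖ + K * ‖y.2.2‖ ^ 2 := by
  have : 0 < ‖y.2.1‖ := by positivity
  rw [inflate, norm_smul, Real.norm_eq_abs, abs_of_nonneg (by positivity)]
  field_simp

variable (J c) in
/-- The symplectic isotopy contracting the cone `coneDomain c` towards `{|q|² + c |w|² = |y|²}`. -/
def coneContraction (κ K t : ℝ) (y : V × V × Z) : V × V × Z :=
  ofCotangent J c (contractLift ((t * K) ^ 2) (inflate J (t ^ 2 * κ) (toCotangent J c y)))

theorem toCotangent_mem (hJ : IsComplexStructure J) (hc : 0 ≤ c) {y : V × V × Z}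
    (hy : y ∈ coneDomain c) : toCotangent J c y ∈ cotangentDomain c := by
  show 0 < cotangentSize c _
  rw [coneSize_toCotangent J hJ hc]; exact hy

/-- The alternative in `hκ` recurs below. If `c = 0` the domain is `ξ ≠ 0`, where `inflate` is
defined and smooth. If `c > 0` the domain contains points with `ξ = 0`, so `inflate` is switched off
by `κ = 0`; it is not needed there, since `R ≥ c|w|²` already. -/
theorem inflate_mem {κ : ℝ} (hκ : κ = 0 ∨ c = 0 ∧ 0 ≤ κ) {y : V × V × Z}
    (hy : y ∈ cotangentDomain c) : inflate J κ y ∈ cotangentDomain c := by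
  rcases hκ with rfl | ⟨rfl, hκ⟩
  · rwa [inflate_zero]
  · have h0 : 0 < ‖y.2.1‖ := by rw [← cotangentSize_zero y]; exact hy
    show 0 < cotangentSize 0 _
    rw [cotangentSize_zero, norm_inflate hκ y (norm_pos_iff.1 h0)]
    positivity

theorem norm_ne_zero_of_mem {y : V × V × Z} (hy : y ∈ cotangentDomain 0) : y.2.1 ≠ 0 := by
  rw [← norm_pos_iff, ← cotangentSize_zero y]; exact hy

theorem contDiffAt_inflate_of_mem {κ : ℝ} (hκ : κ = 0 ∨ c = 0 ∧ 0 ≤ κ) {y : V × V × Z}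
    (hy : y ∈ cotangentDomain c) (t : ℝ) :
    ContDiffAt ℝ ∞ (fun u : ℝ × V × V × Z => inflate J (u.1 ^ 2 * κ) u.2) (t, y) := by
  rcases hκ with rfl | ⟨rfl, hκ⟩
  · simp only [mul_zero, inflate_zero]
    exact contDiffAt_snd
  · exact (contDiffAt_inflate J (u := (t ^ 2 * κ, y)) (norm_ne_zero_of_mem hy)
      (by positivity)).comp (t, y) (((contDiffAt_fst.pow 2).mul contDiffAt_const).prodMk
        contDiffAt_snd)

theorem inflate_inverse (hJ : IsComplexStructure J) {κ : ℝ} (hκ : κ = 0 ∨ c = 0 ∧ 0 ≤ κ)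
    {y : V × V × Z} (hy : y ∈ cotangentDomain c) :
    ContDiffAt ℝ ∞ (inflate J (-κ)) (inflate J κ y) ∧ inflate J (-κ) (inflate J κ y) = y := by
  have hm := inflate_mem (J := J) hκ hy
  rcases hκ with rfl | ⟨rfl, hκ⟩
  · have : (inflate J (-0) : V × V × Z → _) = id := by ext1 z; simp [inflate_zero]
    rw [this, inflate_zero]
    exact ⟨contDiffAt_id, rfl⟩
  · have h0 := norm_ne_zero_of_mem hy
    have h1 := norm_ne_zero_of_mem hm
    have hn : 0 < ‖y.2.1‖ := by positivity
    refine ⟨?_, inflate_inflate J hJ h0 (by positivity)⟩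
    refine (contDiffAt_inflate J (u := (-κ, inflate J κ y)) h1 ?_).comp _
      (contDiffAt_const.prodMk contDiffAt_id)
    show 0 < 1 + -κ * ‖(inflate J κ y).2.2‖ ^ 2 / ‖(inflate J κ y).2.1‖
    rw [norm_inflate hκ y h0, show ‖(inflate J κ y).2.2‖ ^ 2 = ‖y.2.2‖ ^ 2 from
      hJ.norm_sq_rotate _ _]
    -- The backward scaling factor is the old `|ξ|` divided by the new one, hence positive.
    have : 1 + -κ * ‖y.2.2‖ ^ 2 / (‖y.2.1‖ + κ * ‖y.2.2‖ ^ 2)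
        = ‖y.2.1‖ / (‖y.2.1‖ + κ * ‖y.2.2‖ ^ 2) := by
      have : 0 < ‖y.2.1‖ + κ * ‖y.2.2‖ ^ 2 := by positivity
      field_simp
      ring
    rw [this]
    positivity

theorem isOpen_cotangentDomain : IsOpen (cotangentDomain c : Set (V × V × Z)) :=
  isOpen_lt continuous_const (by unfold cotangentSize; fun_prop)

theorem preservesFormAt_ofCotangent (hJ : IsComplexStructure J) {y : V × V × Z}
    (hy : y ∈ cotangentDomain c) :
    PreservesFormAt (cotangentLiouville J) (linearLiouville J) (ofCotangent J c) y := by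
  refine (preservesFormAt_toCotangent (c := c) hJ ?_).of_rightInverse
    ((contDiffAt_ofCotangent J hy).differentiableAt (by simp)) ?_
  · show 0 < coneSize c _
    rw [coneSize_ofCotangent J hJ hy]; exact hy
  · filter_upwards [isOpen_cotangentDomain.mem_nhds hy] with z hz
    exact toCotangent_ofCotangent J hJ hz

/-- All properties pass through the composition. The parameters depend on `t` through `t²`, so they
stay nonnegative for every real `t` and the family is smooth across both ends of `[0, 1]`. -/
theorem isConeIsotopy_coneContraction (hJ : IsComplexStructure J) (hc : 0 ≤ c) {κ : ℝ}
    (hκ : κ = 0 ∨ c = 0 ∧ 0 ≤ κ) (K : ℝ) :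
    IsConeIsotopy (linearLiouville J) (coneDomain c : Set (V × V × Z))
      (coneContraction J c κ K) := by
  have hκt : ∀ t : ℝ, t ^ 2 * κ = 0 ∨ c = 0 ∧ 0 ≤ t ^ 2 * κ := fun t =>
    hκ.imp (fun h => by rw [h, mul_zero]) (fun h => ⟨h.1, mul_nonneg (sq_nonneg t) h.2⟩)
  have m1 : ∀ y ∈ (coneDomain c : Set (V × V × Z)), toCotangent J c y ∈ cotangentDomain c :=
    fun y hy => toCotangent_mem hJ hc hy
  have m2 : ∀ t : ℝ, ∀ y ∈ (coneDomain c : Set (V × V × Z)),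
      inflate J (t ^ 2 * κ) (toCotangent J c y) ∈ cotangentDomain c :=
    fun t y hy => inflate_mem (hκt t) (m1 y hy)
  have m3 : ∀ t : ℝ, ∀ y ∈ (coneDomain c : Set (V × V × Z)), contractLift ((t * K) ^ 2)
      (inflate J (t ^ 2 * κ) (toCotangent J c y)) ∈ cotangentDomain c :=
    fun t y hy => contractLift_mem (sq_nonneg _) (m2 t y hy)
  have m4 : ∀ t : ℝ, ∀ y ∈ (coneDomain c : Set (V × V × Z)),
      coneContraction J c κ K t y ∈ coneDomain c := fun t y hy => by
    show 0 < coneSize c _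
    rw [coneContraction, coneSize_ofCotangent J hJ (m3 t y hy)]
    exact m3 t y hy
  have hp : ∀ (t : ℝ) (y : V × V × Z), 0 < 1 + (t * K) ^ 2 * ‖y.1‖ ^ 2 := fun t y => by positivity
  have sm : ∀ t, ∀ y ∈ (coneDomain c : Set (V × V × Z)),
      ContDiffAt ℝ ∞ (fun u : ℝ × V × V × Z => coneContraction J c κ K u.1 u.2) (t, y) := by
    intro t y hy
    have s1 : ContDiffAt ℝ ∞ (fun u : ℝ × V × V × Z => (u.1, toCotangent J c u.2)) (t, y) :=
      contDiffAt_fst.prodMk ((contDiffAt_toCotangent J hy).comp (t, y) contDiffAt_snd)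
    have s2 := (contDiffAt_inflate_of_mem (J := J) hκ (m1 y hy) t).comp (t, y) s1
    have s3 := (contDiffAt_contractLift (u := ((t * K) ^ 2,
      inflate J (t ^ 2 * κ) (toCotangent J c y))) (hp t _)).comp (t, y)
      (((contDiffAt_fst.mul contDiffAt_const).pow 2).prodMk s2)
    exact (contDiffAt_ofCotangent J (m3 t y hy)).comp (t, y) s3
  refine ⟨sm, m4, ?_, ?_, ?_, ?_⟩
  · intro t y _ a ha
    simp only [coneContraction, toCotangent_smul ha, inflate_dilation ha, contractLift_dilation,
      ofCotangent_dilation ha]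
  · intro t y hy
    have p1 := preservesFormAt_toCotangent hJ hy
    have p2 : PreservesFormAt (cotangentLiouville J) (cotangentLiouville J)
        (inflate J (t ^ 2 * κ)) (toCotangent J c y) := by
      rcases hκ with rfl | ⟨rfl, hκ⟩
      · have : (inflate J (t ^ 2 * 0) : V × V × Z → _) = id := by ext1 z; simp [inflate_zero]
        rw [this]
        exact ⟨differentiableAt_id, fun h => by simp⟩
      · have := norm_ne_zero_of_mem (m1 y hy)
        exact preservesFormAt_inflate hJ this (by positivity)
    have p3 := preservesFormAt_contractLift (J := J) (hp t (inflate J (t ^ 2 * κ)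
      (toCotangent J c y)))
    have p4 := preservesFormAt_ofCotangent hJ (m3 t y hy)
    exact p4.comp (f := contractLift ((t * K) ^ 2) ∘ inflate J (t ^ 2 * κ) ∘ toCotangent J c)
      (p3.comp (f := inflate J (t ^ 2 * κ) ∘ toCotangent J c) (p2.comp p1))
  · intro y hy
    have : ∀ z : V × V × Z, contractLift 0 z = z := fun z => by simp [contractLift]
    simp only [coneContraction, zero_mul, ne_eq, OfNat.ofNat_ne_zero, not_false_eq_true, zero_pow,
      inflate_zero, this, ofCotangent_toCotangent J hJ hc hy]
  · intro t
    -- The factors are undone in reverse order. The inverses are smooth only on parts of their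
    -- domains, so smoothness is checked at the image points alone.
    refine ⟨fun z => ofCotangent J c (inflate J (-(t ^ 2 * κ)) (contractLift (-(t * K) ^ 2)
      (toCotangent J c z))), fun y hy => ?_⟩
    obtain ⟨i1, i2⟩ := inflate_inverse hJ (hκt t) (m1 y hy)
    have e1 : toCotangent J c (coneContraction J c κ K t y) = _ :=
      toCotangent_ofCotangent J hJ (m3 t y hy)
    have e2 := contractLift_contractLift (hp t (inflate J (t ^ 2 * κ) (toCotangent J c y)))
    refine ⟨?_, by beta_reduce; rw [e1, e2, i2, ofCotangent_toCotangent J hJ hc hy]⟩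
    have s1 := contDiffAt_toCotangent J (m4 t y hy)
    have s2 : ContDiffAt ℝ ∞ (contractLift (-(t * K) ^ 2))
        (toCotangent J c (coneContraction J c κ K t y)) := by
      refine (contDiffAt_contractLift (u := (-(t * K) ^ 2, _)) ?_).comp _
        (contDiffAt_const.prodMk contDiffAt_id)
      rw [e1]
      have := contractLift_pos (hp t (inflate J (t ^ 2 * κ) (toCotangent J c y)))
      show 0 < 1 + -(t * K) ^ 2 * _
      rw [neg_mul, ← sub_eq_add_neg, this]
      exact inv_pos.2 (hp t _)
    have s12 := s2.comp _ s1
    have s3 : ContDiffAt ℝ ∞ (inflate J (-(t ^ 2 * κ))) (contractLift (-(t * K) ^ 2)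
        (toCotangent J c (coneContraction J c κ K t y))) := by rw [e1, e2]; exact i1
    have s123 := ContDiffAt.comp (coneContraction J c κ K t y)
      (f := contractLift (-(t * K) ^ 2) ∘ toCotangent J c) s3 s12
    have s4 : ContDiffAt ℝ ∞ (ofCotangent J c) (inflate J (-(t ^ 2 * κ))
        (contractLift (-(t * K) ^ 2) (toCotangent J c (coneContraction J c κ K t y)))) := by
      rw [e1, e2, i2]; exact contDiffAt_ofCotangent J (m1 y hy)
    exact ContDiffAt.comp (coneContraction J c κ K t y) (f := inflate J (-(t ^ 2 * κ)) ∘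
      contractLift (-(t * K) ^ 2) ∘ toCotangent J c) s4 s123

theorem norm_sq_contractLift_le {τ : ℝ} (hτ : 0 < τ) (y : V × V × Z) :
    ‖(contractLift τ y).1‖ ^ 2 ≤ 1 / τ := by
  have := contractLift_pos (show 0 < 1 + τ * ‖y.1‖ ^ 2 by positivity)
  have h2 : 0 < (1 + τ * ‖y.1‖ ^ 2)⁻¹ := by positivity
  rw [le_div_iff₀ hτ]
  linarith

/-- Here `p = √R x + (⟪x, ξ⟫/R) ξ/√R`. As `|ξ|² = R² - c|w|²R ≤ R²`, each summand has norm at most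
`√R |x|`. -/
theorem norm_sq_ofCotangent_le (hc : 0 ≤ c) {y : V × V × Z} (hy : y ∈ cotangentDomain c) :
    ‖(ofCotangent J c y).2.1‖ ^ 2 ≤ 4 * cotangentSize c y * ‖y.1‖ ^ 2 := by
  have h0 : 0 < cotangentSize c y := hy
  have h1 := cotangentSize_sq (c := c) y
  have h2 : ‖y.2.1‖ ≤ cotangentSize c y := by
    refine abs_le_of_sq_le_sq' ?_ h0.le |>.2
    nlinarith [mul_nonneg (mul_nonneg hc (sq_nonneg ‖y.2.2‖)) h0.le]
  have h3 : ‖(ofCotangent J c y).2.1‖ ≤ √(cotangentSize c y) * ‖y.1‖ +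
      |inner ℝ y.1 y.2.1| / cotangentSize c y * ((√(cotangentSize c y))⁻¹ * ‖y.2.1‖) := by
    refine (norm_add_le _ _).trans ?_
    simp only [norm_smul, norm_inv, Real.norm_eq_abs, abs_div, abs_of_pos h0,
      abs_of_nonneg (Real.sqrt_nonneg _)]
    exact le_rfl
  have hs : 0 < √(cotangentSize c y) := Real.sqrt_pos.2 h0
  have hss : √(cotangentSize c y) ^ 2 = cotangentSize c y := Real.sq_sqrt h0.le
  have h4 : |inner ℝ y.1 y.2.1| / cotangentSize c y ≤ ‖y.1‖ := by
    rw [div_le_iff₀ h0]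
    exact (abs_real_inner_le_norm _ _).trans (by gcongr)
  have h5 : (√(cotangentSize c y))⁻¹ * ‖y.2.1‖ ≤ √(cotangentSize c y) := by
    rw [inv_mul_le_iff₀ hs, ← sq, hss]; exact h2
  have h6 : ‖(ofCotangent J c y).2.1‖ ≤ 2 * √(cotangentSize c y) * ‖y.1‖ := by
    refine h3.trans ?_
    have := mul_le_mul h4 h5 (by positivity) (norm_nonneg _)
    linarith
  calc ‖(ofCotangent J c y).2.1‖ ^ 2 ≤ (2 * √(cotangentSize c y) * ‖y.1‖) ^ 2 := by gcongr
    _ = _ := by rw [mul_pow, mul_pow, hss]; ring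

/-- The final bound on the momentum. -/
theorem coneContraction_momentum_le (hJ : IsComplexStructure J) (hc : 0 ≤ c) {κ K : ℝ}
    (hκ : κ = 0 ∨ c = 0 ∧ 0 ≤ κ) (hK : 0 < K) {y : V × V × Z} (hy : y ∈ coneDomain c) :
    ‖(coneContraction J c κ K 1 y).2.1‖ ^ 2 ≤
      4 / K ^ 2 * coneSize c (coneContraction J c κ K 1 y) := by
  have hm : contractLift ((1 * K) ^ 2) (inflate J (1 ^ 2 * κ) (toCotangent J c y))
      ∈ cotangentDomain c := by
    refine contractLift_mem (sq_nonneg _) (inflate_mem ?_ (toCotangent_mem hJ hc hy))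
    simpa using hκ
  rw [coneContraction, coneSize_ofCotangent J hJ hm]
  refine (norm_sq_ofCotangent_le hc hm).trans ?_
  have h0 : 0 < cotangentSize c (contractLift ((1 * K) ^ 2) (inflate J (1 ^ 2 * κ)
    (toCotangent J c y))) := hm
  have := norm_sq_contractLift_le (τ := (1 * K) ^ 2) (by positivity)
    (inflate J (1 ^ 2 * κ) (toCotangent J c y))
  rw [one_mul] at this h0 ⊢
  calc _ ≤ 4 * cotangentSize c (contractLift (K ^ 2) (inflate J (1 ^ 2 * κ)
        (toCotangent J c y))) * (1 / K ^ 2) := by gcongr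
    _ = _ := by ring

/-- The final bound on the symplectic coordinates, in the case `c = 0`. -/
theorem coneContraction_norm_sq_le (hJ : IsComplexStructure J) {K : ℝ}
    (hK : 0 < K) {y : V × V × Z} (hy : y ∈ coneDomain 0) :
    ‖(coneContraction J 0 K K 1 y).2.2‖ ^ 2 ≤
      1 / K * coneSize 0 (coneContraction J 0 K K 1 y) := by
  have h1 := toCotangent_mem (c := 0) hJ le_rfl hy
  have h2 := norm_ne_zero_of_mem h1
  have h3 := inflate_mem (J := J) (c := 0) (κ := 1 ^ 2 * K) (Or.inr ⟨rfl, by positivity⟩) h1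
  have h4 := contractLift_mem (c := 0) (τ := (1 * K) ^ 2) (sq_nonneg _) h3
  rw [coneContraction, coneSize_ofCotangent J hJ h4, cotangentSize_zero]
  have h5 : ‖(ofCotangent J 0 (contractLift ((1 * K) ^ 2) (inflate J (1 ^ 2 * K)
      (toCotangent J 0 y)))).2.2‖ ^ 2 = ‖(toCotangent J 0 y).2.2‖ ^ 2 := by
    rw [ofCotangent, hJ.norm_sq_rotate]
    exact hJ.norm_sq_rotate _ _
  -- For `c = 0` the final `R` is the final `|ξ|`. It is at least the value after inflation, which
  -- is at least `K|w|²`.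
  have h6 := abs_le_of_sq_le_sq' (le_norm_sq_contractLift (τ := (1 * K) ^ 2) (sq_nonneg _)
    (inflate J (1 ^ 2 * K) (toCotangent J 0 y))) (norm_nonneg _) |>.2
  rw [norm_inflate (by positivity) _ h2] at h6
  rw [h5, one_div, ← div_eq_inv_mul, le_div_iff₀ hK]
  refine le_trans ?_ h6
  nlinarith [norm_nonneg (toCotangent J 0 y).2.1]

end ModelIsotopy

/-! ### Manifolds smoothly retracted from open subsets of vector spaces -/

section Retraction

variable {E : Type*} [NormedAddCommGroup E] [NormedSpace ℝ E]
  {F : Type*} [NormedAddCommGroup F] [NormedSpace ℝ F]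
  {H : Type*} [TopologicalSpace H] (I : ModelWithCorners ℝ F H)
  {M : Type*} [TopologicalSpace M] [ChartedSpace H M]

/-- `ι : M → E` is a smooth map whose image lies in the open set `O`, and `r` is a smooth left
inverse of `ι` on `O`. -/
structure IsSmoothRetraction (ι : M → E) (r : E → M) (O : Set E) : Prop where
  contMDiff : ContMDiff I 𝓘(ℝ, E) ∞ ι
  isOpen : IsOpen O
  contMDiffAt : ∀ v ∈ O, ContMDiffAt 𝓘(ℝ, E) I ∞ r v
  mem : ∀ x, ι x ∈ O
  leftInverse : ∀ x, r (ι x) = x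

variable {I} {ι : M → E} {r : E → M} {O : Set E}

theorem IsSmoothRetraction.mdifferentiableAt (h : IsSmoothRetraction I ι r O) (x : M) :
    MDifferentiableAt I 𝓘(ℝ, E) ι x := (h.contMDiff x).mdifferentiableAt (by simp)

theorem IsSmoothRetraction.mdifferentiableAt_retract (h : IsSmoothRetraction I ι r O) {v : E}
    (hv : v ∈ O) : MDifferentiableAt 𝓘(ℝ, E) I r v := (h.contMDiffAt v hv).mdifferentiableAt (by simp)

variable (I) in
/-- The derivative of a map from a manifold to a vector space, with values in plain linear maps
from the model space. -/
def vectorDeriv {A : Type*} [NormedAddCommGroup A] [NormedSpace ℝ A] (f : M → A) (x : M) :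
    F →L[ℝ] A := mfderiv I 𝓘(ℝ, A) f x

/-- Composition of a smooth map on `E` with `ι`. -/
theorem IsSmoothRetraction.vectorDeriv_comp {A : Type*} [NormedAddCommGroup A] [NormedSpace ℝ A]
    (h : IsSmoothRetraction I ι r O) (x : M) {f : E → A} (hf : DifferentiableAt ℝ f (ι x)) :
    vectorDeriv I (fun y => f (ι y)) x = (fderiv ℝ f (ι x)).comp (vectorDeriv I ι x) := by
  have h2 := mfderiv_comp x hf.mdifferentiableAt (h.mdifferentiableAt x)
  rw [mfderiv_eq_fderiv] at h2
  exact h2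

variable (I) in
/-- The derivative of a retraction onto a manifold. -/
def retractDeriv (r : E → M) (v : E) : E →L[ℝ] F := mfderiv 𝓘(ℝ, E) I r v

theorem IsSmoothRetraction.retractDeriv_vectorDeriv (h : IsSmoothRetraction I ι r O) (x : M)
    (v : F) : retractDeriv I r (ι x) (vectorDeriv I ι x v) = v := by
  have h1 : r ∘ ι = id := funext h.leftInverse
  have h2 := mfderiv_comp x (h.mdifferentiableAt_retract (h.mem x)) (h.mdifferentiableAt x)
  rw [h1, mfderiv_id] at h2
  exact (DFunLike.congr_fun h2 v).symm

theorem IsSmoothRetraction.vectorDeriv_retractDeriv (h : IsSmoothRetraction I ι r O) {v : E}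
    (hv : v ∈ O) (u : E) :
    vectorDeriv I ι (r v) (retractDeriv I r v u) = fderiv ℝ (fun w => ι (r w)) v u := by
  have h2 := mfderiv_comp v (h.mdifferentiableAt (r v)) (h.mdifferentiableAt_retract hv)
  rw [mfderiv_eq_fderiv] at h2
  exact (DFunLike.congr_fun h2 u).symm

end Retraction

/-! ### Open subsets of the unit sphere and the cones over them -/

section Sphere

variable {E : Type*} [NormedAddCommGroup E] [InnerProductSpace ℝ E] {m : ℕ}
  [Fact (Module.finrank ℝ E = m + 1)]

/-- A map into the unit sphere is smooth at a point if it is so as a map into the vector space. -/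
theorem contMDiffAt_sphere {F : Type*} [NormedAddCommGroup F] [NormedSpace ℝ F]
    {H : Type*} [TopologicalSpace H] {I : ModelWithCorners ℝ F H}
    {M : Type*} [TopologicalSpace M] [ChartedSpace H M] {f : M → Metric.sphere (0 : E) 1} {x : M}
    (hf : ContMDiffAt I 𝓘(ℝ, E) ∞ (fun y => (f y : E)) x) : ContMDiffAt I (𝓡 m) ∞ f x := by
  rw [contMDiffAt_iff_target]
  refine ⟨Topology.IsInducing.subtypeVal.continuousAt_iff.2 hf.continuousAt, ?_⟩
  -- The preferred chart at `f x` is the stereographic projection from the antipode, followed by a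
  -- linear isometry. Its formula is smooth on the ambient space off the hyperplane `⟪v, ·⟫ = 1`,
  -- while `⟪v, f x⟫ = -1`.
  let v : Metric.sphere (0 : E) 1 := -f x
  let U : _ ≃ₗᵢ[ℝ] _ :=
    (OrthonormalBasis.fromOrthogonalSpanSingleton m (ne_zero_of_mem_unit_sphere v)).repr
  have h1 : ContDiffAt ℝ ∞ (stereoToFun (v : E)) (f x : E) := by
    refine (contDiffOn_stereoToFun (v := (v : E))).contDiffAt (IsOpen.mem_nhds ?_ ?_)
    · exact isOpen_ne_fun (innerSL ℝ (v : E)).continuous continuous_const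
    · show inner ℝ (v : E) (f x : E) ≠ 1
      simp [v]
      norm_num
  have h2 : ContMDiffAt I 𝓘(ℝ, EuclideanSpace ℝ (Fin m)) ∞
      (fun y => U (stereoToFun (v : E) (f y : E))) x :=
    ContMDiffAt.comp x (g := fun z : E => U (stereoToFun (v : E) z))
      (U.contDiff.contDiffAt.comp _ h1).contMDiffAt hf
  exact h2

variable {U : TopologicalSpace.Opens (Metric.sphere (0 : E) 1)} {O : Set E}

/-- `O` is an open cone whose trace on the unit sphere is `U`. -/
structure IsConeOver (U : TopologicalSpace.Opens (Metric.sphere (0 : E) 1)) (O : Set E) : Prop where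
  isOpen : IsOpen O
  zero_notMem : (0 : E) ∉ O
  smul_mem : ∀ a : ℝ, 0 < a → ∀ v ∈ O, a • v ∈ O
  mem_iff : ∀ x, x ∈ U ↔ (x : E) ∈ O

variable (U) in
/-- The inclusion of an open subset of the sphere into the vector space. -/
def sphereIncl (x : U) : E := ((x : Metric.sphere (0 : E) 1) : E)

theorem norm_sphereIncl (x : U) : ‖sphereIncl U x‖ = 1 := norm_eq_of_mem_sphere _

open Classical in
variable (U) in
/-- The radial projection to an open subset `U` of the sphere (with a dummy value elsewhere). -/
def radial (x₀ : U) (v : E) : U :=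
  if h : ∃ x : U, sphereIncl U x = ‖v‖⁻¹ • v then h.choose else x₀

theorem sphereIncl_injective : Function.Injective (sphereIncl U) :=
  Subtype.val_injective.comp Subtype.val_injective

theorem sphereIncl_radial (hO : IsConeOver U O) (x₀ : U) {v : E} (hv : v ∈ O) :
    sphereIncl U (radial U x₀ v) = ‖v‖⁻¹ • v := by
  have h0 : v ≠ 0 := fun h => hO.zero_notMem (h ▸ hv)
  have h : ∃ x : U, sphereIncl U x = ‖v‖⁻¹ • v := by
    refine ⟨⟨⟨‖v‖⁻¹ • v, by simp [norm_smul, h0]⟩, ?_⟩, rfl⟩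
    exact (hO.mem_iff _).2 (hO.smul_mem _ (by positivity) v hv)
  rw [radial, dif_pos h]
  exact h.choose_spec

theorem sphereIncl_mem (hO : IsConeOver U O) (x : U) : sphereIncl U x ∈ O := (hO.mem_iff _).1 x.2

theorem contMDiff_sphereIncl : ContMDiff (𝓡 m) 𝓘(ℝ, E) ∞ (sphereIncl U) :=
  contMDiff_coe_sphere.comp contMDiff_subtype_val

/-- A map into an open subset of the unit sphere is smooth at a point if it is so as a map into the
vector space. -/
theorem contMDiffAt_of_sphereIncl {F : Type*} [NormedAddCommGroup F] [NormedSpace ℝ F]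
    {H : Type*} [TopologicalSpace H] {I : ModelWithCorners ℝ F H}
    {M : Type*} [TopologicalSpace M] [ChartedSpace H M] {f : M → U} {x : M}
    (hf : ContMDiffAt I 𝓘(ℝ, E) ∞ (fun y => sphereIncl U (f y)) x) :
    ContMDiffAt I (𝓡 m) ∞ f x :=
  (ContMDiffAt.subtypeVal_comp_iff U f x).1 (contMDiffAt_sphere hf)

theorem contDiffAt_normalize {v : E} (hv : v ≠ 0) :
    ContDiffAt ℝ ∞ (fun w : E => ‖w‖⁻¹ • w) v :=
  ((contDiffAt_norm ℝ hv).inv (norm_ne_zero_iff.2 hv)).smul contDiffAt_id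

theorem isSmoothRetraction_radial (hO : IsConeOver U O) (x₀ : U) :
    IsSmoothRetraction (𝓡 m) (sphereIncl U) (radial U x₀) O where
  contMDiff := contMDiff_sphereIncl
  isOpen := hO.isOpen
  contMDiffAt v hv := by
    apply contMDiffAt_of_sphereIncl
    have h0 : v ≠ 0 := fun h => hO.zero_notMem (h ▸ hv)
    refine (contDiffAt_normalize h0).contMDiffAt.congr_of_eventuallyEq ?_
    filter_upwards [hO.isOpen.mem_nhds hv] with w hw
    exact sphereIncl_radial hO x₀ hw
  mem := sphereIncl_mem hO
  leftInverse x := by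
    apply sphereIncl_injective
    rw [sphereIncl_radial hO x₀ (sphereIncl_mem hO x), norm_sphereIncl]
    simp

/-- The derivative of the radial projection on the tangent space of the unit sphere. -/
theorem fderiv_normalize {v h : E} (hv : ‖v‖ = 1) (hh : inner ℝ v h = 0) :
    fderiv ℝ (fun w : E => ‖w‖⁻¹ • w) v h = h := by
  have h0 : v ≠ 0 := by rintro rfl; simp at hv
  have hd := (contDiffAt_normalize h0).differentiableAt (by simp)
  have h1 := hasDerivAt_line v h
  have hn : HasDerivAt (fun s : ℝ => ‖v + s • h‖) 0 0 := by
    have := h1.norm_sq.sqrt (by simpa using h0)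
    simp only [Real.sqrt_sq (norm_nonneg _), zero_smul, add_zero, hh] at this
    simpa using this
  refine (hd.hasDerivAt_line h).unique ?_
  have h2 := (hn.inv (by simpa using h0)).smul h1
  have h3 : (fun s : ℝ => ‖v + s • h‖)⁻¹ 0 • h + (-0 / ‖v + (0 : ℝ) • h‖ ^ 2) • (v + (0 : ℝ) • h)
      = h := by simp [hv]
  rw [h3] at h2
  exact h2

/-- Only the radial direction of the correction matters: a form with `λ_v(v) = 0` does not see it.
-/
theorem fderiv_normalize_apply {v : E} (hv : v ≠ 0) (h : E) :
    ∃ b : ℝ, fderiv ℝ (fun w : E => ‖w‖⁻¹ • w) v h = ‖v‖⁻¹ • h + b • v := by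
  have hn := (contDiffAt_norm ℝ hv).inv (norm_ne_zero_iff.2 hv) |>.differentiableAt
    (n := ∞) (by simp)
  refine ⟨fderiv ℝ (fun w : E => ‖w‖⁻¹) v h, ?_⟩
  have := (hn.hasFDerivAt.smul (hasFDerivAt_id v)).fderiv
  rw [show (fun w : E => ‖w‖⁻¹ • w) = (fun w : E => ‖w‖⁻¹) • id from rfl]
  erw [this]
  rfl

theorem inner_sphereIncl_vectorDeriv (hO : IsConeOver U O) (x : U)
    (v : EuclideanSpace ℝ (Fin m)) :
    inner ℝ (sphereIncl U x) (vectorDeriv (𝓡 m) (sphereIncl U) x v) = 0 := by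
  have hr := isSmoothRetraction_radial (m := m) hO x
  have h1 : (fun y : U => ‖sphereIncl U y‖ ^ 2) = fun _ => (1 : ℝ) := by
    ext y; rw [norm_sphereIncl]; norm_num
  have hd : DifferentiableAt ℝ (fun w : E => ‖w‖ ^ 2) (sphereIncl U x) :=
    (contDiff_norm_sq ℝ).contDiffAt.differentiableAt (n := ∞) (by simp)
  have h2 := hr.vectorDeriv_comp x hd
  rw [h1, vectorDeriv, mfderiv_const] at h2
  have h4 := (hd.hasDerivAt_line (vectorDeriv (𝓡 m) (sphereIncl U) x v)).unique
    (hasDerivAt_line (sphereIncl U x) (vectorDeriv (𝓡 m) (sphereIncl U) x v)).norm_sq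
  simp only [zero_smul, add_zero] at h4
  have h5 : (0 : ℝ) = fderiv ℝ (fun w : E => ‖w‖ ^ 2) (sphereIncl U x)
    (vectorDeriv (𝓡 m) (sphereIncl U) x v) := DFunLike.congr_fun h2 v
  rw [h4] at h5
  linarith

/-- The tangent space of the sphere is the whole orthogonal complement. -/
theorem exists_vectorDeriv_eq (hO : IsConeOver U O) (x : U) {h : E}
    (hh : inner ℝ (sphereIncl U x) h = 0) :
    ∃ v : EuclideanSpace ℝ (Fin m), vectorDeriv (𝓡 m) (sphereIncl U) x v = h := by
  have hr := isSmoothRetraction_radial (m := m) hO x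
  have hx := sphereIncl_mem hO x
  have h1 := hr.vectorDeriv_retractDeriv hx h
  rw [hr.leftInverse] at h1
  refine ⟨_, h1.trans ?_⟩
  have h2 : (fun w => sphereIncl U (radial U x w)) =ᶠ[nhds (sphereIncl U x)]
      fun w => ‖w‖⁻¹ • w := by
    filter_upwards [hO.isOpen.mem_nhds hx] with w hw
    exact sphereIncl_radial hO x hw
  rw [h2.fderiv_eq, fderiv_normalize (norm_sphereIncl x) hh]

end Sphere

/-! ### The induced form on the sphere is contact -/

section ContactForm

variable {E : Type*} [NormedAddCommGroup E] [InnerProductSpace ℝ E] {m : ℕ}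
  [Fact (Module.finrank ℝ E = m + 1)]
  {U : TopologicalSpace.Opens (Metric.sphere (0 : E) 1)} {O : Set E}

/-- The one-form induced on an open subset of the sphere by a bilinear form on the vector space. -/
def inducedForm (U : TopologicalSpace.Opens (Metric.sphere (0 : E) 1)) (L : E →L[ℝ] E →L[ℝ] ℝ) :
    OneForm (𝓡 m) U :=
  OneForm.pullback (J := 𝓘(ℝ, E)) (sphereIncl U) (fun v => L v)

theorem inducedForm_apply (L : E →L[ℝ] E →L[ℝ] ℝ) (x : U) (v : EuclideanSpace ℝ (Fin m)) :
    inducedForm (m := m) U L x v = L (sphereIncl U x) (vectorDeriv (𝓡 m) (sphereIncl U) x v) := rfl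

variable (m) in
/-- The inverse of a chart of `U`, as a map to the vector space. -/
def chartIncl (x : U) (y : EuclideanSpace ℝ (Fin m)) : E :=
  sphereIncl U ((extChartAt (𝓡 m) x).symm y)

variable (m) in
/-- The derivative of the inverse of a chart. -/
def chartDeriv (x : U) (y : EuclideanSpace ℝ (Fin m)) :
    EuclideanSpace ℝ (Fin m) →L[ℝ] EuclideanSpace ℝ (Fin m) :=
  mfderiv 𝓘(ℝ, EuclideanSpace ℝ (Fin m)) (𝓡 m) (extChartAt (𝓡 m) x).symm y

theorem contDiffOn_chartIncl (x : U) :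
    ContDiffOn ℝ ∞ (chartIncl m x) (extChartAt (𝓡 m) x).target := by
  rw [← contMDiffOn_iff_contDiffOn]
  exact contMDiff_sphereIncl.comp_contMDiffOn (contMDiffOn_extChartAt_symm x)

theorem mdifferentiableAt_extChartAt_symm_of_mem (x : U) {y : EuclideanSpace ℝ (Fin m)}
    (hy : y ∈ (extChartAt (𝓡 m) x).target) :
    MDifferentiableAt 𝓘(ℝ, EuclideanSpace ℝ (Fin m)) (𝓡 m) (extChartAt (𝓡 m) x).symm y :=
  ((contMDiffOn_extChartAt_symm (n := ∞) x).contMDiffAt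
    ((isOpen_extChartAt_target x).mem_nhds hy)).mdifferentiableAt (by simp)

theorem fderiv_chartIncl (x : U) {y : EuclideanSpace ℝ (Fin m)}
    (hy : y ∈ (extChartAt (𝓡 m) x).target) :
    fderiv ℝ (chartIncl m x) y =
      (vectorDeriv (𝓡 m) (sphereIncl U) ((extChartAt (𝓡 m) x).symm y)).comp (chartDeriv m x y) := by
  rw [← mfderiv_eq_fderiv]
  exact mfderiv_comp y ((contMDiff_sphereIncl _).mdifferentiableAt (n := ∞) (by simp))
    (mdifferentiableAt_extChartAt_symm_of_mem x hy)

theorem chartDeriv_bijective (x : U) : Function.Bijective (chartDeriv m x (extChartAt (𝓡 m) x x)) := by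
  have h1 := mfderiv_extChartAt_comp_mfderivWithin_extChartAt_symm (I := 𝓡 m) (x := x)
    (mem_extChartAt_target x)
  have h2 := mfderivWithin_extChartAt_symm_comp_mfderiv_extChartAt (I := 𝓡 m) (x := x)
    (mem_extChartAt_target x)
  rw [show Set.range (𝓡 m) = Set.univ from (𝓡 m).range_eq_univ, mfderivWithin_univ] at h1 h2
  exact ⟨Function.LeftInverse.injective (DFunLike.congr_fun h1),
    Function.RightInverse.surjective (DFunLike.congr_fun h2)⟩

theorem inducedForm_inChart (L : E →L[ℝ] E →L[ℝ] ℝ) (x : U) {y : EuclideanSpace ℝ (Fin m)}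
    (hy : y ∈ (extChartAt (𝓡 m) x).target) :
    (inducedForm (m := m) U L).inChart x y =
      (L (chartIncl m x y)).comp (fderiv ℝ (chartIncl m x) y) := by
  rw [fderiv_chartIncl x hy]
  rfl

/-- At `x` the form takes the value `½` on the tangent vector `Jx`. If `v` is tangent and in the
kernel, then `⟪x, Jv⟫ = -⟪Jx, v⟫ = 0`, so `Jv` is tangent, and `⟪Jx, Jv⟫ = ⟪x, v⟫ = 0`, so it is in
the kernel; finally `dλ(v, Jv) = |v|²`. The argument is carried out in a chart. -/
theorem isContactForm_inducedForm (hO : IsConeOver U O) {J : E →L[ℝ] E}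
    (hJ : IsComplexStructure J) {L : E →L[ℝ] E →L[ℝ] ℝ}
    (hL : ∀ v h, L v h = 1 / 2 * inner ℝ (J v) h) :
    IsContactForm (inducedForm (m := m) U L) where
  smooth x := by
    have h1 := contDiffOn_chartIncl (m := m) x
    have h2 := h1.fderiv_of_isOpen (m := ∞) (isOpen_extChartAt_target x) (by simp)
    exact ((L.contDiff.comp_contDiffOn h1).clm_comp h2).congr
      fun y hy => inducedForm_inChart L x hy
  ne_zero x h := by
    obtain ⟨v, hv⟩ := exists_vectorDeriv_eq (m := m) hO x (hJ.inner_self_right (sphereIncl U x))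
    have h1 : inducedForm (m := m) U L x v = 0 := by rw [h]; rfl
    rw [inducedForm_apply, hv, hL, hJ.inner_map, real_inner_self_eq_norm_sq, norm_sphereIncl] at h1
    norm_num at h1
  nondegenerate x v hv hv0 := by
    set y := extChartAt (𝓡 m) x x with hy
    have hyt : y ∈ (extChartAt (𝓡 m) x).target := mem_extChartAt_target x
    have hgx : (extChartAt (𝓡 m) x).symm y = x := extChartAt_to_inv x
    have ht := (isOpen_extChartAt_target (I := 𝓡 m) x).mem_nhds hyt
    have hsm : ContDiffAt ℝ ∞ (chartIncl m x) y := (contDiffOn_chartIncl (m := m) x).contDiffAt ht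
    have hdg := hsm.differentiableAt (by simp)
    have hddg := (hsm.fderiv_right (m := ∞) (by simp)).differentiableAt (by simp)
    have hbij := chartDeriv_bijective (m := m) x
    have hD := fderiv_chartIncl x hyt
    rw [hgx] at hD
    have hgy : chartIncl m x y = sphereIncl U x := by rw [chartIncl, hgx]
    set D := fderiv ℝ (chartIncl m x) y
    rw [inducedForm_inChart L x hyt] at hv ⊢
    have hv' : L (sphereIncl U x) (D v) = 0 := by rw [← hgy]; exact hv
    -- The second summand contains the second derivative of the inverse chart; it is symmetric in
    -- `a, b` and disappears on antisymmetrization.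
    have hform : ∀ a b : EuclideanSpace ℝ (Fin m),
        fderiv ℝ ((inducedForm (m := m) U L).inChart x) y a b
          = L (D a) (D b) + L (chartIncl m x y) (fderiv ℝ (fderiv ℝ (chartIncl m x)) y a b) := by
      intro a b
      have h1 : (inducedForm (m := m) U L).inChart x =ᶠ[nhds y]
          fun z => (L (chartIncl m x z)).comp (fderiv ℝ (chartIncl m x) z) := by
        filter_upwards [ht] with z hz using inducedForm_inChart L x hz
      have h2 : HasFDerivAt (fun z => (L (chartIncl m x z)).comp (fderiv ℝ (chartIncl m x) z)) _ y :=
        (L.hasFDerivAt.comp y hdg.hasFDerivAt).clm_comp hddg.hasFDerivAt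
      rw [h1.fderiv_eq, h2.fderiv]
      simp [D, add_comm]
    have hsymm := (hsm.isSymmSndFDerivAt (by
      rw [minSmoothness_of_isRCLikeNormedField]; exact ENat.LEInfty.out)).eq
    have horth : inner ℝ (sphereIncl U x) (J (D v)) = 0 := by
      have := hJ.inner_map_left (sphereIncl U x) (D v)
      rw [hL] at hv'
      linarith
    obtain ⟨w₀, hw₀⟩ := exists_vectorDeriv_eq (m := m) hO x horth
    obtain ⟨w, rfl⟩ := hbij.2 w₀
    have hDw : D w = J (D v) := by rw [hD]; exact hw₀.trans (by rw [hD])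
    have hDv : D v ≠ 0 := by
      intro h0
      apply hv0
      apply hbij.1
      rw [map_zero]
      have hr := (isSmoothRetraction_radial (m := m) hO x).retractDeriv_vectorDeriv x
      have h1 : vectorDeriv (𝓡 m) (sphereIncl U) x (chartDeriv m x y v) = 0 := by
        have := DFunLike.congr_fun hD v
        exact this.symm.trans h0
      rw [← hr (chartDeriv m x y v), h1, map_zero]
    refine ⟨w, ?_, ?_⟩
    · show L (chartIncl m x y) (D w) = 0
      rw [hgy, hDw, hL, hJ.inner_map]
      have := inner_sphereIncl_vectorDeriv (m := m) hO x (chartDeriv m x y v)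
      rw [← ContinuousLinearMap.comp_apply, ← hD] at this
      rw [this, mul_zero]
    · rw [hform, hform, hsymm v w, hDw, hL (D v), hL (J (D v)), hJ.inner_map, hJ.sq, inner_neg_left,
        real_inner_self_eq_norm_sq]
      have : 0 < ‖D v‖ ^ 2 := by positivity
      intro h
      linarith

end ContactForm

/-- A smooth map with open range and a smooth left inverse is a smooth embedding. -/
theorem isSmoothEmbedding_of_leftInverse {F : Type*} [NormedAddCommGroup F] [NormedSpace ℝ F]
    {H : Type*} [TopologicalSpace H] {I : ModelWithCorners ℝ F H}
    {M : Type*} [TopologicalSpace M] [ChartedSpace H M] [IsManifold I ∞ M]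
    {N : Type*} [TopologicalSpace N] [ChartedSpace H N] [IsManifold I ∞ N]
    {f : M → N} {g : N → M} (hf : ContMDiff I I ∞ f) (hr : IsOpen (Set.range f))
    (hg : ∀ x, ContMDiffAt I I ∞ g (f x)) (hgf : ∀ x, g (f x) = x) :
    Manifold.IsSmoothEmbedding I I ∞ f := by
  have hfg : ∀ y ∈ Set.range f, f (g y) = y := by
    rintro _ ⟨x, rfl⟩
    rw [hgf]
  have hgr : ContMDiffOn I I ∞ g (Set.range f) := by
    rintro _ ⟨x, rfl⟩
    exact (hg x).contMDiffWithinAt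
  let e : OpenPartialHomeomorph M N :=
    { toFun := f
      invFun := g
      source := Set.univ
      target := Set.range f
      map_source' := fun x _ => ⟨x, rfl⟩
      map_target' := fun _ _ => trivial
      left_inv' := fun x _ => hgf x
      right_inv' := hfg
      open_source := isOpen_univ
      open_target := hr
      continuousOn_toFun := hf.continuous.continuousOn
      continuousOn_invFun := hgr.continuousOn }
  have he : ⇑e.symm = g := rfl
  refine ⟨⟨PUnit, inferInstance, inferInstance, fun x => ?_⟩,
    (e.isOpenEmbedding rfl).isEmbedding⟩
  -- Dimensions agree, so the complement is trivial. With the chart of `N` obtained by applying `g`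
  -- and then the chart of `M`, the map `f` reads as the identity.
  refine Manifold.IsImmersionAtOfComplement.mk_of_continuousAt hf.continuous.continuousAt
    (.prodUnique ℝ F _) (chartAt H x) (e.symm.trans (chartAt H x)) (mem_chart_source H x) ?_
    (IsManifold.chart_mem_maximalAtlas x) ?_ ?_
  · refine ⟨⟨x, rfl⟩, ?_⟩
    show g (f x) ∈ (chartAt H x).source
    rw [hgf]
    exact mem_chart_source H x
  · apply OpenPartialHomeomorph.mem_maximalAtlas_of_contMDiffOn
    · refine (contMDiffOn_chart (I := I) (n := ∞) (x := x)).comp (hgr.mono ?_) ?_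
      · intro y hy; exact hy.1
      · intro y hy; exact hy.2
    · refine hf.comp_contMDiffOn ((contMDiffOn_chart_symm (I := I) (n := ∞) (x := x)).mono ?_)
      intro y hy; exact hy.1
  · intro y hy
    simp only [OpenPartialHomeomorph.extend, PartialEquiv.trans_target, Set.mem_inter_iff,
      Set.mem_preimage] at hy
    have h1 : (chartAt H x) ((chartAt H x).symm (I.symm y)) = I.symm y :=
      (chartAt H x).right_inv hy.2
    have h2 : I (I.symm y) = y := I.right_inv (by simpa using hy.1)
    simp [he, hgf, h1, h2]

/-! ### From homogeneous isotopies of the cone to contact isotopies of the sphere -/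

section ContactMaps

variable {E : Type*} [NormedAddCommGroup E] [InnerProductSpace ℝ E] {m : ℕ}
  [Fact (Module.finrank ℝ E = m + 1)]
  {U : TopologicalSpace.Opens (Metric.sphere (0 : E) 1)} {O : Set E}
  {L : E →L[ℝ] E →L[ℝ] ℝ} {Φ : ℝ → E → E}

/-- The maps of an open subset of the sphere induced by homogeneous maps of a cone. -/
def sphereFlow (x₀ : U) (Φ : ℝ → E → E) (t : ℝ) (x : U) : U := radial U x₀ (Φ t (sphereIncl U x))

theorem sphereIncl_sphereFlow (hO : IsConeOver U O) (hΦ : IsConeIsotopy (fun v h => L v h) O Φ)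
    (x₀ : U) (t : ℝ) (x : U) : sphereIncl U (sphereFlow x₀ Φ t x) =
      ‖Φ t (sphereIncl U x)‖⁻¹ • Φ t (sphereIncl U x) :=
  sphereIncl_radial hO x₀ (hΦ.mapsTo t _ (sphereIncl_mem hO x))

theorem contMDiff_sphereFlow (hO : IsConeOver U O) (hΦ : IsConeIsotopy (fun v h => L v h) O Φ)
    (x₀ : U) : ContMDiff (𝓘(ℝ, ℝ).prod (𝓡 m)) (𝓡 m) ∞
      (fun p : ℝ × U => sphereFlow x₀ Φ p.1 p.2) := by
  intro p
  have hr := isSmoothRetraction_radial (m := m) hO x₀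
  refine ContMDiffAt.comp p (g := radial U x₀) (hr.contMDiffAt _ (hΦ.mapsTo p.1 _
    (sphereIncl_mem hO p.2))) ?_
  have h1 : ContMDiffAt (𝓘(ℝ, ℝ).prod (𝓡 m)) 𝓘(ℝ, ℝ × E) ∞
      (fun p : ℝ × U => (p.1, sphereIncl U p.2)) p :=
    contMDiffAt_fst.prodMk_space ((contMDiff_sphereIncl p.2).comp p contMDiffAt_snd)
  exact ContMDiffAt.comp p (g := fun u : ℝ × E => Φ u.1 u.2)
    (hΦ.smooth p.1 _ (sphereIncl_mem hO p.2)).contMDiffAt h1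

theorem contMDiff_sphereFlow_apply (hO : IsConeOver U O)
    (hΦ : IsConeIsotopy (fun v h => L v h) O Φ) (x₀ : U) (t : ℝ) :
    ContMDiff (𝓡 m) (𝓡 m) ∞ (sphereFlow x₀ Φ t) :=
  (contMDiff_sphereFlow hO hΦ x₀).comp (contMDiff_const.prodMk contMDiff_id)

/-- `Φ t` preserves the form, and normalization `v ↦ v/|v|` multiplies it by `|v|⁻²`, because the
form is bilinear in point and vector and vanishes on the radial direction. -/
theorem isConformal_sphereFlow (hO : IsConeOver U O) (hΦ : IsConeIsotopy (fun v h => L v h) O Φ)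
    (hL : ∀ v, L v v = 0) (x₀ : U) (t : ℝ) :
    IsConformal (inducedForm (m := m) U L) (inducedForm (m := m) U L) (sphereFlow x₀ Φ t) := by
  intro x
  have hr := isSmoothRetraction_radial (m := m) hO x₀
  have hx := sphereIncl_mem hO x
  have hΦx := hΦ.mapsTo t _ hx
  have h0 : Φ t (sphereIncl U x) ≠ 0 := fun h => hO.zero_notMem (h ▸ hΦx)
  have hn : 0 < ‖Φ t (sphereIncl U x)‖ := norm_pos_iff.2 h0
  obtain ⟨hd, hp⟩ := hΦ.preserves t _ hx
  refine ⟨‖Φ t (sphereIncl U x)‖⁻¹ ^ 2, by positivity, ?_⟩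
  ext v
  have hN := (contDiffAt_normalize h0).differentiableAt (n := ∞) (by simp)
  have h1 : vectorDeriv (𝓡 m) (sphereIncl U) (sphereFlow x₀ Φ t x)
      (mfderiv (𝓡 m) (𝓡 m) (sphereFlow x₀ Φ t) x v) = fderiv ℝ (fun w : E => ‖w‖⁻¹ • w)
        (Φ t (sphereIncl U x)) (fderiv ℝ (Φ t) (sphereIncl U x)
          (vectorDeriv (𝓡 m) (sphereIncl U) x v)) := by
    have h2 := mfderiv_comp x (hr.mdifferentiableAt (sphereFlow x₀ Φ t x))
      ((contMDiff_sphereFlow_apply hO hΦ x₀ t x).mdifferentiableAt (by simp))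
    have h3 := hr.vectorDeriv_comp x (f := (fun w : E => ‖w‖⁻¹ • w) ∘ Φ t) (hN.comp _ hd)
    rw [fderiv_comp _ hN hd] at h3
    have h4 : sphereIncl U ∘ sphereFlow x₀ Φ t =
        fun y => ((fun w : E => ‖w‖⁻¹ • w) ∘ Φ t) (sphereIncl U y) :=
      funext fun y => sphereIncl_sphereFlow hO hΦ x₀ t y
    rw [h4] at h2
    exact (DFunLike.congr_fun h2 v).symm.trans (DFunLike.congr_fun h3 v)
  obtain ⟨b, hb⟩ := fderiv_normalize_apply h0 (fderiv ℝ (Φ t) (sphereIncl U x)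
    (vectorDeriv (𝓡 m) (sphereIncl U) x v))
  show L (sphereIncl U (sphereFlow x₀ Φ t x)) (vectorDeriv (𝓡 m) (sphereIncl U)
      (sphereFlow x₀ Φ t x) (mfderiv (𝓡 m) (𝓡 m) (sphereFlow x₀ Φ t) x v)) =
    ‖Φ t (sphereIncl U x)‖⁻¹ ^ 2 * L (sphereIncl U x) (vectorDeriv (𝓡 m) (sphereIncl U) x v)
  have hp' : L (Φ t (sphereIncl U x)) (fderiv ℝ (Φ t) (sphereIncl U x)
      (vectorDeriv (𝓡 m) (sphereIncl U) x v)) =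
      L (sphereIncl U x) (vectorDeriv (𝓡 m) (sphereIncl U) x v) := hp _
  rw [h1, hb, sphereIncl_sphereFlow hO hΦ, ← hp']
  simp only [map_smul, map_add, smul_apply, smul_eq_mul, hL]
  ring

/-- The smooth left inverse makes the derivative injective, hence bijective in finite dimension, so
`Φ t` is a local homeomorphism. -/
theorem isOpen_image_cone [FiniteDimensional ℝ E] (hO : IsOpen O)
    (hΦ : IsConeIsotopy (fun v h => L v h) O Φ) (t : ℝ) : IsOpen (Φ t '' O) := by
  rw [isOpen_iff_mem_nhds]
  rintro _ ⟨y, hy, rfl⟩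
  obtain ⟨Ψ, hΨ⟩ := hΦ.leftInverse t
  have hs : ContDiffAt ℝ ∞ (Φ t) y :=
    (hΦ.smooth t y hy).comp y (contDiffAt_const.prodMk contDiffAt_id)
  have hst := hs.hasStrictFDerivAt (by simp)
  have h1 : Ψ ∘ Φ t =ᶠ[nhds y] id := by
    filter_upwards [hO.mem_nhds hy] with z hz using (hΨ z hz).2
  have h2 := fderiv_comp y ((hΨ y hy).1.differentiableAt (by simp)) (hΦ.preserves t y hy).1
  rw [h1.fderiv_eq, fderiv_id] at h2
  have h3 : Function.Injective (fderiv ℝ (Φ t) y : E →ₗ[ℝ] E) :=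
    Function.LeftInverse.injective (g := fderiv ℝ Ψ (Φ t y))
      fun v => (DFunLike.congr_fun h2 v).symm
  have h4 := LinearMap.injective_iff_surjective.1 h3
  have := FiniteDimensional.complete ℝ E
  rw [← hst.map_nhds_eq_of_surj (LinearMap.range_eq_top.2 h4)]
  exact Filter.image_mem_map (hO.mem_nhds hy)

theorem isContactEmbedding_sphereFlow [FiniteDimensional ℝ E] (hO : IsConeOver U O)
    (hΦ : IsConeIsotopy (fun v h => L v h) O Φ) (hL : ∀ v, L v v = 0) (x₀ : U) (t : ℝ) :
    IsContactEmbedding (inducedForm (m := m) U L) (inducedForm (m := m) U L)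
      (sphereFlow x₀ Φ t) := by
  refine ⟨?_, isConformal_sphereFlow hO hΦ hL x₀ t⟩
  have hr := isSmoothRetraction_radial (m := m) hO x₀
  obtain ⟨Ψ, hΨ⟩ := hΦ.leftInverse t
  -- By homogeneity the normalization of the value is a rescaling of the argument. So the image of
  -- `U` is the trace of `Φ t '' O` on the sphere, and a left inverse of `Φ t` followed by radial
  -- projection is a left inverse of the induced map.
  have hincl : ∀ x : U, ∃ a : ℝ, 0 < a ∧
      sphereIncl U (sphereFlow x₀ Φ t x) = Φ t (a • sphereIncl U x) := by
    intro x
    have hx := sphereIncl_mem hO x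
    have h0 : Φ t (sphereIncl U x) ≠ 0 := fun h => hO.zero_notMem (h ▸ hΦ.mapsTo t _ hx)
    have ha : 0 < ‖Φ t (sphereIncl U x)‖⁻¹ := by positivity
    exact ⟨_, ha, by rw [hΦ.map_smul t _ hx _ ha, sphereIncl_sphereFlow hO hΦ]⟩
  refine isSmoothEmbedding_of_leftInverse (g := fun x => radial U x₀ (Ψ (sphereIncl U x)))
    (contMDiff_sphereFlow_apply hO hΦ x₀ t) ?_ ?_ ?_
  · have : Set.range (sphereFlow x₀ Φ t) = sphereIncl U ⁻¹' (Φ t '' O) := by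
      ext y
      constructor
      · rintro ⟨x, rfl⟩
        obtain ⟨a, ha, h⟩ := hincl x
        exact ⟨_, hO.smul_mem a ha _ (sphereIncl_mem hO x), h.symm⟩
      · rintro ⟨v, hv, h⟩
        refine ⟨radial U x₀ v, ?_⟩
        apply sphereIncl_injective
        have h0 : v ≠ 0 := fun h => hO.zero_notMem (h ▸ hv)
        have hv' : 0 < ‖v‖⁻¹ := by positivity
        rw [sphereIncl_sphereFlow hO hΦ, sphereIncl_radial hO x₀ hv, hΦ.map_smul t v hv _ hv', h,
          norm_smul, norm_sphereIncl, norm_inv, norm_norm, mul_one, inv_inv, smul_smul,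
          mul_inv_cancel₀ (norm_ne_zero_iff.2 h0), one_smul]
    rw [this]
    exact (isOpen_image_cone hO.isOpen hΦ t).preimage (contMDiff_sphereIncl (m := m)).continuous
  · intro x
    obtain ⟨a, ha, h⟩ := hincl x
    have hax := hO.smul_mem a ha _ (sphereIncl_mem hO x)
    have h1 : ContDiffAt ℝ ∞ Ψ (sphereIncl U (sphereFlow x₀ Φ t x)) := by
      rw [h]; exact (hΨ _ hax).1
    have h2 : Ψ (sphereIncl U (sphereFlow x₀ Φ t x)) ∈ O := by rw [h, (hΨ _ hax).2]; exact hax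
    exact ContMDiffAt.comp _ (g := radial U x₀) (hr.contMDiffAt _ h2)
      (ContMDiffAt.comp _ h1.contMDiffAt (contMDiff_sphereIncl _))
  · intro x
    obtain ⟨a, ha, h⟩ := hincl x
    have hax := hO.smul_mem a ha _ (sphereIncl_mem hO x)
    apply sphereIncl_injective
    rw [h, (hΨ _ hax).2, sphereIncl_radial hO x₀ hax, norm_smul, norm_sphereIncl, mul_one,
      Real.norm_eq_abs, abs_of_pos ha, smul_smul, inv_mul_cancel₀ ha.ne', one_smul]

theorem isContactlyIsotopicToId_sphereFlow [FiniteDimensional ℝ E] (hO : IsConeOver U O)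
    (hΦ : IsConeIsotopy (fun v h => L v h) O Φ) (hL : ∀ v, L v v = 0) (x₀ : U) :
    IsContactlyIsotopicToId (inducedForm (m := m) U L) (sphereFlow x₀ Φ 1) := by
  refine ⟨sphereFlow x₀ Φ, (contMDiff_sphereFlow hO hΦ x₀).contMDiffOn,
    fun t _ => isContactEmbedding_sphereFlow hO hΦ hL x₀ t, ?_, rfl⟩
  ext1 x
  apply sphereIncl_injective
  rw [sphereIncl_sphereFlow hO hΦ, hΦ.zero _ (sphereIncl_mem hO x), norm_sphereIncl]
  simp

/-- If `R` is a nonnegative quadratic function with positivity set `O`, the region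
`|v|² - R v ≤ b R v` of the sphere is compact in `U`. -/
theorem isCompact_region [FiniteDimensional ℝ E] (hO : IsConeOver U O) {R : E → ℝ}
    (hR : Continuous R) (hRO : ∀ v, v ∈ O ↔ 0 < R v) {b : ℝ} (hb : 0 ≤ b) :
    IsCompact {x : U | 1 ≤ (1 + b) * R (sphereIncl U x)} := by
  have hemb : Topology.IsEmbedding (sphereIncl U) :=
    Topology.IsEmbedding.subtypeVal.comp Topology.IsEmbedding.subtypeVal
  rw [hemb.isCompact_iff]
  have : sphereIncl U '' {x : U | 1 ≤ (1 + b) * R (sphereIncl U x)} =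
      Metric.sphere (0 : E) 1 ∩ {v | 1 ≤ (1 + b) * R v} := by
    ext v
    constructor
    · rintro ⟨x, hx, rfl⟩
      exact ⟨by simp [norm_sphereIncl], hx⟩
    · rintro ⟨hv, hv1⟩
      have hv2 : v ∈ O := by
        rw [hRO]
        by_contra h
        have : (1 + b) * R v ≤ 0 := mul_nonpos_of_nonneg_of_nonpos (by positivity) (not_lt.1 h)
        have h1 : 1 ≤ (1 + b) * R v := hv1
        linarith
      exact ⟨⟨⟨v, hv⟩, (hO.mem_iff _).2 hv2⟩, hv1, rfl⟩
  rw [this]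
  have : ProperSpace E := FiniteDimensional.proper_real E
  exact (isCompact_sphere _ _).inter_right (isClosed_le continuous_const (by fun_prop))

/-- The regions `|v|² - R v ≤ b R v` shrink to the set where `R v = |v|²`. -/
theorem exists_region_subset [FiniteDimensional ℝ E] (hO : IsConeOver U O) {R : E → ℝ}
    (hR : Continuous R) (hRO : ∀ v, v ∈ O ↔ 0 < R v) (hR1 : ∀ v, R v ≤ ‖v‖ ^ 2)
    {W : Set U} (hW : IsOpen W) (hRW : {x : U | R (sphereIncl U x) = 1} ⊆ W) :
    ∃ b : ℝ, 0 < b ∧ {x : U | 1 ≤ (1 + b) * R (sphereIncl U x)} ⊆ W := by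
  -- The region for `b = 1`, minus `W`, is compact, and `R < 1` on it. If it is nonempty, its
  -- maximum of `R` bounds how large `b` may be.
  have hc := (isCompact_region hO hR hRO zero_le_one).diff hW
  have hcont : Continuous fun x : U => R (sphereIncl U x) :=
    hR.comp (continuous_subtype_val.comp continuous_subtype_val)
  have hle : ∀ x : U, R (sphereIncl U x) ≤ 1 := fun x => by
    simpa [norm_sphereIncl] using hR1 (sphereIncl U x)
  have hpos : ∀ x : U, 0 < R (sphereIncl U x) := fun x => (hRO _).1 (sphereIncl_mem hO x)
  rcases Set.eq_empty_or_nonempty ({x : U | 1 ≤ (1 + 1) * R (sphereIncl U x)} \ W) with h | h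
  · exact ⟨1, one_pos, Set.sdiff_eq_empty.1 h⟩
  · obtain ⟨z, hz, hmax⟩ := hc.exists_isMaxOn h hcont.continuousOn
    have hz1 : R (sphereIncl U z) < 1 := lt_of_le_of_ne (hle z) fun h => hz.2 (hRW h)
    have hz0 := hpos z
    have hz2 : 0 < (1 - R (sphereIncl U z)) / 2 := by linarith
    -- The bound 1 keeps the region inside the one just treated. With `s = 1 - R z > 0`, a point
    -- outside `W` would satisfy `1 ≤ (1 + s/2)(1 - s) < 1`.
    refine ⟨min 1 ((1 - R (sphereIncl U z)) / 2), lt_min one_pos hz2, fun x hx => ?_⟩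
    by_contra hxW
    have hx' : 1 ≤ (1 + min 1 ((1 - R (sphereIncl U z)) / 2)) * R (sphereIncl U x) := hx
    have hx0 := hpos x
    have h1 := mul_le_mul_of_nonneg_right (min_le_left 1 ((1 - R (sphereIncl U z)) / 2)) hx0.le
    have h2 := mul_le_mul_of_nonneg_right (min_le_right 1 ((1 - R (sphereIncl U z)) / 2)) hx0.le
    have h3 : x ∈ {x : U | 1 ≤ (1 + 1) * R (sphereIncl U x)} \ W := by
      refine ⟨?_, hxW⟩
      show 1 ≤ (1 + 1) * R (sphereIncl U x)
      linarith
    have h4 : R (sphereIncl U x) ≤ R (sphereIncl U z) := hmax h3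
    nlinarith

/-- Contracting isotopies of cones give elements of `contractingEmbeddings`. -/
theorem exists_contractingEmbedding [FiniteDimensional ℝ E] (hO : IsConeOver U O) {R : E → ℝ}
    (hR : Continuous R) (hRs : ∀ (a : ℝ) v, R (a • v) = a ^ 2 * R v)
    (hRO : ∀ v, v ∈ O ↔ 0 < R v) (hR1 : ∀ v, R v ≤ ‖v‖ ^ 2)
    (hL : ∀ v, L v v = 0) (x₀ : U)
    (hΦ : ∀ b : ℝ, 0 < b → ∃ Φ, IsConeIsotopy (fun v h => L v h) O Φ ∧
      ∀ v ∈ O, ‖Φ 1 v‖ ^ 2 ≤ (1 + b) * R (Φ 1 v))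
    {W : Set U} (hW : IsOpen W) (hRW : {x : U | R (sphereIncl U x) = 1} ⊆ W) :
    ∃ σ ∈ contractingEmbeddings (inducedForm (m := m) U L), Set.range σ ⊆ W := by
  obtain ⟨b, hb, hbW⟩ := exists_region_subset hO hR hRO hR1 hW hRW
  obtain ⟨Φ, hΦ, hΦb⟩ := hΦ b hb
  have hrange : Set.range (sphereFlow x₀ Φ 1) ⊆ {x : U | 1 ≤ (1 + b) * R (sphereIncl U x)} := by
    rintro _ ⟨x, rfl⟩
    have hx := sphereIncl_mem hO x
    have h0 : Φ 1 (sphereIncl U x) ≠ 0 := fun h => hO.zero_notMem (h ▸ hΦ.mapsTo 1 _ hx)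
    have hn : 0 < ‖Φ 1 (sphereIncl U x)‖ ^ 2 := by positivity
    show 1 ≤ (1 + b) * R (sphereIncl U (sphereFlow x₀ Φ 1 x))
    rw [sphereIncl_sphereFlow hO hΦ, hRs, inv_pow, mul_left_comm, ← div_eq_inv_mul, le_div_iff₀ hn,
      one_mul]
    exact hΦb _ hx
  refine ⟨_, ⟨isContactEmbedding_sphereFlow hO hΦ hL x₀ 1,
    isContactlyIsotopicToId_sphereFlow hO hΦ hL x₀, ?_⟩, hrange.trans hbW⟩
  have hK := isCompact_region hO hR hRO hb.le
  exact hK.of_isClosed_subset isClosed_closure (closure_minimal hrange hK.isClosed)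

end ContactMaps

/-! ### Coordinates on `ℝ^{2n}` -/

theorem sum_fin_two_mul {A : Type*} [AddCommMonoid A] {n : ℕ} (f : Fin (2 * n) → A) :
    ∑ i, f i = ∑ i : Fin n, (f (xIdx i) + f (yIdx i)) := by
  have e : n + n = 2 * n := by ring
  rw [← Equiv.sum_comp (finCongr e), Fin.sum_univ_add, Finset.sum_add_distrib]
  rfl

theorem fin_two_mul_cases {n : ℕ} {P : Fin (2 * n) → Prop} (hx : ∀ i : Fin n, P (xIdx i))
    (hy : ∀ i : Fin n, P (yIdx i)) (i : Fin (2 * n)) : P i := by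
  by_cases h : (i : ℕ) < n
  · exact hx ⟨i, h⟩
  · have : i = yIdx ⟨i - n, by omega⟩ := by ext; simp [yIdx]; omega
    rw [this]
    exact hy _

/-- The map `(x, y) ↦ (-y, x)` on coordinates. -/
def complexStructureFun {n : ℕ} (v : EuclideanSpace ℝ (Fin (2 * n))) (i : Fin (2 * n)) : ℝ :=
  if h : (i : ℕ) < n then -v (yIdx ⟨i, h⟩) else v (xIdx ⟨i - n, by omega⟩)

/-- The standard complex structure of `ℝ^{2n}`. -/
def stdComplexStructure (n : ℕ) :
    EuclideanSpace ℝ (Fin (2 * n)) →L[ℝ] EuclideanSpace ℝ (Fin (2 * n)) :=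
  LinearMap.toContinuousLinearMap
    { toFun := fun v => WithLp.toLp 2 (complexStructureFun v)
      map_add' := fun v w => by
        ext i
        simp only [complexStructureFun, PiLp.add_apply]
        split_ifs <;> ring
      map_smul' := fun a v => by
        ext i
        simp only [complexStructureFun, PiLp.smul_apply, RingHom.id_apply, smul_eq_mul]
        split_ifs <;> ring }

@[simp]
theorem stdComplexStructure_xIdx {n : ℕ} (v : EuclideanSpace ℝ (Fin (2 * n))) (i : Fin n) :
    stdComplexStructure n v (xIdx i) = -v (yIdx i) := by
  show complexStructureFun v (xIdx i) = _
  rw [complexStructureFun, dif_pos (show ((xIdx i : Fin (2 * n)) : ℕ) < n from i.2)]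
  rfl

@[simp]
theorem stdComplexStructure_yIdx {n : ℕ} (v : EuclideanSpace ℝ (Fin (2 * n))) (i : Fin n) :
    stdComplexStructure n v (yIdx i) = v (xIdx i) := by
  show complexStructureFun v (yIdx i) = _
  rw [complexStructureFun, dif_neg (by simp [yIdx])]
  have : (⟨((yIdx i : Fin (2 * n)) : ℕ) - n, by simp [yIdx]⟩ : Fin n) = i := by ext; simp [yIdx]
  rw [this]

theorem inner_fin_two_mul {n : ℕ} (v w : EuclideanSpace ℝ (Fin (2 * n))) :
    inner ℝ v w = ∑ i : Fin n, (v (xIdx i) * w (xIdx i) + v (yIdx i) * w (yIdx i)) := by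
  rw [PiLp.inner_apply, sum_fin_two_mul]
  simp [mul_comm]

theorem isComplexStructure_std (n : ℕ) : IsComplexStructure (stdComplexStructure n) where
  inner_self w := by
    rw [inner_fin_two_mul]
    refine Finset.sum_eq_zero fun i _ => ?_
    simp only [stdComplexStructure_xIdx, stdComplexStructure_yIdx]
    ring
  inner_map w v := by
    rw [inner_fin_two_mul, inner_fin_two_mul]
    refine Finset.sum_congr rfl fun i _ => ?_
    simp only [stdComplexStructure_xIdx, stdComplexStructure_yIdx]
    ring
  sq w := by
    ext i
    induction i using fin_two_mul_cases with
    | hx i => simp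
    | hy i => simp

theorem stdLiouville_apply (n : ℕ) (v h : EuclideanSpace ℝ (Fin (2 * n))) :
    stdLiouville n v h = 1 / 2 * inner ℝ (stdComplexStructure n v) h := by
  rw [inner_fin_two_mul]
  simp only [stdLiouville, smul_apply, sum_apply, sub_apply, smul_eq_mul, stdComplexStructure_xIdx,
    stdComplexStructure_yIdx, PiLp.proj_apply]
  congr 1
  refine Finset.sum_congr rfl fun i _ => ?_
  ring

/-- The standard Liouville form as a bilinear map. -/
def stdLiouvilleBilin (n : ℕ) :
    EuclideanSpace ℝ (Fin (2 * n)) →L[ℝ] EuclideanSpace ℝ (Fin (2 * n)) →L[ℝ] ℝ :=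
  (1 / 2 : ℝ) • (innerSL ℝ).comp (stdComplexStructure n)

theorem stdLiouvilleBilin_apply (n : ℕ) (v h : EuclideanSpace ℝ (Fin (2 * n))) :
    stdLiouvilleBilin n v h = 1 / 2 * inner ℝ (stdComplexStructure n v) h := rfl

theorem stdLiouvilleBilin_eq (n : ℕ) (v : EuclideanSpace ℝ (Fin (2 * n))) :
    stdLiouvilleBilin n v = stdLiouville n v := by
  ext h
  rw [stdLiouville_apply, stdLiouvilleBilin_apply]

theorem sphereForm_eq (n k : ℕ) [NeZero n] :
    sphereForm n k = inducedForm (sphereCompl n k) (stdLiouvilleBilin n) := by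
  unfold inducedForm sphereForm
  congr 1
  ext1 v
  exact (stdLiouvilleBilin_eq n v).symm

section Splitting

variable {n m l : ℕ} (e : Fin n ≃ Fin m ⊕ Fin l)

/-- The splitting of `ℝ^{2n}` defined by a splitting of the index set: the coordinates `x_i` and
`y_i` with `i` in the first part form the first two components. -/
def splitLinear : EuclideanSpace ℝ (Fin (2 * n)) →ₗ[ℝ]
    EuclideanSpace ℝ (Fin m) × EuclideanSpace ℝ (Fin m) × EuclideanSpace ℝ (Fin (2 * l)) where
  toFun v := (WithLp.toLp 2 fun i => v (xIdx (e.symm (.inl i))),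
    WithLp.toLp 2 fun i => v (yIdx (e.symm (.inl i))),
    WithLp.toLp 2 fun i => if h : (i : ℕ) < l then v (xIdx (e.symm (.inr ⟨i, h⟩)))
      else v (yIdx (e.symm (.inr ⟨i - l, by omega⟩))))
  map_add' v w := by
    ext i
    · rfl
    · rfl
    · simp only [PiLp.add_apply, Prod.snd_add]; split_ifs <;> rfl
  map_smul' a v := by
    ext i
    · rfl
    · rfl
    · simp only [PiLp.smul_apply, Prod.smul_snd, RingHom.id_apply]; split_ifs <;> rfl

theorem splitLinear_fst (v : EuclideanSpace ℝ (Fin (2 * n))) (i : Fin m) :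
    (splitLinear e v).1 i = v (xIdx (e.symm (.inl i))) := rfl

theorem splitLinear_snd_fst (v : EuclideanSpace ℝ (Fin (2 * n))) (i : Fin m) :
    (splitLinear e v).2.1 i = v (yIdx (e.symm (.inl i))) := rfl

theorem splitLinear_xIdx (v : EuclideanSpace ℝ (Fin (2 * n))) (i : Fin l) :
    (splitLinear e v).2.2 (xIdx i) = v (xIdx (e.symm (.inr i))) :=
  dif_pos (show ((xIdx i : Fin (2 * l)) : ℕ) < l from i.2)

theorem splitLinear_yIdx (v : EuclideanSpace ℝ (Fin (2 * n))) (i : Fin l) :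
    (splitLinear e v).2.2 (yIdx i) = v (yIdx (e.symm (.inr i))) := by
  refine (dif_neg (by simp [yIdx])).trans ?_
  have : (⟨((yIdx i : Fin (2 * l)) : ℕ) - l, by simp [yIdx]⟩ : Fin l) = i := by ext; simp [yIdx]
  rw [this]

theorem sum_split {A : Type*} [AddCommMonoid A] (f : Fin n → A) :
    ∑ i, f i = ∑ i : Fin m, f (e.symm (.inl i)) + ∑ i : Fin l, f (e.symm (.inr i)) := by
  rw [← Equiv.sum_comp e.symm, Fintype.sum_sum_type]

theorem norm_sq_splitLinear (v : EuclideanSpace ℝ (Fin (2 * n))) :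
    ‖(splitLinear e v).1‖ ^ 2 + ‖(splitLinear e v).2.1‖ ^ 2 + ‖(splitLinear e v).2.2‖ ^ 2
      = ‖v‖ ^ 2 := by
  rw [← real_inner_self_eq_norm_sq v, inner_fin_two_mul, sum_split e,
    ← real_inner_self_eq_norm_sq (splitLinear e v).2.2, inner_fin_two_mul,
    EuclideanSpace.real_norm_sq_eq, EuclideanSpace.real_norm_sq_eq, ← Finset.sum_add_distrib]
  simp only [splitLinear_xIdx, splitLinear_yIdx, splitLinear_fst, splitLinear_snd_fst, sq]

/-- The splitting never separates `x_i` from `y_i`, so the form splits as a sum over the two blocks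
of indices. -/
theorem linearLiouville_splitLinear (v h : EuclideanSpace ℝ (Fin (2 * n))) :
    linearLiouville (stdComplexStructure l) (splitLinear e v) (splitLinear e h)
      = stdLiouvilleBilin n v h := by
  rw [stdLiouvilleBilin_apply, inner_fin_two_mul, sum_split e, linearLiouville, inner_fin_two_mul,
    PiLp.inner_apply, PiLp.inner_apply, ← Finset.sum_sub_distrib]
  simp only [splitLinear_xIdx, splitLinear_yIdx, splitLinear_fst, splitLinear_snd_fst,
    stdComplexStructure_xIdx, stdComplexStructure_yIdx]
  congr 2
  refine Finset.sum_congr rfl fun i _ => ?_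
  simp
  ring

theorem splitLinear_injective : Function.Injective (splitLinear e) := by
  rw [← LinearMap.ker_eq_bot, LinearMap.ker_eq_bot']
  intro v hv
  have := norm_sq_splitLinear e v
  rw [hv] at this
  simpa using this.symm

/-- The splitting as a linear equivalence. -/
def splitEquiv : EuclideanSpace ℝ (Fin (2 * n)) ≃L[ℝ]
    EuclideanSpace ℝ (Fin m) × EuclideanSpace ℝ (Fin m) × EuclideanSpace ℝ (Fin (2 * l)) :=
  (LinearEquiv.ofInjectiveOfFinrankEq (splitLinear e) (splitLinear_injective e) (by
    have := Fintype.card_congr e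
    simp only [Fintype.card_sum, Fintype.card_fin] at this
    simp
    omega)).toContinuousLinearEquiv

theorem splitEquiv_apply (v : EuclideanSpace ℝ (Fin (2 * n))) :
    splitEquiv e v = splitLinear e v := rfl

end Splitting

/-! ### Transport of cone isotopies -/

theorem IsConeIsotopy.conj {E F : Type*} [NormedAddCommGroup E] [NormedSpace ℝ E]
    [NormedAddCommGroup F] [NormedSpace ℝ F] {α : F → F → ℝ} {β : E → E → ℝ} {O : Set F}
    {Φ : ℝ → F → F} (hΦ : IsConeIsotopy α O Φ) (T : E ≃L[ℝ] F)
    (hT : ∀ v h, α (T v) (T h) = β v h) :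
    IsConeIsotopy β (T ⁻¹' O) (fun t v => T.symm (Φ t (T v))) where
  smooth t y hy := by
    refine T.symm.contDiff.contDiffAt.comp (t, y) ?_
    exact ContDiffAt.comp (t, y) (g := fun u : ℝ × F => Φ u.1 u.2) (hΦ.smooth t _ hy)
      (contDiffAt_fst.prodMk (T.contDiff.contDiffAt.comp (t, y) contDiffAt_snd))
  mapsTo t y hy := by
    show T (T.symm _) ∈ O
    rw [T.apply_symm_apply]
    exact hΦ.mapsTo t _ hy
  map_smul t y hy a ha := by
    rw [T.map_smul, hΦ.map_smul t _ hy a ha, T.symm.map_smul]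
  preserves t y hy := by
    have h1 : PreservesFormAt β α T y := ⟨T.differentiableAt, fun h => by
      rw [T.fderiv]; exact hT y h⟩
    have h2 : PreservesFormAt α β T.symm (Φ t (T y)) := ⟨T.symm.differentiableAt, fun h => by
      rw [T.symm.fderiv, ← hT]
      show α (T (T.symm _)) (T (T.symm h)) = _
      rw [T.apply_symm_apply, T.apply_symm_apply]⟩
    exact h2.comp (f := fun v => Φ t (T v)) ((hΦ.preserves t _ hy).comp h1)
  zero y hy := by rw [hΦ.zero _ hy, T.symm_apply_apply]
  leftInverse t := by
    obtain ⟨Ψ, hΨ⟩ := hΦ.leftInverse t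
    refine ⟨fun v => T.symm (Ψ (T v)), fun y hy => ⟨?_, ?_⟩⟩
    · refine T.symm.contDiff.contDiffAt.comp _ (ContDiffAt.comp _ ?_ T.contDiff.contDiffAt)
      rw [T.apply_symm_apply]
      exact (hΨ _ hy).1
    · beta_reduce
      rw [T.apply_symm_apply, (hΨ _ hy).2, T.symm_apply_apply]

/-! ### The coordinate planes `Π_k` and the cone over the complement -/

section Planes

variable {n : ℕ} (k : ℕ)

theorem mem_coordPlane_iff {v : EuclideanSpace ℝ (Fin (2 * n))} :
    v ∈ coordPlane n k ↔ ∀ i : Fin (2 * n), (i : ℕ) + k < 2 * n → v i = 0 := by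
  constructor
  · intro hv i hi
    induction hv using Submodule.span_induction with
    | mem v hv =>
      obtain ⟨j, hj, rfl⟩ := hv
      have : i ≠ j := by rintro rfl; omega
      simp [this]
    | zero => rfl
    | add v w _ _ hv hw => rw [PiLp.add_apply, hv, hw, add_zero]
    | smul a v _ hv => rw [PiLp.smul_apply, hv, smul_zero]
  · intro h
    have : v = ∑ i, v i • EuclideanSpace.single i (1 : ℝ) := by
      ext j
      simp [Finset.sum_apply, Pi.single_apply]
    rw [this]
    refine Submodule.sum_mem _ fun i _ => ?_
    by_cases hi : (i : ℕ) + k < 2 * n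
    · rw [h i hi, zero_smul]; exact Submodule.zero_mem _
    · exact Submodule.smul_mem _ _ (Submodule.subset_span ⟨i, by omega, rfl⟩)

theorem mem_coordPlane_orthogonal {v : EuclideanSpace ℝ (Fin (2 * n))}
    (h : ∀ i : Fin (2 * n), 2 * n ≤ (i : ℕ) + k → v i = 0) : v ∈ (coordPlane n k)ᗮ := by
  rw [Submodule.mem_orthogonal]
  intro w hw
  rw [PiLp.inner_apply]
  refine Finset.sum_eq_zero fun i _ => ?_
  by_cases hi : (i : ℕ) + k < 2 * n
  · rw [(mem_coordPlane_iff k).1 hw i hi, inner_zero_left]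
  · rw [h i (by omega), inner_zero_right]

theorem isConeOver_coordPlane [NeZero n] :
    IsConeOver (sphereCompl n k) {v | v ∉ coordPlane n k} where
  isOpen := (coordPlane n k).closed_of_finiteDimensional.isOpen_compl
  zero_notMem h := h (Submodule.zero_mem _)
  smul_mem a ha v hv h := by
    apply hv
    have := Submodule.smul_mem _ a⁻¹ h
    rwa [smul_smul, inv_mul_cancel₀ ha.ne', one_smul] at this
  mem_iff x := Iff.rfl

end Planes

/-! ### Contracting embeddings and convexity at infinity -/

section SphereCompl

variable {n k : ℕ}

theorem coneSize_le_norm_sq {m l : ℕ} (e : Fin n ≃ Fin m ⊕ Fin l) {c : ℝ} (hc : c ≤ 1)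
    (v : EuclideanSpace ℝ (Fin (2 * n))) : coneSize c (splitLinear e v) ≤ ‖v‖ ^ 2 := by
  rw [← norm_sq_splitLinear e v, coneSize]
  nlinarith [sq_nonneg ‖(splitLinear e v).2.1‖, sq_nonneg ‖(splitLinear e v).2.2‖]

/-- Contracting isotopies of the cones in the model coordinates. -/
theorem exists_coneIsotopy {m l : ℕ} {c : ℝ} (hc : c = 0 ∨ c = 1) {b : ℝ} (hb : 0 < b) :
    ∃ Φ, IsConeIsotopy (linearLiouville (stdComplexStructure l))
        (coneDomain c : Set (EuclideanSpace ℝ (Fin m) × EuclideanSpace ℝ (Fin m) × _)) Φ ∧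
      ∀ y ∈ coneDomain c, ‖(Φ 1 y).1‖ ^ 2 + ‖(Φ 1 y).2.1‖ ^ 2 + ‖(Φ 1 y).2.2‖ ^ 2
        ≤ (1 + b) * coneSize c (Φ 1 y) := by
  have hJ := isComplexStructure_std l
  -- The bounds are `|p|² ≤ (4/K²)R` and, for `c = 0`, `|w|² ≤ (1/K)R`. Since `K ≥ 1`, the excess
  -- over `R` is at most `(5/K)R`, and `5/K ≤ b`.
  set K : ℝ := 1 + 5 / b with hKdef
  have hK : 0 < K := by positivity
  have hK1 : 1 ≤ K := by rw [hKdef]; linarith [show 0 < 5 / b by positivity]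
  have hKb : 5 / K ≤ b := by
    rw [div_le_iff₀ hK, hKdef, mul_add, mul_div_cancel₀ _ hb.ne']
    linarith
  have hK4 : 4 / K ^ 2 ≤ 4 / K := by
    refine div_le_div_of_nonneg_left (by norm_num) hK ?_
    nlinarith
  have h54 : 5 / K = 4 / K + 1 / K := by ring
  rcases hc with rfl | rfl
  · have hΦ := isConeIsotopy_coneContraction (V := EuclideanSpace ℝ (Fin m)) hJ le_rfl
      (Or.inr ⟨rfl, hK.le⟩) K
    refine ⟨_, hΦ, fun y hy => ?_⟩
    have h1 := coneContraction_momentum_le hJ le_rfl (Or.inr ⟨rfl, hK.le⟩) hK hy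
    have h2 := coneContraction_norm_sq_le hJ hK hy
    have h3 : 0 < coneSize 0 (coneContraction (stdComplexStructure l) 0 K K 1 y) :=
      hΦ.mapsTo 1 y hy
    generalize coneContraction (stdComplexStructure l) 0 K K 1 y = z at *
    have h4 : ‖z.1‖ ^ 2 = coneSize 0 z := by simp [coneSize]
    rw [h4]
    nlinarith
  · have hΦ := isConeIsotopy_coneContraction (V := EuclideanSpace ℝ (Fin m)) hJ zero_le_one
      (Or.inl rfl) K
    refine ⟨_, hΦ, fun y hy => ?_⟩
    have h1 := coneContraction_momentum_le hJ zero_le_one (Or.inl rfl) hK hy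
    have h3 : 0 < coneSize 1 (coneContraction (stdComplexStructure l) 1 0 K 1 y) :=
      hΦ.mapsTo 1 y hy
    have h5 : 0 < 1 / K := by positivity
    generalize coneContraction (stdComplexStructure l) 1 0 K 1 y = z at *
    have h4 : ‖z.1‖ ^ 2 + ‖z.2.2‖ ^ 2 = coneSize 1 z := by simp [coneSize]
    nlinarith

/-- Contracting embeddings of `S^{2n-1} ∖ Π_k` obtained from a splitting of the coordinates. -/
theorem exists_contractingEmbedding_of_split [NeZero n] (hk : k < 2 * n) {m l : ℕ}
    (e : Fin n ≃ Fin m ⊕ Fin l) {c : ℝ} (hc : c = 0 ∨ c = 1)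
    (hO : ∀ v, v ∈ coordPlane n k ↔
      (splitLinear e v).1 = 0 ∧ (c = 1 → (splitLinear e v).2.2 = 0))
    (hR : ∀ v, (splitLinear e v).2.1 = 0 → (c = 0 → (splitLinear e v).2.2 = 0) →
      v ∈ (coordPlane n k)ᗮ)
    {W : Set (sphereCompl n k)} (hW : IsOpen W)
    (hWE : {x : sphereCompl n k |
      ((x : UnitSphere (2 * n)) : EuclideanSpace ℝ (Fin (2 * n))) ∈ (coordPlane n k)ᗮ} ⊆ W) :
    ∃ σ ∈ contractingEmbeddings (sphereForm n k), Set.range σ ⊆ W := by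
  have hc0 : 0 ≤ c := by rcases hc with rfl | rfl <;> norm_num
  have hc1 : c ≤ 1 := by rcases hc with rfl | rfl <;> norm_num
  have hRO : ∀ v, v ∈ {v | v ∉ coordPlane n k} ↔ 0 < coneSize c (splitLinear e v) := fun v => by
    have h1 := sq_nonneg ‖(splitLinear e v).1‖
    have h2 := sq_nonneg ‖(splitLinear e v).2.2‖
    show v ∉ _ ↔ _
    rw [hO v, ← not_le, not_iff_not, coneSize]
    rcases hc with rfl | rfl
    · simp
    · constructor
      · rintro ⟨h, h'⟩
        rw [h, h' rfl]
        simp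
      · intro h
        have h3 : ‖(splitLinear e v).1‖ ^ 2 = 0 := by linarith
        have h4 : ‖(splitLinear e v).2.2‖ ^ 2 = 0 := by linarith
        exact ⟨by simpa using h3, fun _ => by simpa using h4⟩
  have hOeq : {v | v ∉ coordPlane n k} = splitEquiv e ⁻¹' coneDomain c := Set.ext hRO
  have hnotMem : EuclideanSpace.single (⟨0, by omega⟩ : Fin (2 * n)) (1 : ℝ) ∉ coordPlane n k := by
    intro h
    have := (mem_coordPlane_iff k).1 h ⟨0, by omega⟩ (by simpa using hk)
    simp at this
  rw [sphereForm_eq]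
  refine exists_contractingEmbedding (isConeOver_coordPlane k)
    (R := fun v => coneSize c (splitLinear e v))
    (contDiff_coneSize.continuous.comp (splitEquiv e).continuous)
    (fun a v => by rw [map_smul, coneSize_smul]) hRO (coneSize_le_norm_sq e hc1)
    (fun v => by rw [stdLiouvilleBilin_apply, (isComplexStructure_std n).inner_self, mul_zero])
    ⟨⟨_, by simp⟩, hnotMem⟩ (fun b hb => ?_) hW (subset_trans ?_ hWE)
  · obtain ⟨Φ, hΦ, hbound⟩ := exists_coneIsotopy hc hb
    rw [hOeq]
    refine ⟨_, hΦ.conj (splitEquiv e) (linearLiouville_splitLinear e), fun v hv => ?_⟩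
    have := hbound _ hv
    rw [← norm_sq_splitLinear e, ← splitEquiv_apply e, ContinuousLinearEquiv.apply_symm_apply]
    exact this
  · intro x hx
    have h1 : coneSize c (splitLinear e (sphereIncl (sphereCompl n k) x)) = 1 := hx
    have h2 := norm_sq_splitLinear e (sphereIncl (sphereCompl n k) x)
    rw [norm_sphereIncl, one_pow, ← h1, coneSize] at h2
    have h3 := sq_nonneg ‖(splitLinear e (sphereIncl (sphereCompl n k) x)).2.1‖
    have h4 := sq_nonneg ‖(splitLinear e (sphereIncl (sphereCompl n k) x)).2.2‖
    -- Comparing `|v|² = 1` with `R = 1` leaves `|p|² + (1 - c)|w|² = 0`.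
    refine hR _ ?_ ?_
    · have : ‖(splitLinear e (sphereIncl (sphereCompl n k) x)).2.1‖ ^ 2 = 0 := by nlinarith
      exact norm_eq_zero.1 (pow_eq_zero_iff two_ne_zero |>.1 this)
    · rintro rfl
      have : ‖(splitLinear e (sphereIncl (sphereCompl n k) x)).2.2‖ ^ 2 = 0 := by nlinarith
      exact norm_eq_zero.1 (pow_eq_zero_iff two_ne_zero |>.1 this)

/-- The splitting of the indices after the first `m` ones. -/
def indexSplit {m l : ℕ} (h : n = m + l) : Fin n ≃ Fin m ⊕ Fin l :=
  (finCongr h).trans finSumFinEquiv.symm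

theorem indexSplit_symm_inl {m l : ℕ} (h : n = m + l) (i : Fin m) :
    ((indexSplit h).symm (.inl i) : ℕ) = i := rfl

theorem indexSplit_symm_inr {m l : ℕ} (h : n = m + l) (i : Fin l) :
    ((indexSplit h).symm (.inr i) : ℕ) = m + i := rfl

theorem indexSplit_cases {m l : ℕ} (h : n = m + l) {P : Fin n → Prop}
    (hl : ∀ i, P ((indexSplit h).symm (.inl i))) (hr : ∀ i, P ((indexSplit h).symm (.inr i)))
    (i : Fin n) : P i := by
  rw [← (indexSplit h).symm_apply_apply i]
  rcases indexSplit h i with j | j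
  · exact hl j
  · exact hr j

theorem splitLinear_eq_zero_iff {m l : ℕ} (e : Fin n ≃ Fin m ⊕ Fin l)
    (v : EuclideanSpace ℝ (Fin (2 * n))) : (splitLinear e v).2.2 = 0 ↔
      ∀ i, v (xIdx (e.symm (.inr i))) = 0 ∧ v (yIdx (e.symm (.inr i))) = 0 := by
  constructor
  · intro h i
    rw [← splitLinear_xIdx, ← splitLinear_yIdx, h]
    exact ⟨rfl, rfl⟩
  · intro h
    ext i
    induction i using fin_two_mul_cases with
    | hx i => rw [splitLinear_xIdx, (h i).1]; rfl
    | hy i => rw [splitLinear_yIdx, (h i).2]; rfl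

theorem splitLinear_fst_eq_zero_iff {m l : ℕ} (e : Fin n ≃ Fin m ⊕ Fin l)
    (v : EuclideanSpace ℝ (Fin (2 * n))) : (splitLinear e v).1 = 0 ↔
      ∀ i, v (xIdx (e.symm (.inl i))) = 0 :=
  ⟨fun h i => by rw [← splitLinear_fst, h]; rfl, fun h => by ext i; exact h i⟩

theorem splitLinear_snd_fst_eq_zero_iff {m l : ℕ} (e : Fin n ≃ Fin m ⊕ Fin l)
    (v : EuclideanSpace ℝ (Fin (2 * n))) : (splitLinear e v).2.1 = 0 ↔
      ∀ i, v (yIdx (e.symm (.inl i))) = 0 :=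
  ⟨fun h i => by rw [← splitLinear_snd_fst, h]; rfl, fun h => by ext i; exact h i⟩

/-- For `k ≥ n` the last `k` basis vectors include all `y` directions and the last `k - n` of the
`x` directions. What has to vanish on `Π_k` is therefore `x_i` for the first `2n - k` indices, which
is `q`. -/
theorem mem_coordPlane_iff_split (hnk : n ≤ k) (h : n = (2 * n - k) + (k - n))
    (v : EuclideanSpace ℝ (Fin (2 * n))) :
    v ∈ coordPlane n k ↔ (splitLinear (indexSplit h) v).1 = 0 := by
  rw [mem_coordPlane_iff, splitLinear_fst_eq_zero_iff]
  constructor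
  · intro hv i
    exact hv _ (by have := indexSplit_symm_inl h i; simp only [xIdx]; omega)
  · intro hv i hi
    induction i using fin_two_mul_cases with
    | hx i =>
      induction i using indexSplit_cases h with
      | hl i => exact hv i
      | hr i => have := indexSplit_symm_inr h i; simp only [xIdx] at hi; omega
    | hy i => simp only [yIdx] at hi; omega

/-- For `k ≥ n` the first `2n - k` conjugate pairs form `(q, p)` and `c = 0`. For `k ≤ n` the plane
`Π_k` lies in the `y` directions of the last `k` pairs; these pairs form `(q, p)`, the remaining
ones form `w`, and `c = 1`. -/
theorem exists_contractingEmbedding_sphereCompl [NeZero n] (hk : k < 2 * n)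
    {W : Set (sphereCompl n k)} (hW : IsOpen W)
    (hWE : {x : sphereCompl n k |
      ((x : UnitSphere (2 * n)) : EuclideanSpace ℝ (Fin (2 * n))) ∈ (coordPlane n k)ᗮ} ⊆ W) :
    ∃ σ ∈ contractingEmbeddings (sphereForm n k), Set.range σ ⊆ W := by
  rcases le_total n k with hnk | hnk
  · have h : n = (2 * n - k) + (k - n) := by omega
    refine exists_contractingEmbedding_of_split hk (indexSplit h) (Or.inl rfl) (fun v => ?_)
      (fun v hp hw => ?_) hW hWE
    · rw [mem_coordPlane_iff_split hnk h]
      simp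
    · rw [splitLinear_snd_fst_eq_zero_iff] at hp
      have hw := (splitLinear_eq_zero_iff _ _).1 (hw rfl)
      refine mem_coordPlane_orthogonal k fun i hi => ?_
      induction i using fin_two_mul_cases with
      | hx i =>
        induction i using indexSplit_cases h with
        | hl i => have := indexSplit_symm_inl h i; simp only [xIdx] at hi; omega
        | hr i => exact (hw i).1
      | hy i =>
        induction i using indexSplit_cases h with
        | hl i => exact hp i
        | hr i => exact (hw i).2
  · have h : n = (n - k) + k := by omega
    -- The roles of the blocks are exchanged by `Equiv.sumComm`: the last `k` indices give `(q, p)`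
    -- and the first `n - k` give `w`.
    have hl (i : Fin (n - k)) : (((indexSplit h).trans (Equiv.sumComm _ _)).symm (.inr i) : ℕ) = i :=
      rfl
    have hr (i : Fin k) :
        (((indexSplit h).trans (Equiv.sumComm _ _)).symm (.inl i) : ℕ) = n - k + i := rfl
    refine exists_contractingEmbedding_of_split hk ((indexSplit h).trans (Equiv.sumComm _ _))
      (Or.inr rfl) (fun v => ?_) (fun v hp _ => ?_) hW hWE
    · rw [mem_coordPlane_iff, splitLinear_fst_eq_zero_iff, splitLinear_eq_zero_iff]
      constructor
      · refine fun hv => ⟨fun i => hv _ ?_, fun _ i => ⟨hv _ ?_, hv _ ?_⟩⟩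
        · have := hr i; simp only [xIdx]; omega
        · have := hl i; simp only [xIdx]; omega
        · have := hl i; simp only [yIdx]; omega
      · rintro ⟨hq, hw⟩ i hi
        have hw := hw rfl
        induction i using fin_two_mul_cases with
        | hx i =>
          induction i using indexSplit_cases h with
          | hl i => exact (hw i).1
          | hr i => exact hq i
        | hy i =>
          induction i using indexSplit_cases h with
          | hl i => exact (hw i).2
          | hr i => have := indexSplit_symm_inr h i; simp only [yIdx] at hi; omega
    · rw [splitLinear_snd_fst_eq_zero_iff] at hp
      refine mem_coordPlane_orthogonal k fun i hi => ?_
      induction i using fin_two_mul_cases with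
      | hx i => have := i.2; simp only [xIdx] at hi; omega
      | hy i =>
        induction i using indexSplit_cases h with
        | hl i => have := indexSplit_symm_inl h i; simp only [yIdx] at hi; omega
        | hr i => exact hp i

/-- The sphere is connected because `2n > 1`. A compact complement would be clopen and nonempty,
hence everything, yet the last basis vector lies in `Π_k` as `k ≥ 1`. -/
theorem noncompactSpace_sphereCompl (hk₁ : 1 ≤ k) (hk₂ : k < 2 * n) :
    NoncompactSpace (sphereCompl n k) := by
  rw [← not_compactSpace_iff]
  intro hcompact
  have hconn : IsPreconnected (Metric.sphere (0 : EuclideanSpace ℝ (Fin (2 * n))) 1) := by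
    refine isPreconnected_sphere ?_ 0 1
    rw [← Module.finrank_eq_rank, finrank_euclideanSpace_fin]
    exact_mod_cast (by omega : 1 < 2 * n)
  have : PreconnectedSpace (UnitSphere (2 * n)) := isPreconnected_iff_preconnectedSpace.1 hconn
  have hne : ((sphereCompl n k : Set (UnitSphere (2 * n)))).Nonempty := by
    refine ⟨⟨EuclideanSpace.single ⟨0, by omega⟩ 1, by simp⟩, fun h => ?_⟩
    have := (mem_coordPlane_iff k).1 h ⟨0, by omega⟩ (by simpa using hk₂)
    simp at this
  have huniv := IsClopen.eq_univ
    ⟨(isCompact_iff_compactSpace.2 hcompact).isClosed, (sphereCompl n k).isOpen⟩ hne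
  have hlast : (⟨EuclideanSpace.single ⟨2 * n - 1, by omega⟩ 1, by simp⟩ : UnitSphere (2 * n)) ∈
      (sphereCompl n k : Set (UnitSphere (2 * n))) := huniv ▸ Set.mem_univ _
  exact hlast (Submodule.subset_span ⟨_, by show 2 * n ≤ 2 * n - 1 + k; omega, rfl⟩)

theorem convexAtInfinity_sphereForm [NeZero n] (hk₁ : 1 ≤ k) (hk₂ : k < 2 * n) :
    ConvexAtInfinity (sphereForm n k) where
  isContactForm := by
    rw [sphereForm_eq]
    exact isContactForm_inducedForm (isConeOver_coordPlane k) (isComplexStructure_std n)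
      (stdLiouvilleBilin_apply n)
  noncompact := noncompactSpace_sphereCompl hk₁ hk₂
  nonempty := by
    obtain ⟨σ, hσ, -⟩ := exists_contractingEmbedding_sphereCompl hk₂ isOpen_univ
      (Set.subset_univ _)
    exact ⟨σ, hσ⟩

end SphereCompl

/-! ### Covectors on retracts -/

section Covectors

open Bundle

variable {E : Type*} [NormedAddCommGroup E] [NormedSpace ℝ E]
  {F : Type*} [NormedAddCommGroup F] [NormedSpace ℝ F]
  {H : Type*} [TopologicalSpace H] {I : ModelWithCorners ℝ F H}
  {M : Type*} [TopologicalSpace M] [ChartedSpace H M] [IsManifold I ∞ M] [IsManifold I 1 M]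
  {A : Type*} [NormedAddCommGroup A] [NormedSpace ℝ A]
  {G : Type*} [TopologicalSpace G] {J : ModelWithCorners ℝ A G}
  {X : Type*} [TopologicalSpace X] [ChartedSpace G X]
  {ι : M → E} {r : E → M} {O : Set E}

variable (I) in
/-- The covector at `x` with values given by `P`. -/
def mkCovector (x : M) (P : F →L[ℝ] ℝ) : Cotangent I M := ⟨x, P⟩

/-- The value of a covector, as a plain linear map. -/
def covectorVal (η : Cotangent I M) : F →L[ℝ] ℝ := η.snd

/-- In the target trivial line bundle the coordinate change is the identity, so only the
trivialization of the tangent bundle remains. -/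
theorem contMDiffAt_mkCovector_iff {f : X → M} {P : X → F →L[ℝ] ℝ} {x₀ : X} :
    ContMDiffAt J (cotangentModel I) ∞ (fun x => mkCovector I (f x) (P x)) x₀ ↔
      ContMDiffAt J I ∞ f x₀ ∧ ContMDiffAt J 𝓘(ℝ, F →L[ℝ] ℝ) ∞
        (fun x => (P x).comp ((trivializationAt F (TangentSpace I) (f x₀)).symmL ℝ (f x))) x₀ := by
  rw [contMDiffAt_hom_bundle]
  have : ∀ x y : M, (trivializationAt ℝ (fun _ : M => ℝ) y).continuousLinearMapAt ℝ x =
      ContinuousLinearMap.id ℝ ℝ := fun x y =>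
    Trivial.continuousLinearMapAt_trivialization ℝ M ℝ x
  refine and_congr Iff.rfl ?_
  simp only [ContinuousLinearMap.inCoordinates, this]
  exact Iff.rfl

/-- Covectors restricted from the ambient space depend smoothly on the ambient functional. This is
how maps into `T^*M` are shown to be smooth. -/
theorem IsSmoothRetraction.contMDiffAt_mkCovector (h : IsSmoothRetraction I ι r O) {f : X → M}
    {P : X → E →L[ℝ] ℝ} {x₀ : X} (hf : ContMDiffAt J I ∞ f x₀)
    (hP : ContMDiffAt J 𝓘(ℝ, E →L[ℝ] ℝ) ∞ P x₀) :
    ContMDiffAt J (cotangentModel I) ∞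
      (fun x => mkCovector I (f x) ((P x).comp (vectorDeriv I ι (f x)))) x₀ := by
  rw [contMDiffAt_mkCovector_iff]
  refine ⟨hf, ?_⟩
  have h1 := (h.contMDiff (f x₀)).mfderiv_const (m := ∞) (by simp)
  have h2 := hP.clm_comp (h1.comp x₀ hf)
  refine h2.congr_of_eventuallyEq (Filter.Eventually.of_forall fun x => ?_)
  simp only [inTangentCoordinates, ContinuousLinearMap.inCoordinates, Function.comp_apply,
    TangentBundle.continuousLinearMapAt_model_space]
  rfl

/-- The opposite direction: the derivative of the retraction extends a covector to the ambient
space, and the extension varies smoothly. This yields smooth vector-valued maps on `T^*M`. -/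
theorem IsSmoothRetraction.contMDiff_covectorVal_comp (h : IsSmoothRetraction I ι r O) :
    ContMDiff (cotangentModel I) 𝓘(ℝ, E →L[ℝ] ℝ) ∞
      (fun η : Cotangent I M => (covectorVal η).comp (retractDeriv I r (ι η.proj))) := by
  intro η₀
  have h1 : ContMDiffAt (cotangentModel I) (cotangentModel I) ∞
    (fun η : Cotangent I M => mkCovector I η.proj (covectorVal η)) η₀ := contMDiffAt_id
  rw [contMDiffAt_mkCovector_iff] at h1
  have h2 : ContMDiffAt (cotangentModel I) 𝓘(ℝ, E) ∞ (fun η : Cotangent I M => ι η.proj) η₀ :=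
    (h.contMDiff _).comp η₀ h1.1
  have h3 := ContMDiffAt.mfderiv (m := ∞) (n := ∞) (x₀ := η₀) (fun _ : Cotangent I M => r)
    (fun η => ι η.proj) ((h.contMDiffAt _ (h.mem η₀.proj)).comp (η₀, ι η₀.proj) contMDiffAt_snd)
    h2 (by simp)
  refine (h1.2.clm_comp h3).congr_of_eventuallyEq ?_
  have h4 := h1.1.continuousAt.preimage_mem_nhds
    ((trivializationAt F (TangentSpace I) η₀.proj).open_baseSet.mem_nhds
      (FiberBundle.mem_baseSet_trivializationAt' η₀.proj))
  filter_upwards [h4] with η hη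
  ext v
  simp only [inTangentCoordinates, ContinuousLinearMap.inCoordinates,
    TangentBundle.symmL_model_space, ContinuousLinearMap.comp_apply, h.leftInverse]
  have h5 := (trivializationAt F (TangentSpace I) η₀.proj).symmL_continuousLinearMapAt (R := ℝ) hη
    (retractDeriv I r (ι η.proj) v)
  -- The points `r (ι η.proj)` and `η.proj` are equal but not by definition, so the trivialization
  -- is transported along that equality.
  have h6 : ∀ x y : M, x = y → ∀ u : F,
      (trivializationAt F (TangentSpace I) η₀.proj).continuousLinearMapAt ℝ x u =
        (trivializationAt F (TangentSpace I) η₀.proj).continuousLinearMapAt ℝ y u := by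
    rintro x _ rfl u
    rfl
  rw [← h6 _ _ (h.leftInverse η.proj)] at h5
  exact (congrArg (covectorVal η) h5).symm

theorem contMDiff_cotangent_proj :
    ContMDiff (cotangentModel I) I ∞ (fun η : Cotangent I M => η.proj) :=
  contMDiff_proj _

/-- The canonical Liouville form pulled back by a map to the cotangent bundle. -/
theorem canonicalLiouville_mfderiv (h : IsSmoothRetraction I ι r O) {f : X → M}
    {P : X → E →L[ℝ] ℝ} {x : X} (hf : ContMDiffAt J I ∞ f x)
    (hP : ContMDiffAt J 𝓘(ℝ, E →L[ℝ] ℝ) ∞ P x) (v : A) :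
    OneForm.pullback (I := J)
      (fun x => mkCovector I (f x) ((P x).comp (vectorDeriv I ι (f x))))
      (canonicalLiouville I M) x v = P x (vectorDeriv J (fun y => ι (f y)) x v) := by
  have h1 := (h.contMDiffAt_mkCovector hf hP).mdifferentiableAt (by simp)
  have h2 := mfderiv_comp x
    ((contMDiff_cotangent_proj (I := I) (M := M) _).mdifferentiableAt (by simp)) h1
  have h3 := mfderiv_comp x (h.mdifferentiableAt (f x)) (hf.mdifferentiableAt (by simp))
  have h4 : vectorDeriv J (fun y => ι (f y)) x v =
    vectorDeriv I ι (f x) ((mfderiv J I f x : A →L[ℝ] F) v) := DFunLike.congr_fun h3 v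
  rw [h4]
  exact congrArg (fun u : F => P x (vectorDeriv I ι (f x) u)) (DFunLike.congr_fun h2 v).symm

end Covectors

/-! ### The unit sphere as a retract -/

theorem IsSmoothRetraction.vectorDeriv_eq_zero {E F H M : Type*} [NormedAddCommGroup E]
    [NormedSpace ℝ E] [NormedAddCommGroup F] [NormedSpace ℝ F] [TopologicalSpace H]
    {I : ModelWithCorners ℝ F H} [TopologicalSpace M] [ChartedSpace H M] {ι : M → E} {r : E → M}
    {O : Set E} (h : IsSmoothRetraction I ι r O) (x : M) {u : E}
    (hu : fderiv ℝ (fun w => ι (r w)) (ι x) u = 0) : retractDeriv I r (ι x) u = 0 := by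
  rw [← h.vectorDeriv_retractDeriv (h.mem x)] at hu
  have := h.retractDeriv_vectorDeriv (r (ι x)) (retractDeriv I r (ι x) u)
  rw [hu, map_zero] at this
  exact this.symm

theorem IsSmoothRetraction.fderiv_vectorDeriv {E F H M : Type*} [NormedAddCommGroup E]
    [NormedSpace ℝ E] [NormedAddCommGroup F] [NormedSpace ℝ F] [TopologicalSpace H]
    {I : ModelWithCorners ℝ F H} [TopologicalSpace M] [ChartedSpace H M] {ι : M → E} {r : E → M}
    {O : Set E} (h : IsSmoothRetraction I ι r O) (x : M) (v : F) :
    fderiv ℝ (fun w => ι (r w)) (ι x) (vectorDeriv I ι x v) = vectorDeriv I ι x v := by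
  rw [← h.vectorDeriv_retractDeriv (h.mem x), h.retractDeriv_vectorDeriv, h.leftInverse]

section UnitSphere

variable {V : Type*} [NormedAddCommGroup V] [InnerProductSpace ℝ V] {m : ℕ}
  [Fact (Module.finrank ℝ V = m + 1)]

theorem fderiv_normalize_unit {v : V} (hv : ‖v‖ = 1) (h : V) :
    fderiv ℝ (fun w : V => ‖w‖⁻¹ • w) v h = h - inner ℝ v h • v := by
  have h0 : v ≠ 0 := by rintro rfl; simp at hv
  have hd := (contDiffAt_normalize h0).differentiableAt (by simp)
  have h1 : fderiv ℝ (fun w : V => ‖w‖⁻¹ • w) v v = 0 := by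
    refine (hd.hasDerivAt_line v).unique ((hasDerivAt_const (0 : ℝ) v).congr_of_eventuallyEq ?_)
    filter_upwards [lt_mem_nhds (show (-1 : ℝ) < 0 by norm_num)] with s hs
    have h2 : v + s • v = (1 + s) • v := by module
    have h3 : 0 < 1 + s := by linarith
    rw [h2, norm_smul, hv, mul_one, Real.norm_eq_abs, abs_of_pos h3, smul_smul,
      inv_mul_cancel₀ h3.ne', one_smul]
  have h2 : inner ℝ v (h - inner ℝ v h • v) = 0 := by
    rw [inner_sub_right, inner_smul_right, real_inner_self_eq_norm_sq, hv]
    ring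
  have h3 := fderiv_normalize hv h2
  rwa [map_sub, map_smul, h1, smul_zero, sub_zero] at h3

/-- The radial projection to the unit sphere (with a dummy value at the origin). -/
def sphereRetract (x₀ : Metric.sphere (0 : V) 1) (v : V) : Metric.sphere (0 : V) 1 :=
  radial ⊤ ⟨x₀, trivial⟩ v

theorem isConeOver_top :
    IsConeOver (⊤ : TopologicalSpace.Opens (Metric.sphere (0 : V) 1)) {v | v ≠ 0} where
  isOpen := isOpen_ne
  zero_notMem h := h rfl
  smul_mem _ ha _ hv := smul_ne_zero ha.ne' hv
  mem_iff x := iff_of_true trivial (ne_zero_of_mem_unit_sphere x)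

theorem coe_sphereRetract (x₀ : Metric.sphere (0 : V) 1) {v : V} (hv : v ≠ 0) :
    (sphereRetract x₀ v : V) = ‖v‖⁻¹ • v :=
  sphereIncl_radial isConeOver_top _ hv

theorem coe_sphereRetract_of_norm (x₀ : Metric.sphere (0 : V) 1) {v : V} (hv : ‖v‖ = 1) :
    (sphereRetract x₀ v : V) = v := by
  rw [coe_sphereRetract x₀ (by rintro rfl; simp at hv), hv, inv_one, one_smul]

theorem isSmoothRetraction_sphereRetract (x₀ : Metric.sphere (0 : V) 1) :
    IsSmoothRetraction (𝓡 m) ((↑) : Metric.sphere (0 : V) 1 → V) (sphereRetract x₀)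
      {v | v ≠ 0} where
  contMDiff := contMDiff_coe_sphere
  isOpen := isOpen_ne
  contMDiffAt v hv := by
    apply contMDiffAt_sphere
    refine (contDiffAt_normalize hv).contMDiffAt.congr_of_eventuallyEq ?_
    filter_upwards [isOpen_ne.mem_nhds hv] with w hw
    exact coe_sphereRetract x₀ hw
  mem := ne_zero_of_mem_unit_sphere
  leftInverse x := Subtype.ext (coe_sphereRetract_of_norm x₀ (norm_eq_of_mem_sphere x))

theorem fderiv_sphereRetract (x₀ : Metric.sphere (0 : V) 1) {v : V} (hv : ‖v‖ = 1) (h : V) :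
    fderiv ℝ (fun w => (sphereRetract x₀ w : V)) v h = h - inner ℝ v h • v := by
  have h0 : v ≠ 0 := by rintro rfl; simp at hv
  have h1 : (fun w => (sphereRetract x₀ w : V)) =ᶠ[nhds v] fun w => ‖w‖⁻¹ • w := by
    filter_upwards [isOpen_ne.mem_nhds h0] with w hw
    exact coe_sphereRetract x₀ hw
  rw [h1.fderiv_eq, fderiv_normalize_unit hv]

end UnitSphere

theorem IsSmoothRetraction.prod_id {E F H M : Type*} [NormedAddCommGroup E]
    [NormedSpace ℝ E] [NormedAddCommGroup F] [NormedSpace ℝ F] [TopologicalSpace H]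
    {I : ModelWithCorners ℝ F H} [TopologicalSpace M] [ChartedSpace H M] {ι : M → E} {r : E → M}
    {O : Set E} (h : IsSmoothRetraction I ι r O) (L : Type*) [NormedAddCommGroup L]
    [NormedSpace ℝ L] :
    IsSmoothRetraction (I.prod 𝓘(ℝ, L)) (fun x : M × L => (ι x.1, x.2))
      (fun v : E × L => (r v.1, v.2)) (O ×ˢ Set.univ) where
  contMDiff := (h.contMDiff.comp contMDiff_fst).prodMk_space contMDiff_snd
  isOpen := h.isOpen.prod isOpen_univ
  contMDiffAt v hv :=
    (ContMDiffAt.comp v (g := r) (h.contMDiffAt _ hv.1) contDiff_fst.contMDiff.contMDiffAt).prodMk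
      contDiff_snd.contMDiff.contMDiffAt
  mem x := ⟨h.mem x.1, trivial⟩
  leftInverse x := Prod.ext (h.leftInverse x.1) rfl

theorem IsSmoothRetraction.fderiv_prod_id {E F H M : Type*} [NormedAddCommGroup E]
    [NormedSpace ℝ E] [NormedAddCommGroup F] [NormedSpace ℝ F] [TopologicalSpace H]
    {I : ModelWithCorners ℝ F H} [TopologicalSpace M] [ChartedSpace H M] {ι : M → E} {r : E → M}
    {O : Set E} (h : IsSmoothRetraction I ι r O) {L : Type*} [NormedAddCommGroup L]
    [NormedSpace ℝ L] {v : E × L} (hv : v.1 ∈ O) (u : E × L) :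
    fderiv ℝ (fun w : E × L => (ι (r w.1), w.2)) v u
      = (fderiv ℝ (fun w => ι (r w)) v.1 u.1, u.2) := by
  have h1 : DifferentiableAt ℝ (fun w => ι (r w)) v.1 :=
    (ContMDiffAt.comp v.1 (h.contMDiff _) (h.contMDiffAt _ hv)).contDiffAt.differentiableAt
      (n := ∞) (by simp)
  have h2 := (h1.hasFDerivAt.comp v hasFDerivAt_fst).prodMk
    (hasFDerivAt_snd (𝕜 := ℝ) (E := E) (F := L) (p := v))
  exact DFunLike.congr_fun h2.fderiv u

/-! ### The slice `|q| = 1` -/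

theorem OneForm.pullback_pullback_apply {A B C G₁ G₂ G₃ X Y Z : Type*} [NormedAddCommGroup A]
    [NormedSpace ℝ A] [NormedAddCommGroup B] [NormedSpace ℝ B] [NormedAddCommGroup C]
    [NormedSpace ℝ C] [TopologicalSpace G₁] [TopologicalSpace G₂] [TopologicalSpace G₃]
    {I₁ : ModelWithCorners ℝ A G₁} {I₂ : ModelWithCorners ℝ B G₂} {I₃ : ModelWithCorners ℝ C G₃}
    [TopologicalSpace X] [ChartedSpace G₁ X] [TopologicalSpace Y] [ChartedSpace G₂ Y]
    [TopologicalSpace Z] [ChartedSpace G₃ Z] {f : X → Y} {g : Y → Z} (β : OneForm I₃ Z) {x : X}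
    (hg : MDifferentiableAt I₂ I₃ g (f x)) (hf : MDifferentiableAt I₁ I₂ f x) (v : A) :
    OneForm.pullback (I := I₁) f (OneForm.pullback (I := I₂) g β) x v
      = OneForm.pullback (I := I₁) (fun y => g (f y)) β x v := by
  have h := mfderiv_comp x hg hf
  exact congrArg (fun u : C => β (g (f x)) u) (DFunLike.congr_fun h v).symm

/-- The model space with coordinates `(q, p, w)`. -/
abbrev SplitSpace (m l : ℕ) : Type :=
  EuclideanSpace ℝ (Fin m) × EuclideanSpace ℝ (Fin m) × EuclideanSpace ℝ (Fin (2 * l))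

section Slice

variable {n k m l : ℕ} (e : Fin n ≃ Fin m ⊕ Fin l)

/-- The coordinates `(q, p, w) / |q|`. -/
def sliceCoord (x : sphereCompl n k) : SplitSpace m l :=
  ‖(splitEquiv e (sphereIncl _ x)).1‖⁻¹ • splitEquiv e (sphereIncl _ x)

variable (hO : ∀ v, v ∈ coordPlane n k ↔ (splitLinear e v).1 = 0)
include hO

theorem splitEquiv_fst_ne_zero [NeZero n] (x : sphereCompl n k) :
    (splitEquiv e (sphereIncl _ x)).1 ≠ 0 := fun h =>
  sphereIncl_mem (isConeOver_coordPlane k) x ((hO _).2 h)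

theorem norm_sliceCoord [NeZero n] (x : sphereCompl n k) : ‖(sliceCoord e x).1‖ = 1 := by
  have := norm_pos_iff.2 (splitEquiv_fst_ne_zero e hO x)
  rw [sliceCoord, Prod.smul_fst, norm_smul, norm_inv, norm_norm, inv_mul_cancel₀ this.ne']

theorem contDiffAt_slice {v : EuclideanSpace ℝ (Fin (2 * n))} (hv : (splitEquiv e v).1 ≠ 0) :
    ContDiffAt ℝ ∞ (fun v => ‖(splitEquiv e v).1‖⁻¹) v :=
  ContDiffAt.comp v (g := fun u : EuclideanSpace ℝ (Fin m) => ‖u‖⁻¹)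
    ((contDiffAt_norm ℝ hv).inv (norm_ne_zero_iff.2 hv))
    (contDiff_fst.comp (splitEquiv e).contDiff).contDiffAt

theorem contMDiff_sliceCoord [NeZero n] :
    ContMDiff (𝓡 (2 * n - 1)) 𝓘(ℝ, SplitSpace m l) ∞ (sliceCoord (k := k) e) := fun x =>
  ContMDiffAt.comp x
    (g := fun v : EuclideanSpace ℝ (Fin (2 * n)) => ‖(splitEquiv e v).1‖⁻¹ • splitEquiv e v)
    ((contDiffAt_slice e hO (splitEquiv_fst_ne_zero e hO x)).smul
      (splitEquiv e).contDiff.contDiffAt).contMDiffAt (contMDiff_sphereIncl x)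

/-- The Liouville form in the slice coordinates. -/
theorem linearLiouville_sliceCoord [NeZero n] (x : sphereCompl n k)
    (v : EuclideanSpace ℝ (Fin (2 * n - 1))) :
    linearLiouville (stdComplexStructure l) (sliceCoord e x)
        (vectorDeriv (𝓡 (2 * n - 1)) (sliceCoord e) x v)
      = (‖(splitEquiv e (sphereIncl _ x)).1‖⁻¹) ^ 2 * sphereForm n k x v := by
  have h0 := splitEquiv_fst_ne_zero e hO x
  have h1 := (contDiffAt_slice e hO h0).differentiableAt (by simp)
  have h2 := (h1.hasFDerivAt.smul (splitEquiv e).hasFDerivAt)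
  have h3 := (isSmoothRetraction_radial (m := 2 * n - 1) (isConeOver_coordPlane k) x).vectorDeriv_comp
    x h2.differentiableAt
  rw [h2.fderiv] at h3
  have h4 : vectorDeriv (𝓡 (2 * n - 1)) (sliceCoord e) x v = _ := DFunLike.congr_fun h3 v
  rw [h4, sphereForm_eq, inducedForm_apply]
  set h := vectorDeriv (𝓡 (2 * n - 1)) (sphereIncl (sphereCompl n k)) x v
  set y := sphereIncl (sphereCompl n k) x
  set b := fderiv ℝ (fun v => ‖(splitEquiv e v).1‖⁻¹) y h with hb
  -- The derivative of `|q|⁻¹ v` is `|q|⁻¹ h` plus a multiple of `v`; the form kills the latter.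
  show linearLiouville _ (‖(splitEquiv e y).1‖⁻¹ • splitEquiv e y)
    (‖(splitEquiv e y).1‖⁻¹ • splitEquiv e h + b • splitEquiv e y) = _
  rw [← linearLiouville_splitLinear e, ← splitEquiv_apply, ← splitEquiv_apply]
  generalize splitEquiv e y = y
  generalize splitEquiv e h = h
  simp only [linearLiouville, Prod.smul_fst, Prod.smul_snd, Prod.fst_add, Prod.snd_add,
    inner_add_right, inner_smul_left, inner_smul_right, map_smul, conj_trivial,
    (isComplexStructure_std l).inner_self, real_inner_comm y.1 y.2.1]
  ring

omit hO in
/-- The point of the sphere with given slice coordinates. -/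
def ofSliceCoord (x₀ : sphereCompl n k) (u : SplitSpace m l) : sphereCompl n k :=
  radial (sphereCompl n k) x₀ ((splitEquiv e).symm u)

theorem mem_of_fst_ne_zero {u : SplitSpace m l} (hu : u.1 ≠ 0) :
    (splitEquiv e).symm u ∈ {v | v ∉ coordPlane n k} := fun h => by
  have := (hO _).1 h
  rw [← splitEquiv_apply, ContinuousLinearEquiv.apply_symm_apply] at this
  exact hu this

theorem contMDiffAt_ofSliceCoord [NeZero n] (x₀ : sphereCompl n k) {u : SplitSpace m l}
    (hu : u.1 ≠ 0) :
    ContMDiffAt 𝓘(ℝ, SplitSpace m l) (𝓡 (2 * n - 1)) ∞ (ofSliceCoord e x₀) u :=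
  ContMDiffAt.comp u (g := radial (sphereCompl n k) x₀)
    ((isSmoothRetraction_radial (isConeOver_coordPlane k) x₀).contMDiffAt _
      (mem_of_fst_ne_zero e hO hu)) (splitEquiv e).symm.contDiff.contMDiff.contMDiffAt

theorem ofSliceCoord_sliceCoord [NeZero n] (x₀ x : sphereCompl n k) :
    ofSliceCoord e x₀ (sliceCoord e x) = x := by
  have h0 := norm_pos_iff.2 (splitEquiv_fst_ne_zero e hO x)
  apply sphereIncl_injective
  rw [ofSliceCoord, sphereIncl_radial (isConeOver_coordPlane k)]
  · rw [sliceCoord, (splitEquiv e).symm.map_smul, ContinuousLinearEquiv.symm_apply_apply,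
      norm_smul, norm_sphereIncl, norm_inv, norm_norm, mul_one, inv_inv, smul_smul,
      mul_inv_cancel₀ h0.ne', one_smul]
  · refine mem_of_fst_ne_zero e hO fun h => ?_
    have := norm_sliceCoord e hO x
    rw [h, norm_zero] at this
    exact zero_ne_one this

theorem sliceCoord_ofSliceCoord [NeZero n] (x₀ : sphereCompl n k) {u : SplitSpace m l}
    (hu : ‖u.1‖ = 1) : sliceCoord e (ofSliceCoord e x₀ u) = u := by
  have hu0 : u.1 ≠ 0 := norm_pos_iff.1 (hu ▸ one_pos)
  have hm := mem_of_fst_ne_zero e hO hu0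
  have h0 : (splitEquiv e).symm u ≠ 0 := fun h => hm (h ▸ Submodule.zero_mem _)
  have h1 := norm_pos_iff.2 h0
  rw [sliceCoord, ofSliceCoord, sphereIncl_radial (isConeOver_coordPlane k) x₀ hm,
    (splitEquiv e).map_smul, ContinuousLinearEquiv.apply_symm_apply, Prod.smul_fst, norm_smul, hu,
    norm_inv, norm_norm, mul_one, inv_inv, smul_smul, mul_inv_cancel₀ h1.ne', one_smul]

/-- A criterion for contactomorphy with `S^{2n-1} ∖ Π_k` in the slice coordinates. -/
theorem contactomorphic_of_slice [NeZero n] {A G N : Type*} [NormedAddCommGroup A]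
    [NormedSpace ℝ A] [TopologicalSpace G] {J : ModelWithCorners ℝ A G} [TopologicalSpace N]
    [ChartedSpace G N] {β : OneForm J N} (x₀ : sphereCompl n k) {f : SplitSpace m l → N}
    {g : N → SplitSpace m l}
    (hf : ∀ u : SplitSpace m l, ‖u.1‖ = 1 → ContMDiffAt 𝓘(ℝ, SplitSpace m l) J ∞ f u)
    (hg : ContMDiff J 𝓘(ℝ, SplitSpace m l) ∞ g) (hg₁ : ∀ b, ‖(g b).1‖ = 1)
    (hfg : ∀ b, f (g b) = b) (hgf : ∀ u : SplitSpace m l, ‖u.1‖ = 1 → g (f u) = u)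
    (hβ : ∀ γ : sphereCompl n k → SplitSpace m l,
      ContMDiff (𝓡 (2 * n - 1)) 𝓘(ℝ, SplitSpace m l) ∞ γ → (∀ x, ‖(γ x).1‖ = 1) →
      ∀ x v, OneForm.pullback (I := 𝓡 (2 * n - 1)) (fun x => f (γ x)) β x v =
        linearLiouville (stdComplexStructure l) (γ x) (vectorDeriv (𝓡 (2 * n - 1)) γ x v)) :
    Contactomorphic (sphereForm n k) β := by
  refine ⟨⟨⟨fun x => f (sliceCoord e x), fun b => ofSliceCoord e x₀ (g b), fun x => ?_,
    fun b => ?_⟩, fun x => ?_, fun b => ?_⟩, fun x => ?_⟩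
  · beta_reduce
    rw [hgf _ (norm_sliceCoord e hO x), ofSliceCoord_sliceCoord e hO]
  · beta_reduce
    rw [sliceCoord_ofSliceCoord e hO x₀ (hg₁ b), hfg]
  · exact (hf _ (norm_sliceCoord e hO x)).comp x (contMDiff_sliceCoord e hO x)
  · exact ContMDiffAt.comp b (g := ofSliceCoord e x₀)
      (contMDiffAt_ofSliceCoord e hO x₀ (norm_pos_iff.1 ((hg₁ b) ▸ one_pos))) (hg b)
  · have h0 := norm_pos_iff.2 (splitEquiv_fst_ne_zero e hO x)
    refine ⟨(‖(splitEquiv e (sphereIncl _ x)).1‖⁻¹) ^ 2, by positivity, ?_⟩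
    ext v
    exact (hβ _ (contMDiff_sliceCoord e hO) (norm_sliceCoord e hO) x v).trans
      (linearLiouville_sliceCoord e hO x v)

end Slice

/-! ### Maps to jet spaces -/

section JetMaps

variable {E : Type*} [NormedAddCommGroup E] [NormedSpace ℝ E]
  {F : Type*} [NormedAddCommGroup F] [NormedSpace ℝ F]
  {H : Type*} [TopologicalSpace H] {I : ModelWithCorners ℝ F H}
  {M : Type*} [TopologicalSpace M] [ChartedSpace H M] [IsManifold I ∞ M] [IsManifold I 1 M]
  {A : Type*} [NormedAddCommGroup A] [NormedSpace ℝ A]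
  {G : Type*} [TopologicalSpace G] {J : ModelWithCorners ℝ A G}
  {X : Type*} [TopologicalSpace X] [ChartedSpace G X]
  {ι : M → E} {r : E → M} {O : Set E}

theorem mkCovector_eq {x : M} {P : F →L[ℝ] ℝ} {η : Cotangent I M} (hx : x = η.proj)
    (hP : P = covectorVal η) : mkCovector I x P = η := by
  subst hx hP
  rfl

theorem jet1Form_pullback (h : IsSmoothRetraction I ι r O) {f : X → M} {P : X → E →L[ℝ] ℝ}
    {z : X → ℝ} {x : X} (hf : ContMDiffAt J I ∞ f x) (hP : ContMDiffAt J 𝓘(ℝ, E →L[ℝ] ℝ) ∞ P x)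
    (hz : ContMDiffAt J 𝓘(ℝ, ℝ) ∞ z x) (v : A) :
    OneForm.pullback (I := J)
      (fun x => ((mkCovector I (f x) ((P x).comp (vectorDeriv I ι (f x))), z x) : Jet1 I M))
      (jet1Form I M) x v = vectorDeriv J z x v + P x (vectorDeriv J (fun y => ι (f y)) x v) := by
  have h1 := h.contMDiffAt_mkCovector hf hP
  have h2 := (h1.prodMk hz).mdifferentiableAt (by simp)
  rw [← canonicalLiouville_mfderiv h hf hP v]
  have h3 := OneForm.pullback_pullback_apply (I₁ := J) (I₂ := jet1Model I) (I₃ := 𝓘(ℝ, ℝ))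
    (f := fun x => ((mkCovector I (f x) ((P x).comp (vectorDeriv I ι (f x))), z x) : Jet1 I M))
    (g := fun b : Jet1 I M => b.2) (fun _ => ContinuousLinearMap.id ℝ ℝ)
    mdifferentiableAt_snd h2 v
  have h4 := OneForm.pullback_pullback_apply (I₁ := J) (I₂ := jet1Model I) (I₃ := cotangentModel I)
    (f := fun x => ((mkCovector I (f x) ((P x).comp (vectorDeriv I ι (f x))), z x) : Jet1 I M))
    (g := fun b : Jet1 I M => b.1) (canonicalLiouville I M) mdifferentiableAt_fst h2 v
  exact congrArg₂ (· + ·) h3 h4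

theorem vectorDeriv_comp_apply {B : Type*} [NormedAddCommGroup B] [NormedSpace ℝ B] {φ : E → B}
    {γ : X → E} {x : X} (hφ : DifferentiableAt ℝ φ (γ x)) (hγ : MDifferentiableAt J 𝓘(ℝ, E) γ x)
    (v : A) : vectorDeriv J (fun y => φ (γ y)) x v = fderiv ℝ φ (γ x) (vectorDeriv J γ x v) := by
  have h := mfderiv_comp x hφ.mdifferentiableAt hγ
  rw [mfderiv_eq_fderiv] at h
  exact DFunLike.congr_fun h v

theorem vectorDeriv_clm_comp_apply {B : Type*} [NormedAddCommGroup B] [NormedSpace ℝ B]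
    (φ : E →L[ℝ] B) {γ : X → E} {x : X} (hγ : MDifferentiableAt J 𝓘(ℝ, E) γ x) (v : A) :
    vectorDeriv J (fun y => φ (γ y)) x v = φ (vectorDeriv J γ x v) := by
  rw [vectorDeriv_comp_apply φ.differentiableAt hγ, φ.fderiv]

theorem fderiv_inner_fst_snd {V B : Type*} [NormedAddCommGroup V] [InnerProductSpace ℝ V]
    [NormedAddCommGroup B] [NormedSpace ℝ B] (u h : V × V × B) :
    DifferentiableAt ℝ (fun u : V × V × B => inner ℝ u.1 u.2.1) u ∧
    fderiv ℝ (fun u : V × V × B => inner ℝ u.1 u.2.1) u h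
      = inner ℝ u.1 h.2.1 + inner ℝ h.1 u.2.1 := by
  have h1 := (hasFDerivAt_fst (𝕜 := ℝ) (E := V) (F := V × B) (p := u)).inner ℝ
    ((hasFDerivAt_fst (𝕜 := ℝ) (E := V) (F := B) (p := u.2)).comp u hasFDerivAt_snd)
  exact ⟨h1.differentiableAt, DFunLike.congr_fun h1.fderiv h⟩

end JetMaps

/-! ### The slice as `J^1(S^{m-1}) × ℝ^{2l}` -/

section JetTimes

variable {m l : ℕ} [NeZero m]

/-- The map from the slice to `J^1(S^{m-1}) × ℝ^{2l}`. -/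
def sliceToJetTimes (x₀ : UnitSphere m) (u : SplitSpace m l) :
    Jet1 (𝓡 (m - 1)) (UnitSphere m) × EuclideanSpace ℝ (Fin (2 * l)) :=
  ((mkCovector (𝓡 (m - 1)) (sphereRetract x₀ u.1) ((-innerSL ℝ u.2.1).comp
    (vectorDeriv (𝓡 (m - 1)) ((↑) : UnitSphere m → EuclideanSpace ℝ (Fin m))
      (sphereRetract x₀ u.1))), 1 / 2 * inner ℝ u.1 u.2.1), u.2.2)

/-- A covector of the sphere, extended by zero to the normal direction. -/
def extendCovector (x₀ : UnitSphere m) (η : Cotangent (𝓡 (m - 1)) (UnitSphere m)) :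
    EuclideanSpace ℝ (Fin m) →L[ℝ] ℝ :=
  (covectorVal η).comp (retractDeriv (𝓡 (m - 1)) (sphereRetract x₀)
    (η.proj : EuclideanSpace ℝ (Fin m)))

/-- The map from `J^1(S^{m-1}) × ℝ^{2l}` to the slice. -/
def jetTimesToSlice (x₀ : UnitSphere m)
    (b : Jet1 (𝓡 (m - 1)) (UnitSphere m) × EuclideanSpace ℝ (Fin (2 * l))) : SplitSpace m l :=
  ((b.1.1.proj : EuclideanSpace ℝ (Fin m)),
    (2 * b.1.2) • (b.1.1.proj : EuclideanSpace ℝ (Fin m)) -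
      (InnerProductSpace.toDual ℝ (EuclideanSpace ℝ (Fin m))).symm (extendCovector x₀ b.1.1),
    b.2)

theorem contMDiffAt_sphereRetract_fst (x₀ : UnitSphere m) {u : SplitSpace m l} (hu : u.1 ≠ 0) :
    ContMDiffAt 𝓘(ℝ, SplitSpace m l) (𝓡 (m - 1)) ∞
      (fun u : SplitSpace m l => sphereRetract x₀ u.1) u :=
  ContMDiffAt.comp u (g := sphereRetract x₀)
    ((isSmoothRetraction_sphereRetract (m := m - 1) x₀).contMDiffAt _ hu)
    contDiff_fst.contMDiff.contMDiffAt

theorem contMDiffAt_sliceToJetTimes (x₀ : UnitSphere m) {u : SplitSpace m l} (hu : u.1 ≠ 0) :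
    ContMDiffAt 𝓘(ℝ, SplitSpace m l)
      ((jet1Model (𝓡 (m - 1))).prod 𝓘(ℝ, EuclideanSpace ℝ (Fin (2 * l)))) ∞
      (sliceToJetTimes x₀) u := by
  have h := isSmoothRetraction_sphereRetract (m := m - 1) x₀
  refine ContMDiffAt.prodMk (ContMDiffAt.prodMk (h.contMDiffAt_mkCovector
    (f := fun u : SplitSpace m l => sphereRetract x₀ u.1)
    (P := fun u : SplitSpace m l => -innerSL ℝ u.2.1) ?_ ?_) ?_) ?_
  · exact contMDiffAt_sphereRetract_fst x₀ hu
  · exact ((innerSL ℝ).contDiff.comp (contDiff_fst.comp contDiff_snd)).neg.contMDiff.contMDiffAt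
  · exact (contDiff_const.mul (contDiff_fst.inner ℝ (contDiff_fst.comp contDiff_snd))).contMDiff
      |>.contMDiffAt
  · exact (contDiff_snd.comp contDiff_snd).contMDiff.contMDiffAt

theorem contMDiff_jetTimesToSlice (x₀ : UnitSphere m) :
    ContMDiff ((jet1Model (𝓡 (m - 1))).prod 𝓘(ℝ, EuclideanSpace ℝ (Fin (2 * l))))
      𝓘(ℝ, SplitSpace m l) ∞ (jetTimesToSlice (l := l) x₀) := by
  have h := isSmoothRetraction_sphereRetract (m := m - 1) x₀
  have h1 : ContMDiff (cotangentModel (𝓡 (m - 1))) 𝓘(ℝ, EuclideanSpace ℝ (Fin m)) ∞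
      (fun η : Cotangent (𝓡 (m - 1)) (UnitSphere m) =>
        (η.proj : EuclideanSpace ℝ (Fin m))) := h.contMDiff.comp contMDiff_cotangent_proj
  have h2 : ContMDiff (cotangentModel (𝓡 (m - 1))) 𝓘(ℝ, EuclideanSpace ℝ (Fin m)) ∞
      (fun η : Cotangent (𝓡 (m - 1)) (UnitSphere m) =>
        (InnerProductSpace.toDual ℝ (EuclideanSpace ℝ (Fin m))).symm (extendCovector x₀ η)) :=
    (InnerProductSpace.toDual ℝ (EuclideanSpace ℝ (Fin m))).symm.contDiff.contMDiff.comp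
      h.contMDiff_covectorVal_comp
  have hb : ContMDiff ((jet1Model (𝓡 (m - 1))).prod 𝓘(ℝ, EuclideanSpace ℝ (Fin (2 * l))))
      (cotangentModel (𝓡 (m - 1))) ∞
      (fun b : Jet1 (𝓡 (m - 1)) (UnitSphere m) × EuclideanSpace ℝ (Fin (2 * l)) => b.1.1) :=
    contMDiff_fst.comp contMDiff_fst
  have hz : ContMDiff ((jet1Model (𝓡 (m - 1))).prod 𝓘(ℝ, EuclideanSpace ℝ (Fin (2 * l))))
      𝓘(ℝ, ℝ) ∞
      (fun b : Jet1 (𝓡 (m - 1)) (UnitSphere m) × EuclideanSpace ℝ (Fin (2 * l)) => b.1.2) :=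
    contMDiff_snd.comp contMDiff_fst
  exact (h1.comp hb).prodMk_space
    ((((contMDiff_const.mul hz).smul (h1.comp hb)).sub (h2.comp hb)).prodMk_space contMDiff_snd)

/-- The radial retraction is constant along rays, so its derivative kills the normal direction. -/
theorem extendCovector_proj (x₀ : UnitSphere m) (η : Cotangent (𝓡 (m - 1)) (UnitSphere m)) :
    extendCovector x₀ η (η.proj : EuclideanSpace ℝ (Fin m)) = 0 := by
  have h := isSmoothRetraction_sphereRetract (m := m - 1) x₀
  have hn : ‖(η.proj : EuclideanSpace ℝ (Fin m))‖ = 1 := norm_eq_of_mem_sphere _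
  rw [extendCovector, ContinuousLinearMap.comp_apply, h.vectorDeriv_eq_zero, map_zero]
  rw [fderiv_sphereRetract x₀ hn, real_inner_self_eq_norm_sq, hn]
  simp

theorem inner_coe_vectorDeriv (x₀ x : UnitSphere m) (v : EuclideanSpace ℝ (Fin (m - 1))) :
    inner ℝ (x : EuclideanSpace ℝ (Fin m)) (vectorDeriv (𝓡 (m - 1))
      ((↑) : UnitSphere m → EuclideanSpace ℝ (Fin m)) x v) = 0 := by
  have hn : ‖(x : EuclideanSpace ℝ (Fin m))‖ = 1 := norm_eq_of_mem_sphere _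
  have h1 := (isSmoothRetraction_sphereRetract (m := m - 1) x₀).fderiv_vectorDeriv x v
  rw [fderiv_sphereRetract x₀ hn, sub_eq_self] at h1
  have := congrArg norm h1
  rw [norm_smul, hn, norm_zero, mul_one, norm_eq_zero] at this
  exact this

/-- The covector records the tangential part of `-p` and `z` the normal part, as `⟪q, p⟫ = 2z`.
Hence `p = 2z q - η`, with `η` extended by zero to the normal and viewed as a vector. -/
theorem sliceToJetTimes_jetTimesToSlice (x₀ : UnitSphere m)
    (b : Jet1 (𝓡 (m - 1)) (UnitSphere m) × EuclideanSpace ℝ (Fin (2 * l))) :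
    sliceToJetTimes x₀ (jetTimesToSlice x₀ b) = b := by
  have h := isSmoothRetraction_sphereRetract (m := m - 1) x₀
  have hn : ‖(b.1.1.proj : EuclideanSpace ℝ (Fin m))‖ = 1 := norm_eq_of_mem_sphere _
  have h1 : sphereRetract x₀ (jetTimesToSlice x₀ b).1 = b.1.1.proj := h.leftInverse _
  refine Prod.ext (Prod.ext (mkCovector_eq h1 ?_) ?_) rfl
  · rw [h1]
    ext v
    show -inner ℝ ((2 * b.1.2) • (b.1.1.proj : EuclideanSpace ℝ (Fin m)) -
      (InnerProductSpace.toDual ℝ (EuclideanSpace ℝ (Fin m))).symm (extendCovector x₀ b.1.1))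
      (vectorDeriv (𝓡 (m - 1)) Subtype.val b.1.1.proj v) = covectorVal b.1.1 v
    rw [inner_sub_left, inner_smul_left, inner_coe_vectorDeriv x₀,
      InnerProductSpace.toDual_symm_apply, extendCovector, ContinuousLinearMap.comp_apply,
      h.retractDeriv_vectorDeriv]
    ring
  · show 1 / 2 * inner ℝ (b.1.1.proj : EuclideanSpace ℝ (Fin m))
      ((2 * b.1.2) • (b.1.1.proj : EuclideanSpace ℝ (Fin m)) -
      (InnerProductSpace.toDual ℝ (EuclideanSpace ℝ (Fin m))).symm (extendCovector x₀ b.1.1))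
      = b.1.2
    rw [inner_sub_right, inner_smul_right,
      real_inner_comm ((InnerProductSpace.toDual ℝ (EuclideanSpace ℝ (Fin m))).symm _),
      InnerProductSpace.toDual_symm_apply, extendCovector_proj, real_inner_self_eq_norm_sq, hn]
    ring

theorem jetTimesToSlice_sliceToJetTimes (x₀ : UnitSphere m) {u : SplitSpace m l}
    (hu : ‖u.1‖ = 1) : jetTimesToSlice x₀ (sliceToJetTimes x₀ u) = u := by
  have h := isSmoothRetraction_sphereRetract (m := m - 1) x₀
  have h0 : u.1 ≠ 0 := norm_pos_iff.1 (hu ▸ one_pos)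
  have h1 : (sphereRetract x₀ u.1 : EuclideanSpace ℝ (Fin m)) = u.1 :=
    coe_sphereRetract_of_norm x₀ hu
  have h2 : extendCovector x₀ (sliceToJetTimes x₀ u).1.1 =
      InnerProductSpace.toDual ℝ _ (inner ℝ u.1 u.2.1 • u.1 - u.2.1) := by
    ext v
    have h3 := h.vectorDeriv_retractDeriv (h.mem (sphereRetract x₀ u.1)) v
    rw [h.leftInverse, h1, fderiv_sphereRetract x₀ hu] at h3
    show -inner ℝ u.2.1 (vectorDeriv _ _ _ (retractDeriv _ _
      (sphereRetract x₀ u.1 : EuclideanSpace ℝ (Fin m)) v)) = _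
    rw [h1, h3, InnerProductSpace.toDual_apply_apply, inner_sub_left, inner_sub_right,
      inner_smul_left, inner_smul_right, real_inner_comm u.1 u.2.1]
    simp
    ring
  refine Prod.ext h1 (Prod.ext ?_ rfl)
  show (2 * (1 / 2 * inner ℝ u.1 u.2.1)) • (sphereRetract x₀ u.1 : EuclideanSpace ℝ (Fin m)) -
    (InnerProductSpace.toDual ℝ _).symm (extendCovector x₀ (sliceToJetTimes x₀ u).1.1) = _
  rw [h1, h2, LinearIsometryEquiv.symm_apply_apply]
  module

/-- With `z = ½⟪q, p⟫`, the form `dz - p dq` equals `½(q dp - p dq)`, and the `w` part is unchanged.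
The condition `|q| = 1` along `γ` removes the normalization of the base point before
differentiation. -/
theorem jetTimesForm_pullback {A G X : Type*} [NormedAddCommGroup A] [NormedSpace ℝ A]
    [TopologicalSpace G] {J : ModelWithCorners ℝ A G} [TopologicalSpace X] [ChartedSpace G X]
    (x₀ : UnitSphere m) {γ : X → SplitSpace m l}
    (hγ : ContMDiff J 𝓘(ℝ, SplitSpace m l) ∞ γ) (hγ₁ : ∀ x, ‖(γ x).1‖ = 1) (x : X) (v : A) :
    OneForm.pullback (I := J) (fun x => sliceToJetTimes x₀ (γ x)) (jetTimesForm m l) x v =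
      linearLiouville (stdComplexStructure l) (γ x) (vectorDeriv J γ x v) := by
  have h := isSmoothRetraction_sphereRetract (m := m - 1) x₀
  have h0 : (γ x).1 ≠ 0 := norm_pos_iff.1 ((hγ₁ x) ▸ one_pos)
  have hF := ((contMDiffAt_sliceToJetTimes x₀ h0).comp x (hγ x)).mdifferentiableAt (by simp)
  have hγd := (hγ x).mdifferentiableAt (by simp)
  have hf : ContMDiffAt J (𝓡 (m - 1)) ∞ (fun x => sphereRetract x₀ (γ x).1) x :=
    ContMDiffAt.comp x (g := fun u : SplitSpace m l => sphereRetract x₀ u.1)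
      (contMDiffAt_sphereRetract_fst x₀ h0) (hγ x)
  have hP : ContMDiffAt J 𝓘(ℝ, EuclideanSpace ℝ (Fin m) →L[ℝ] ℝ) ∞
      (fun x => -innerSL ℝ (γ x).2.1) x :=
    ContMDiffAt.comp x (g := fun u : SplitSpace m l => -innerSL ℝ u.2.1)
      ((innerSL ℝ).contDiff.comp (contDiff_fst.comp contDiff_snd)).neg.contMDiff.contMDiffAt (hγ x)
  have hz : ContMDiffAt J 𝓘(ℝ, ℝ) ∞ (fun x => 1 / 2 * inner ℝ (γ x).1 (γ x).2.1) x :=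
    ContMDiffAt.comp x (g := fun u : SplitSpace m l => 1 / 2 * inner ℝ u.1 u.2.1)
      (contDiff_const.mul (contDiff_fst.inner ℝ
        (contDiff_fst.comp contDiff_snd))).contMDiff.contMDiffAt (hγ x)
  have h1 := OneForm.pullback_pullback_apply (I₁ := J)
    (f := fun x => sliceToJetTimes x₀ (γ x)) (g := fun b => b.1)
    (jet1Form (𝓡 (m - 1)) (UnitSphere m)) mdifferentiableAt_fst hF v
  have h2 := OneForm.pullback_pullback_apply (I₁ := J)
    (f := fun x => sliceToJetTimes x₀ (γ x)) (g := fun b => b.2)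
    (stdLiouville l) mdifferentiableAt_snd hF v
  have h3 := h1.trans (jet1Form_pullback h hf hP hz v)
  have h4 : (fun y => (sphereRetract x₀ (γ y).1 : EuclideanSpace ℝ (Fin m))) =
      fun y => (γ y).1 := funext fun y => coe_sphereRetract_of_norm x₀ (hγ₁ y)
  have h5 := vectorDeriv_clm_comp_apply (ContinuousLinearMap.fst ℝ (EuclideanSpace ℝ (Fin m))
    (EuclideanSpace ℝ (Fin m) × EuclideanSpace ℝ (Fin (2 * l)))) hγd v
  have h6 := vectorDeriv_clm_comp_apply ((ContinuousLinearMap.snd ℝ (EuclideanSpace ℝ (Fin m))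
    (EuclideanSpace ℝ (Fin (2 * l)))).comp (ContinuousLinearMap.snd ℝ (EuclideanSpace ℝ (Fin m))
    (EuclideanSpace ℝ (Fin m) × EuclideanSpace ℝ (Fin (2 * l))))) hγd v
  obtain ⟨hd, hd'⟩ := fderiv_inner_fst_snd (γ x) (vectorDeriv J γ x v)
  have h7 : vectorDeriv J (fun x => 1 / 2 * inner ℝ (γ x).1 (γ x).2.1) x v =
      1 / 2 * (inner ℝ (γ x).1 (vectorDeriv J γ x v).2.1 +
        inner ℝ (vectorDeriv J γ x v).1 (γ x).2.1) := by
    rw [vectorDeriv_comp_apply (φ := fun u : SplitSpace m l => 1 / 2 * inner ℝ u.1 u.2.1)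
      (hd.const_mul _) hγd, fderiv_const_mul hd, smul_apply, hd', smul_eq_mul]
  have h8 : OneForm.pullback (I := J) (J := 𝓘(ℝ, EuclideanSpace ℝ (Fin (2 * l))))
      (fun y => (γ y).2.2) (stdLiouville l) x v =
      1 / 2 * inner ℝ (stdComplexStructure l (γ x).2.2) (vectorDeriv J γ x v).2.2 := by
    rw [← stdLiouville_apply]
    exact congrArg (stdLiouville l (γ x).2.2) h6
  rw [h4, h7] at h3
  refine (congrArg₂ (· + ·) h3 (h2.trans h8)).trans ?_
  have h9 : (-innerSL ℝ (γ x).2.1) (vectorDeriv J (fun y => (γ y).1) x v) =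
      -inner ℝ (γ x).2.1 (vectorDeriv J γ x v).1 := congrArg (-innerSL ℝ (γ x).2.1) h5
  simp only [h9, linearLiouville, real_inner_comm (γ x).2.1 (vectorDeriv J γ x v).1]
  ring

theorem contactomorphic_jetTimesForm {n k : ℕ} [NeZero n] (e : Fin n ≃ Fin m ⊕ Fin l)
    (hO : ∀ v, v ∈ coordPlane n k ↔ (splitLinear e v).1 = 0) (x₀ : sphereCompl n k)
    (θ₀ : UnitSphere m) : Contactomorphic (sphereForm n k) (jetTimesForm m l) :=
  contactomorphic_of_slice e hO x₀
    (fun _ hu => contMDiffAt_sliceToJetTimes θ₀ (norm_pos_iff.1 (hu ▸ one_pos)))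
    (contMDiff_jetTimesToSlice θ₀) (fun b => norm_eq_of_mem_sphere b.1.1.proj)
    (sliceToJetTimes_jetTimesToSlice θ₀) (fun _ hu => jetTimesToSlice_sliceToJetTimes θ₀ hu)
    (fun _ hγ hγ₁ => jetTimesForm_pullback θ₀ hγ hγ₁)

end JetTimes

/-! ### The slice as `J^1(S^{m-1} × ℝ^l)` -/

section JetProd

variable {m l : ℕ} [NeZero m]

variable (l) in
/-- The coordinates `(x, y)` of `ℝ^{2l}`. -/
def halves : EuclideanSpace ℝ (Fin (2 * l)) ≃L[ℝ] EuclideanSpace ℝ (Fin l) ×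
    EuclideanSpace ℝ (Fin l) × EuclideanSpace ℝ (Fin (2 * 0)) :=
  splitEquiv (Equiv.sumEmpty (Fin l) (Fin 0)).symm

instance subsingletonEuclideanZero : Subsingleton (EuclideanSpace ℝ (Fin (2 * 0))) :=
  ⟨fun v w => by ext i; exact i.elim0⟩

/-- This is the splitting of the form with every conjugate pair in the first block; the second block
has dimension zero. -/
theorem inner_stdComplexStructure_halves (w h : EuclideanSpace ℝ (Fin (2 * l))) :
    inner ℝ (stdComplexStructure l w) h =
      inner ℝ (halves l w).1 (halves l h).2.1 - inner ℝ (halves l w).2.1 (halves l h).1 := by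
  have h1 := linearLiouville_splitLinear (Equiv.sumEmpty (Fin l) (Fin 0)).symm w h
  rw [stdLiouvilleBilin_apply, linearLiouville, Subsingleton.elim (stdComplexStructure 0 _) 0,
    inner_zero_left] at h1
  have h2 : ∀ w, halves l w = splitLinear (Equiv.sumEmpty (Fin l) (Fin 0)).symm w := fun _ => rfl
  rw [h2, h2]
  linarith

variable (m l) in
/-- The inclusion of `S^{m-1} × ℝ^l`. -/
def prodIncl (x : UnitSphere m × EuclideanSpace ℝ (Fin l)) :
    EuclideanSpace ℝ (Fin m) × EuclideanSpace ℝ (Fin l) := (x.1, x.2)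

variable (l) in
/-- The retraction to `S^{m-1} × ℝ^l`. -/
def prodRetract (x₀ : UnitSphere m) (v : EuclideanSpace ℝ (Fin m) × EuclideanSpace ℝ (Fin l)) :
    UnitSphere m × EuclideanSpace ℝ (Fin l) := (sphereRetract x₀ v.1, v.2)

/-- The model of `S^{m-1} × ℝ^l`. -/
abbrev prodModel (m l : ℕ) := (𝓡 (m - 1)).prod 𝓘(ℝ, EuclideanSpace ℝ (Fin l))

variable (l) in
theorem isSmoothRetraction_prodRetract (x₀ : UnitSphere m) :
    IsSmoothRetraction (prodModel m l) (prodIncl m l) (prodRetract l x₀)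
      ({v | v ≠ 0} ×ˢ Set.univ) :=
  (isSmoothRetraction_sphereRetract (m := m - 1) x₀).prod_id _

theorem norm_prodIncl_fst (x : UnitSphere m × EuclideanSpace ℝ (Fin l)) :
    ‖(prodIncl m l x).1‖ = 1 := norm_eq_of_mem_sphere x.1

theorem fderiv_prodRetract (x₀ : UnitSphere m)
    {v : EuclideanSpace ℝ (Fin m) × EuclideanSpace ℝ (Fin l)} (hv : ‖v.1‖ = 1)
    (u : EuclideanSpace ℝ (Fin m) × EuclideanSpace ℝ (Fin l)) :
    fderiv ℝ (fun w => prodIncl m l (prodRetract l x₀ w)) v u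
      = (u.1 - inner ℝ v.1 u.1 • v.1, u.2) := by
  have h1 := (isSmoothRetraction_sphereRetract (m := m - 1) x₀).fderiv_prod_id
    (L := EuclideanSpace ℝ (Fin l)) (v := v) (norm_pos_iff.1 (hv ▸ one_pos)) u
  rw [fderiv_sphereRetract x₀ hv] at h1
  exact h1

/-- The functional defined by a pair of vectors, with the opposite sign. -/
def negPairing (u : SplitSpace m l) :
    EuclideanSpace ℝ (Fin m) × EuclideanSpace ℝ (Fin l) →L[ℝ] ℝ :=
  -((innerSL ℝ u.2.1).comp (ContinuousLinearMap.fst ℝ _ _) +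
    (innerSL ℝ (halves l u.2.2).2.1).comp (ContinuousLinearMap.snd ℝ _ _))

theorem negPairing_apply (u : SplitSpace m l)
    (v : EuclideanSpace ℝ (Fin m) × EuclideanSpace ℝ (Fin l)) :
    negPairing u v = -(inner ℝ u.2.1 v.1 + inner ℝ (halves l u.2.2).2.1 v.2) := rfl

theorem contDiff_negPairing : ContDiff ℝ ∞ (negPairing (m := m) (l := l)) := by
  have h1 : ContDiff ℝ ∞ fun u : SplitSpace m l => innerSL ℝ u.2.1 :=
    (innerSL ℝ).contDiff.comp (contDiff_fst.comp contDiff_snd)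
  have h2 : ContDiff ℝ ∞ fun u : SplitSpace m l => innerSL ℝ (halves l u.2.2).2.1 :=
    (innerSL ℝ).contDiff.comp (contDiff_fst.comp (contDiff_snd.comp
      ((halves l).contDiff.comp (contDiff_snd.comp contDiff_snd))))
  exact ((h1.clm_comp contDiff_const).add (h2.clm_comp contDiff_const)).neg

/-- The base point in `S^{m-1} × ℝ^l` of a point of the slice. -/
def sliceBase (x₀ : UnitSphere m) (u : SplitSpace m l) : UnitSphere m × EuclideanSpace ℝ (Fin l) :=
  (sphereRetract x₀ u.1, (halves l u.2.2).1)

/-- The function `½ (⟪q, p⟫ + ⟪x, y⟫)`. -/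
def sliceHeight (u : SplitSpace m l) : ℝ :=
  1 / 2 * inner ℝ u.1 u.2.1 + 1 / 2 * inner ℝ (halves l u.2.2).1 (halves l u.2.2).2.1

/-- The map from the slice to `J^1(S^{m-1} × ℝ^l)`. -/
def sliceToJetProd (x₀ : UnitSphere m) (u : SplitSpace m l) :
    Jet1 (prodModel m l) (UnitSphere m × EuclideanSpace ℝ (Fin l)) :=
  (mkCovector (prodModel m l) (sliceBase x₀ u) ((negPairing u).comp
    (vectorDeriv (prodModel m l) (prodIncl m l) (sliceBase x₀ u))), sliceHeight u)

/-- A covector of `S^{m-1} × ℝ^l`, extended by zero to the normal direction. -/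
def extendProdCovector (x₀ : UnitSphere m)
    (η : Cotangent (prodModel m l) (UnitSphere m × EuclideanSpace ℝ (Fin l))) :
    EuclideanSpace ℝ (Fin m) × EuclideanSpace ℝ (Fin l) →L[ℝ] ℝ :=
  (covectorVal η).comp (retractDeriv (prodModel m l) (prodRetract l x₀) (prodIncl m l η.proj))

/-- The components of an extended covector, as vectors. -/
def prodCovectorVectors (x₀ : UnitSphere m)
    (η : Cotangent (prodModel m l) (UnitSphere m × EuclideanSpace ℝ (Fin l))) :
    EuclideanSpace ℝ (Fin m) × EuclideanSpace ℝ (Fin l) :=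
  ((InnerProductSpace.toDual ℝ _).symm
    ((extendProdCovector x₀ η).comp (ContinuousLinearMap.inl ℝ _ _)),
   (InnerProductSpace.toDual ℝ _).symm
    ((extendProdCovector x₀ η).comp (ContinuousLinearMap.inr ℝ _ _)))

theorem inner_prodCovectorVectors (x₀ : UnitSphere m)
    (η : Cotangent (prodModel m l) (UnitSphere m × EuclideanSpace ℝ (Fin l)))
    (v : EuclideanSpace ℝ (Fin m) × EuclideanSpace ℝ (Fin l)) :
    inner ℝ (prodCovectorVectors x₀ η).1 v.1 + inner ℝ (prodCovectorVectors x₀ η).2 v.2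
      = extendProdCovector x₀ η v := by
  rw [prodCovectorVectors, InnerProductSpace.toDual_symm_apply,
    InnerProductSpace.toDual_symm_apply, ContinuousLinearMap.comp_apply,
    ContinuousLinearMap.comp_apply, ← map_add]
  simp

/-- The map from `J^1(S^{m-1} × ℝ^l)` to the slice. -/
def jetProdToSlice (x₀ : UnitSphere m)
    (b : Jet1 (prodModel m l) (UnitSphere m × EuclideanSpace ℝ (Fin l))) : SplitSpace m l :=
  ((b.1.proj.1 : EuclideanSpace ℝ (Fin m)),
    (2 * b.2 + inner ℝ b.1.proj.2 (prodCovectorVectors x₀ b.1).2) •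
      (b.1.proj.1 : EuclideanSpace ℝ (Fin m)) - (prodCovectorVectors x₀ b.1).1,
    (halves l).symm (b.1.proj.2, -(prodCovectorVectors x₀ b.1).2, 0))

theorem contMDiffAt_sliceBase (x₀ : UnitSphere m) {u : SplitSpace m l} (hu : u.1 ≠ 0) :
    ContMDiffAt 𝓘(ℝ, SplitSpace m l) (prodModel m l) ∞ (sliceBase x₀) u :=
  (contMDiffAt_sphereRetract_fst x₀ hu).prodMk (contDiff_fst.comp
    ((halves l).contDiff.comp (contDiff_snd.comp contDiff_snd))).contMDiff.contMDiffAt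

theorem contDiff_sliceHeight : ContDiff ℝ ∞ (sliceHeight (m := m) (l := l)) := by
  have h1 : ContDiff ℝ ∞ fun u : SplitSpace m l => halves l u.2.2 :=
    (halves l).contDiff.comp (contDiff_snd.comp contDiff_snd)
  exact (contDiff_const.mul (contDiff_fst.inner ℝ (contDiff_fst.comp contDiff_snd))).add
    (contDiff_const.mul ((contDiff_fst.comp h1).inner ℝ
      (contDiff_fst.comp (contDiff_snd.comp h1))))

theorem contMDiffAt_sliceToJetProd (x₀ : UnitSphere m) {u : SplitSpace m l} (hu : u.1 ≠ 0) :
    ContMDiffAt 𝓘(ℝ, SplitSpace m l) (jet1Model (prodModel m l)) ∞ (sliceToJetProd x₀) u :=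
  ((isSmoothRetraction_prodRetract l x₀).contMDiffAt_mkCovector (contMDiffAt_sliceBase x₀ hu)
    contDiff_negPairing.contMDiff.contMDiffAt).prodMk contDiff_sliceHeight.contMDiff.contMDiffAt

theorem contMDiff_prodCovectorVectors (x₀ : UnitSphere m) :
    ContMDiff (cotangentModel (prodModel m l))
      𝓘(ℝ, EuclideanSpace ℝ (Fin m) × EuclideanSpace ℝ (Fin l)) ∞
      (prodCovectorVectors (l := l) x₀) := by
  have h1 := (isSmoothRetraction_prodRetract l x₀).contMDiff_covectorVal_comp
  have h2 : ContDiff ℝ ∞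
      fun φ : EuclideanSpace ℝ (Fin m) × EuclideanSpace ℝ (Fin l) →L[ℝ] ℝ =>
      ((InnerProductSpace.toDual ℝ _).symm (φ.comp (ContinuousLinearMap.inl ℝ _ _)),
        (InnerProductSpace.toDual ℝ _).symm (φ.comp (ContinuousLinearMap.inr ℝ _ _))) :=
    ((InnerProductSpace.toDual ℝ _).symm.contDiff.comp (contDiff_id.clm_comp contDiff_const)).prodMk
      ((InnerProductSpace.toDual ℝ _).symm.contDiff.comp (contDiff_id.clm_comp contDiff_const))
  exact h2.contMDiff.comp h1

theorem contMDiff_jetProdToSlice (x₀ : UnitSphere m) :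
    ContMDiff (jet1Model (prodModel m l)) 𝓘(ℝ, SplitSpace m l) ∞
      (jetProdToSlice (l := l) x₀) := by
  have hb : ContMDiff (jet1Model (prodModel m l)) (cotangentModel (prodModel m l)) ∞
      (fun b : Jet1 (prodModel m l) (UnitSphere m × EuclideanSpace ℝ (Fin l)) => b.1) :=
    contMDiff_fst
  have hz : ContMDiff (jet1Model (prodModel m l)) 𝓘(ℝ, ℝ) ∞
      (fun b : Jet1 (prodModel m l) (UnitSphere m × EuclideanSpace ℝ (Fin l)) => b.2) :=
    contMDiff_snd
  have h1 := ((isSmoothRetraction_prodRetract l x₀).contMDiff.comp contMDiff_cotangent_proj).comp hb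
  have h2 := (contMDiff_prodCovectorVectors x₀).comp hb
  have h3 : ContDiff ℝ ∞ fun u : (EuclideanSpace ℝ (Fin m) × EuclideanSpace ℝ (Fin l)) ×
      (EuclideanSpace ℝ (Fin m) × EuclideanSpace ℝ (Fin l)) × ℝ =>
      ((u.1.1, (2 * u.2.2 + inner ℝ u.1.2 u.2.1.2) • u.1.1 - u.2.1.1,
        (halves l).symm (u.1.2, -u.2.1.2, 0)) : SplitSpace m l) := by
    refine (contDiff_fst.comp contDiff_fst).prodMk (ContDiff.prodMk ?_ ?_)
    · exact (((contDiff_const.mul (contDiff_snd.comp contDiff_snd)).add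
        ((contDiff_snd.comp contDiff_fst).inner ℝ
          (contDiff_snd.comp (contDiff_fst.comp contDiff_snd)))).smul
        (contDiff_fst.comp contDiff_fst)).sub (contDiff_fst.comp (contDiff_fst.comp contDiff_snd))
    · exact (halves l).symm.contDiff.comp ((contDiff_snd.comp contDiff_fst).prodMk
        ((contDiff_snd.comp (contDiff_fst.comp contDiff_snd)).neg.prodMk contDiff_const))
  exact h3.contMDiff.comp (h1.prodMk_space (h2.prodMk_space hz))

theorem extendProdCovector_normal (x₀ : UnitSphere m)
    (η : Cotangent (prodModel m l) (UnitSphere m × EuclideanSpace ℝ (Fin l))) :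
    extendProdCovector x₀ η ((η.proj.1 : EuclideanSpace ℝ (Fin m)), 0) = 0 := by
  have h := isSmoothRetraction_prodRetract l x₀
  have hn : ‖(η.proj.1 : EuclideanSpace ℝ (Fin m))‖ = 1 := norm_eq_of_mem_sphere _
  rw [extendProdCovector, ContinuousLinearMap.comp_apply, h.vectorDeriv_eq_zero, map_zero]
  rw [fderiv_prodRetract x₀ (norm_prodIncl_fst η.proj)]
  simp [prodIncl, hn]

theorem inner_prodIncl_vectorDeriv (x₀ : UnitSphere m)
    (x : UnitSphere m × EuclideanSpace ℝ (Fin l))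
    (v : EuclideanSpace ℝ (Fin (m - 1)) × EuclideanSpace ℝ (Fin l)) :
    inner ℝ (x.1 : EuclideanSpace ℝ (Fin m))
      (vectorDeriv (prodModel m l) (prodIncl m l) x v).1 = 0 := by
  have h1 := congrArg Prod.fst
    ((isSmoothRetraction_prodRetract l x₀).fderiv_vectorDeriv x v)
  rw [fderiv_prodRetract x₀ (norm_prodIncl_fst x), sub_eq_self] at h1
  have := congrArg norm h1
  rw [norm_smul, norm_prodIncl_fst, norm_zero, mul_one, norm_eq_zero] at this
  exact this

/-- Here `2z = ⟪q, p⟫ + ⟪x, y⟫`, and the second component `η₂` of the covector is `-y`, so the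
normal part of `p` is `2z + ⟪x, η₂⟫`. The normal direction contributes nothing to the extended
covector. -/
theorem sliceToJetProd_jetProdToSlice (x₀ : UnitSphere m)
    (b : Jet1 (prodModel m l) (UnitSphere m × EuclideanSpace ℝ (Fin l))) :
    sliceToJetProd x₀ (jetProdToSlice x₀ b) = b := by
  have h := isSmoothRetraction_prodRetract l x₀
  have hn : ‖(b.1.proj.1 : EuclideanSpace ℝ (Fin m))‖ = 1 := norm_eq_of_mem_sphere _
  have hw : halves l (jetProdToSlice x₀ b).2.2 =
      (b.1.proj.2, -(prodCovectorVectors x₀ b.1).2, 0) :=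
    (halves l).apply_symm_apply _
  have h1 : sliceBase x₀ (jetProdToSlice x₀ b) = b.1.proj := by
    refine Prod.ext ((isSmoothRetraction_sphereRetract (m := m - 1) x₀).leftInverse _) ?_
    rw [sliceBase, hw]
  refine Prod.ext (mkCovector_eq h1 ?_) ?_
  · rw [h1]
    refine ContinuousLinearMap.ext fun v => ?_
    rw [ContinuousLinearMap.comp_apply, negPairing_apply, hw]
    show -(inner ℝ ((2 * b.2 + inner ℝ b.1.proj.2 (prodCovectorVectors x₀ b.1).2) •
      (b.1.proj.1 : EuclideanSpace ℝ (Fin m)) - (prodCovectorVectors x₀ b.1).1) _ +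
      inner ℝ (-(prodCovectorVectors x₀ b.1).2) _) = _
    rw [inner_sub_left, inner_smul_left, inner_prodIncl_vectorDeriv x₀, inner_neg_left]
    have h2 := inner_prodCovectorVectors x₀ b.1
      (vectorDeriv (prodModel m l) (prodIncl m l) b.1.proj v)
    rw [extendProdCovector, ContinuousLinearMap.comp_apply, h.retractDeriv_vectorDeriv] at h2
    rw [← h2]
    ring
  · have h2 := inner_prodCovectorVectors x₀ b.1 ((b.1.proj.1 : EuclideanSpace ℝ (Fin m)), 0)
    rw [extendProdCovector_normal, inner_zero_right, add_zero] at h2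
    show sliceHeight _ = _
    rw [sliceHeight, hw]
    show 1 / 2 * inner ℝ (b.1.proj.1 : EuclideanSpace ℝ (Fin m))
      ((2 * b.2 + inner ℝ b.1.proj.2 (prodCovectorVectors x₀ b.1).2) •
      (b.1.proj.1 : EuclideanSpace ℝ (Fin m)) - (prodCovectorVectors x₀ b.1).1) +
      1 / 2 * inner ℝ b.1.proj.2 (-(prodCovectorVectors x₀ b.1).2) = _
    rw [inner_sub_right, inner_smul_right, real_inner_comm (prodCovectorVectors x₀ b.1).1, h2,
      real_inner_self_eq_norm_sq, hn, inner_neg_right]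
    ring

theorem jetProdToSlice_sliceToJetProd (x₀ : UnitSphere m) {u : SplitSpace m l}
    (hu : ‖u.1‖ = 1) : jetProdToSlice x₀ (sliceToJetProd x₀ u) = u := by
  have h := isSmoothRetraction_prodRetract l x₀
  have h1 : (sphereRetract x₀ u.1 : EuclideanSpace ℝ (Fin m)) = u.1 :=
    coe_sphereRetract_of_norm x₀ hu
  have h1' : prodIncl m l (sliceBase x₀ u) = (u.1, (halves l u.2.2).1) := Prod.ext h1 rfl
  have h2 (v : EuclideanSpace ℝ (Fin m) × EuclideanSpace ℝ (Fin l)) :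
      extendProdCovector x₀ (sliceToJetProd x₀ u).1 v =
        negPairing u (v.1 - inner ℝ u.1 v.1 • u.1, v.2) := by
    have h3 := h.vectorDeriv_retractDeriv (h.mem (sliceBase x₀ u)) v
    rw [h.leftInverse, h1', fderiv_prodRetract x₀ (v := (u.1, (halves l u.2.2).1)) hu] at h3
    show negPairing u (vectorDeriv _ _ _ (retractDeriv _ _
      (prodIncl m l (sliceBase x₀ u)) v)) = _
    rw [h1', h3]
  have h4 : prodCovectorVectors x₀ (sliceToJetProd x₀ u).1 =
      (inner ℝ u.1 u.2.1 • u.1 - u.2.1, -(halves l u.2.2).2.1) := by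
    refine Prod.ext ?_ ?_
    · refine (LinearIsometryEquiv.symm_apply_eq _).2 ?_
      ext v
      rw [ContinuousLinearMap.comp_apply, h2, negPairing_apply,
        InnerProductSpace.toDual_apply_apply, inner_sub_left, inner_smul_left,
        ContinuousLinearMap.inl_apply, inner_sub_right, inner_smul_right,
        real_inner_comm u.1 u.2.1, inner_zero_right]
      simp only [conj_trivial]
      ring
    · refine (LinearIsometryEquiv.symm_apply_eq _).2 ?_
      ext v
      rw [ContinuousLinearMap.comp_apply, h2, negPairing_apply,
        InnerProductSpace.toDual_apply_apply, ContinuousLinearMap.inr_apply, inner_neg_left]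
      simp
  have hp : (sliceToJetProd x₀ u).1.proj = sliceBase x₀ u := rfl
  have hz : (sliceToJetProd x₀ u).2 = sliceHeight u := rfl
  rw [jetProdToSlice, h4, hp, hz]
  refine Prod.ext h1 (Prod.ext ?_ ?_)
  · show (2 * sliceHeight u + inner ℝ (halves l u.2.2).1 (-(halves l u.2.2).2.1)) •
      (sphereRetract x₀ u.1 : EuclideanSpace ℝ (Fin m)) - (inner ℝ u.1 u.2.1 • u.1 - u.2.1) = u.2.1
    rw [h1, sliceHeight, inner_neg_right]
    module
  · refine (halves l).symm_apply_eq.2 (Prod.ext rfl (Prod.ext ?_ (Subsingleton.elim _ _)))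
    exact neg_neg _

/-- Besides `½(q dp - p dq)` there is now `½ d⟪x, y⟫ - y dx = ½(x dy - y dx)`, which is `½ w ∧ dw`.
-/
theorem jetProdForm_pullback {A G X : Type*} [NormedAddCommGroup A] [NormedSpace ℝ A]
    [TopologicalSpace G] {J : ModelWithCorners ℝ A G} [TopologicalSpace X] [ChartedSpace G X]
    (x₀ : UnitSphere m) {γ : X → SplitSpace m l}
    (hγ : ContMDiff J 𝓘(ℝ, SplitSpace m l) ∞ γ) (hγ₁ : ∀ x, ‖(γ x).1‖ = 1) (x : X) (v : A) :
    OneForm.pullback (I := J) (fun x => sliceToJetProd x₀ (γ x)) (jetProdForm m l) x v =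
      linearLiouville (stdComplexStructure l) (γ x) (vectorDeriv J γ x v) := by
  have h := isSmoothRetraction_prodRetract l x₀
  have h0 : (γ x).1 ≠ 0 := norm_pos_iff.1 ((hγ₁ x) ▸ one_pos)
  have hγd := (hγ x).mdifferentiableAt (by simp)
  have hf : ContMDiffAt J (prodModel m l) ∞ (fun x => sliceBase x₀ (γ x)) x :=
    (contMDiffAt_sliceBase x₀ h0).comp x (hγ x)
  have hP : ContMDiffAt J 𝓘(ℝ, _) ∞ (fun x => negPairing (γ x)) x :=
    contDiff_negPairing.contMDiff.contMDiffAt.comp x (hγ x)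
  have hz : ContMDiffAt J 𝓘(ℝ, ℝ) ∞ (fun x => sliceHeight (γ x)) x :=
    contDiff_sliceHeight.contMDiff.contMDiffAt.comp x (hγ x)
  refine (jet1Form_pullback h hf hP hz v).trans ?_
  let Q : SplitSpace m l →L[ℝ] EuclideanSpace ℝ (Fin l) × EuclideanSpace ℝ (Fin l) ×
      EuclideanSpace ℝ (Fin (2 * 0)) := ((halves l).toContinuousLinearMap).comp
    ((ContinuousLinearMap.snd ℝ _ _).comp (ContinuousLinearMap.snd ℝ _ _))
  have h4 : (fun y => prodIncl m l (sliceBase x₀ (γ y))) =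
      fun y => ((ContinuousLinearMap.fst ℝ _ _).prod
        ((ContinuousLinearMap.fst ℝ _ _).comp Q)) (γ y) :=
    funext fun y => Prod.ext (coe_sphereRetract_of_norm x₀ (hγ₁ y)) rfl
  rw [h4, vectorDeriv_clm_comp_apply _ hγd,
    vectorDeriv_comp_apply (contDiff_sliceHeight.contDiffAt.differentiableAt (n := ∞) (by simp)) hγd]
  generalize γ x = u
  generalize vectorDeriv J γ x v = w
  have h5 : fderiv ℝ sliceHeight u w = 1 / 2 * (inner ℝ u.1 w.2.1 + inner ℝ w.1 u.2.1) +
      1 / 2 * (inner ℝ (halves l u.2.2).1 (halves l w.2.2).2.1 +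
        inner ℝ (halves l w.2.2).1 (halves l u.2.2).2.1) := by
    obtain ⟨hd, hd'⟩ := fderiv_inner_fst_snd u w
    obtain ⟨he, he'⟩ := fderiv_inner_fst_snd (Q u) (Q w)
    have h6 := he.hasFDerivAt.comp u Q.hasFDerivAt
    have h7 := (hd.hasFDerivAt.const_mul (1 / 2)).add (h6.const_mul (1 / 2))
    rw [show fderiv ℝ sliceHeight u w = _ from DFunLike.congr_fun h7.fderiv w]
    simp only [add_apply, smul_apply, ContinuousLinearMap.comp_apply, hd', he', smul_eq_mul]
    rfl
  rw [h5, negPairing_apply, linearLiouville, inner_stdComplexStructure_halves]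
  show _ + -(inner ℝ u.2.1 w.1 + inner ℝ (halves l u.2.2).2.1 (halves l w.2.2).1) = _
  rw [real_inner_comm u.2.1 w.1, real_inner_comm (halves l u.2.2).2.1 (halves l w.2.2).1]
  ring

theorem contactomorphic_jetProdForm {n k : ℕ} [NeZero n] (e : Fin n ≃ Fin m ⊕ Fin l)
    (hO : ∀ v, v ∈ coordPlane n k ↔ (splitLinear e v).1 = 0) (x₀ : sphereCompl n k)
    (θ₀ : UnitSphere m) : Contactomorphic (sphereForm n k) (jetProdForm m l) :=
  contactomorphic_of_slice e hO x₀
    (fun _ hu => contMDiffAt_sliceToJetProd θ₀ (norm_pos_iff.1 (hu ▸ one_pos)))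
    (contMDiff_jetProdToSlice θ₀) (fun b => norm_eq_of_mem_sphere b.1.proj.1)
    (sliceToJetProd_jetProdToSlice θ₀) (fun _ hu => jetProdToSlice_sliceToJetProd θ₀ hu)
    (fun _ hγ hγ₁ => jetProdForm_pullback θ₀ hγ hγ₁)

end JetProd

/-! ### The main theorem -/

theorem lemma1p2 (n : ℕ) [NeZero n] (k : ℕ) (hk₁ : 1 ≤ k) (hk₂ : k < 2 * n) :
    (ConvexAtInfinity (sphereForm n k) ∧
      ∀ W : Set (sphereCompl n k), IsOpen W →
        {x : sphereCompl n k |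
          ((x : UnitSphere (2 * n)) : EuclideanSpace ℝ (Fin (2 * n))) ∈ (coordPlane n k)ᗮ} ⊆ W →
        ∃ σ ∈ contractingEmbeddings (sphereForm n k), Set.range σ ⊆ W) ∧
    (n ≤ k →
      letI : NeZero (2 * n - k) := ⟨Nat.sub_ne_zero_of_lt hk₂⟩
      Contactomorphic (sphereForm n k) (jetTimesForm (2 * n - k) (k - n)) ∧
      Contactomorphic (sphereForm n k) (jetProdForm (2 * n - k) (k - n))) := by
  refine ⟨⟨convexAtInfinity_sphereForm hk₁ hk₂, fun W hW hWE =>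
    exists_contractingEmbedding_sphereCompl hk₂ hW hWE⟩, fun hnk => ?_⟩
  have : NeZero (2 * n - k) := ⟨Nat.sub_ne_zero_of_lt hk₂⟩
  have h : n = (2 * n - k) + (k - n) := by omega
  have hO := mem_coordPlane_iff_split hnk h
  -- The points `x₀` and `θ₀` serve only as dummy values of the radial projections outside their
  -- domains.
  have x₀ : sphereCompl n k := ⟨⟨EuclideanSpace.single ⟨0, by omega⟩ 1, by simp⟩, fun hx => by
    have := (mem_coordPlane_iff k).1 hx ⟨0, by omega⟩ (by simpa using hk₂)
    simp at this⟩
  have θ₀ : UnitSphere (2 * n - k) := ⟨EuclideanSpace.single ⟨0, by omega⟩ 1, by simp⟩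
  exact ⟨contactomorphic_jetTimesForm _ hO x₀ θ₀, contactomorphic_jetProdForm _ hO x₀ θ₀⟩

end
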